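/- A \emph{rendez-vous protocol} $\mathcal P=(Q_P,Q_L,\Sigma,q_i,q_f,q_i^L,q_f^L,E)$ consists of disjoint finite sets $Q_P$ (process states) and $Q_L$ (leader states), a finite alphabet $\Sigma$, initial and final states $q_i,q_f\in Q_P$ and $q_i^L,q_f^L\in Q_L$, and a set of edges $E\subseteq (Q_P\times R\times Q_P)\cup(Q_L\times R\times Q_L)$, where $R=\{?a,!a\mid a\in\Sigma\}$. It is \emph{symmetric} if $(q,!a,q')\in E\iff(q,?a,q')\in E$ for all states $q,q'$ and all $a\in\Sigma$. A configuration is a finite multiset of states that contains exactly one leader state (counted with multiplicity). There is a step $C\to C'$ if there are $a\in\Sigma$ and edges $(q_1,?a,q_2),(q_1',!a,q_2')\in E$ such that the multiset $q_1+q_1'$ is contained in $C$ and $C'=C-(q_1+q_1')+(q_2+q_2')$; let $\to^*$ be the reflexive and transitive closure of $\to$. For $n\in\mathbb N$, let $C_i^{(n)}$ consist of $q_i^L$ and $n$ copies of $q_i$, and let $C_f^{(n)}$ consist of $q_f^L$ and $n$ copies of $q_f$. The protocol \emph{has a cut-off} if there is $B\in\mathbb N$ such that $C_i^{(n)}\to^*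 C_f^{(n)}$ for all $n\ge B$. The \emph{cut-off problem} asks whether a given rendez-vous protocol has a cut-off. Protocols are given as words, by numbering the states and the letters and listing the numbers of process states, of leader states and of letters, the four distinguished states and the edges (all the numbers in unary). \textbf{Theorem.} The cut-off problem restricted to symmetric rendez-vous protocols is in PSPACE. That is, the language of the words that encode a symmetric rendez-vous protocol with a cut-off is decided by a deterministic Turing machine whose space is bounded by a polynomial in the length of the input. -/

import Mathlib

/-! ### Polynomial space -/

/-- `InPSPACE L`: the language `L` is decided in polynomial space by a deterministic machine.

The machine model is Mathlib's `Turing.FinTM2`, a deterministic Turing machine with finite control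
whose tapes are given by finitely many stacks (here all with finite alphabets).  The input word `w`
is written on the stack `k₀`; on every `w` the machine must halt, with the single answer bit
"`w ∈ L`" on the stack `k₁` and nothing else left.  The space used by a configuration is the total
number of symbols on all the stacks, the input included; it has to be bounded by a polynomial in
the length of `w`, for all the configurations that occur in the run on `w`. -/
def InPSPACE {Γ : Type} (L : Language Γ) : Prop :=
  ∃ (tm : Turing.FinTM2) (inputAlphabet : tm.Γ tm.k₀ ≃ Γ) (outputAlphabet : tm.Γ tm.k₁ ≃ Bool)
    (p : Polynomial ℕ),
    (∀ k, Finite (tm.Γ k)) ∧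
    ∀ w : List Γ,
      (∃ b : Bool, (b = true ↔ w ∈ L) ∧
        Nonempty (Turing.TM2Outputs tm (w.map inputAlphabet.symm)
          (some [outputAlphabet.symm b]))) ∧
      ∀ c : tm.Cfg,
        StateTransition.Reaches tm.step (Turing.initList tm (w.map inputAlphabet.symm)) c →
        (letI := tm.kFin; ∑ k, (c.stk k).length) ≤ p.eval w.length

/-! ### Rendez-vous protocols -/

/-- The actions over an alphabet `A`: `req a` is the request `?a`, `ans a` is the answer `!a`. -/
inductive RvAction (A : Type) : Type
  | req (a : A) : RvAction A
  | ans (a : A) : RvAction A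

/-- A rendez-vous protocol with process states `QP`, leader states `QL` and alphabet `A`.
The set of all the states is the disjoint union `QP ⊕ QL`, and the set of edges is the union of
`procEdges` and `leaderEdges`. -/
structure RvProtocol (QP QL A : Type) where
  /-- initial state of the processes -/
  procInit : QP
  /-- final state of the processes -/
  procFinal : QP
  /-- initial state of the leader -/
  leaderInit : QL
  /-- final state of the leader -/
  leaderFinal : QL
  /-- edges between process states -/
  procEdges : Set (QP × RvAction A × QP)
  /-- edges between leader states -/
  leaderEdges : Set (QL × RvAction A × QL)

namespace RvProtocol

variable {QP QL A : Type}

/-- `P.HasEdge q α q'`: the triple `(q, α, q')` is an edge of `P`. -/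
inductive HasEdge (P : RvProtocol QP QL A) : QP ⊕ QL → RvAction A → QP ⊕ QL → Prop
  | proc (q q' : QP) (α : RvAction A) (h : (q, α, q') ∈ P.procEdges) :
      HasEdge P (Sum.inl q) α (Sum.inl q')
  | leader (q q' : QL) (α : RvAction A) (h : (q, α, q') ∈ P.leaderEdges) :
      HasEdge P (Sum.inr q) α (Sum.inr q')

/-- The protocol is symmetric: `(q, !a, q')` is an edge iff `(q, ?a, q')` is an edge. -/
def IsSymmetric (P : RvProtocol QP QL A) : Prop :=
  ∀ (q q' : QP ⊕ QL) (a : A), P.HasEdge q (RvAction.ans a) q' ↔ P.HasEdge q (RvAction.req a) q'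

/-- One rendez-vous.  Configurations are multisets of states; the multiset `D` collects the
entities that do not take part, so `C' = C - (q₁ + q₁') + (q₂ + q₂')` with `q₁ + q₁' ≤ C`.
Steps preserve the number of entities in `QL`, so that every multiset that is reachable from an
initial configuration contains exactly one leader state. -/
def Step (P : RvProtocol QP QL A) (C C' : Multiset (QP ⊕ QL)) : Prop :=
  ∃ (a : A) (q₁ q₂ q₁' q₂' : QP ⊕ QL) (D : Multiset (QP ⊕ QL)),
    P.HasEdge q₁ (RvAction.req a) q₂ ∧ P.HasEdge q₁' (RvAction.ans a) q₂' ∧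
    C = {q₁, q₁'} + D ∧ C' = {q₂, q₂'} + D

/-- The initial configuration with `n` processes. -/
def initConfig (P : RvProtocol QP QL A) (n : ℕ) : Multiset (QP ⊕ QL) :=
  {Sum.inr P.leaderInit} + Multiset.replicate n (Sum.inl P.procInit)

/-- The final configuration with `n` processes. -/
def finalConfig (P : RvProtocol QP QL A) (n : ℕ) : Multiset (QP ⊕ QL) :=
  {Sum.inr P.leaderFinal} + Multiset.replicate n (Sum.inl P.procFinal)

/-- There is a cut-off: from some number of processes on, the final configuration is reachable
from the initial one. -/
def HasCutoff (P : RvProtocol QP QL A) : Prop :=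
  ∃ B : ℕ, ∀ n : ℕ, B ≤ n →
    Relation.ReflTransGen P.Step (P.initConfig n) (P.finalConfig n)

end RvProtocol

/-! ### Protocols as words -/

/-- The number `n` in unary, as a self-delimiting word `1ⁿ0`. -/
def unaryCode (n : ℕ) : List Bool :=
  List.replicate n true ++ [false]

/-- The code of an edge between numbered states, with a numbered letter. -/
def edgeCode {m s : ℕ} : Fin m × RvAction (Fin s) × Fin m → List Bool
  | (q, RvAction.req a, q') => unaryCode q ++ false :: unaryCode a ++ unaryCode q'
  | (q, RvAction.ans a, q') => unaryCode q ++ true :: unaryCode a ++ unaryCode q'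

namespace RvProtocol

/-- `P.IsEncodedBy w`: the word `w` is a code of the protocol `P`, whose process states, leader
states and letters are numbered from `0`.  The word lists the numbers of process states, of leader
states and of letters, the four distinguished states, and then the edges (in any order, the ones
of the processes before the ones of the leader); a bit before each edge says which kind it is. -/
def IsEncodedBy {m l s : ℕ} (P : RvProtocol (Fin m) (Fin l) (Fin s)) (w : List Bool) : Prop :=
  ∃ (EP : List (Fin m × RvAction (Fin s) × Fin m)) (EL : List (Fin l × RvAction (Fin s) × Fin l)),
    (∀ e, e ∈ EP ↔ e ∈ P.procEdges) ∧ (∀ e, e ∈ EL ↔ e ∈ P.leaderEdges) ∧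
    w = unaryCode m ++ unaryCode l ++ unaryCode s ++
      unaryCode P.procInit ++ unaryCode P.procFinal ++
      unaryCode P.leaderInit ++ unaryCode P.leaderFinal ++
      EP.flatMap (fun e => true :: edgeCode e) ++ EL.flatMap (fun e => false :: edgeCode e)

end RvProtocol

/-- The cut-off problem restricted to symmetric rendez-vous protocols, as a language: the codes of
the symmetric protocols that have a cut-off. -/
def symmetricCutoffProblem : Language Bool :=
  {w | ∃ (m l s : ℕ) (P : RvProtocol (Fin m) (Fin l) (Fin s)),
    P.IsEncodedBy w ∧ P.IsSymmetric ∧ P.HasCutoff}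

/-! In a symmetric protocol two processes in the same state can take any edge together, one
requesting and the other answering (`IsSymmetric.move_pair`). Pairs thus move freely, and with
enough processes only the parity of their number in each state matters. Call a process edge useful
if it lies on a path from the initial to the final process state. A run from an initial to a final
configuration uses only useful process edges, so it projects to a walk on pairs of a leader state
and a vector of parities over `ZMod 2` (`IsSymmetric.reachable_parity`). Conversely, let a parity
walk of length `N` be given. Send pairs of processes from the initial state until every useful state
holds `2 * N` of them, which changes no parity; imitate the walk (`IsSymmetric.walk_of_parity`);
then every state except the final one holds an even number of processes, which go home in pairs
(`IsSymmetric.finish`). Hence a cut-off exists iff two parity walks exist, one for even and one for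
odd numbers of processes (`IsSymmetric.hasCutoff_iff`).

The graph of parities is exponential, but its steps commute with translations of the vector. If a
walk visits one leader state often, the closed pieces between the visits have linearly dependent
sums, and pieces with total sum zero can be cut out. So walks of length at most `l * (m + 1)`
suffice, for `l` leader and `m` process states (`exists_short_walk`). Such a walk is coded by one
number with polynomially many bits, and all these numbers can be tried one after the other in the
same space (`PSpace.bddWalk`).

Only space has to be counted on the side of the machines. Register programs with increments,
decrements and loops are compiled to stack machines that hold each register in binary
(`Run.reaches`). The functions they compute with polynomially many bits are closed under composition
and under recursion with small intermediate values (`IsComputable.comp`, `IsComputable.recur`),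
whatever the number of rounds. Arithmetic, bounded quantifiers and parsing follow, and membership
becomes a formula in this calculus (`mem_symmetricCutoffProblem_iff`, `PSpace.accepts`). -/

/-! ### Register programs -/

/-- Structured programs over registers that hold natural numbers. -/
inductive RegProg (R : Type) : Type
  | inc (r : R) : RegProg R
  | dec (r : R) : RegProg R
  | seq (p q : RegProg R) : RegProg R
  | loop (r : R) (p : RegProg R) : RegProg R

namespace RegProg

open Function Relation Turing

/-- `Run B p s s'`: started in the state `s`, the program `p` ends in the state `s'`, and no
register ever exceeds `B` by an increment. -/
inductive Run {R : Type} [DecidableEq R] (B : ℕ) : RegProg R → (R → ℕ) → (R → ℕ) → Prop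
  | inc {r : R} {s : R → ℕ} (h : s r < B) : Run B (.inc r) s (update s r (s r + 1))
  | dec {r : R} {s : R → ℕ} : Run B (.dec r) s (update s r (s r - 1))
  | seq {p q : RegProg R} {s s' s'' : R → ℕ} (h : Run B p s s') (h' : Run B q s' s'') :
      Run B (.seq p q) s s''
  | loop_zero {r : R} {p : RegProg R} {s : R → ℕ} (h : s r = 0) : Run B (.loop r p) s s
  | loop_step {r : R} {p : RegProg R} {s s' s'' : R → ℕ} (h : s r ≠ 0) (h' : Run B p s s')
      (h'' : Run B (.loop r p) s' s'') : Run B (.loop r p) s s''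

/-- Only an increment raises a register, and the premise of `Run.inc` guards it. -/
theorem Run.le {R : Type} [DecidableEq R] {B : ℕ} {p : RegProg R} {s s' : R → ℕ}
    (h : Run B p s s') (hs : ∀ r, s r ≤ B) : ∀ r, s' r ≤ B := by
  induction h with
  | @inc r s h =>
    intro r'
    rcases eq_or_ne r' r with rfl | hr
    · simpa using h
    · simpa [hr] using hs r'
  | @dec r s =>
    intro r'
    rcases eq_or_ne r' r with rfl | hr
    · have := hs r'
      simp only [update_self]
      omega
    · simpa [hr] using hs r'
  | seq _ _ ih ih' => exact ih' (ih hs)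
  | loop_zero _ => exact hs
  | loop_step _ _ _ ih ih' => exact ih' (ih hs)

end RegProg

/-! ### Bijective binary numerals -/

/-- The value of a word as a numeral with the digits `1` (`false`) and `2` (`true`), the least
significant digit first.  Every number is the value of exactly one word. -/
def numVal : List Bool → ℕ
  | [] => 0
  | b :: l => 2 * numVal l + (if b then 2 else 1)

/-- The successor on numerals. -/
def incWord : List Bool → List Bool
  | [] => [false]
  | false :: l => true :: l
  | true :: l => false :: incWord l

/-- The predecessor on numerals. -/
def decWord : List Bool → List Bool
  | [] => []
  | true :: l => false :: l
  | [false] => []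
  | false :: b :: l => true :: decWord (b :: l)

/-- The numeral of a number. -/
def num (n : ℕ) : List Bool := incWord^[n] []

theorem numVal_incWord (l : List Bool) : numVal (incWord l) = numVal l + 1 := by
  induction l with
  | nil => rfl
  | cons b l ih => cases b <;> simp [incWord, numVal, ih]; omega

theorem num_succ (n : ℕ) : num (n + 1) = incWord (num n) := by
  rw [num, Function.iterate_succ_apply', num]

theorem incWord_ne_nil (l : List Bool) : incWord l ≠ [] := by
  rcases l with _ | ⟨_ | _, l⟩ <;> simp [incWord]

theorem decWord_incWord (l : List Bool) : decWord (incWord l) = l := by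
  induction l with
  | nil => rfl
  | cons b l ih =>
    cases b
    · rfl
    · rcases h : incWord l with _ | ⟨c, l'⟩
      · exact absurd h (incWord_ne_nil l)
      · rw [incWord, h, decWord, ← h, ih]

theorem decWord_num (n : ℕ) : decWord (num n) = num (n - 1) := by
  cases n with
  | zero => rfl
  | succ n => rw [num_succ, decWord_incWord, Nat.add_sub_cancel]

theorem numVal_num (n : ℕ) : numVal (num n) = n := by
  induction n with
  | zero => rfl
  | succ n ih => rw [num_succ, numVal_incWord, ih]

/-- The parity of a nonzero value determines the lowest digit. Because numerals are unique, every
input word is itself the content of a register, and zero is the empty stack. -/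
theorem numVal_injective : Function.Injective numVal := by
  intro l
  induction l with
  | nil =>
    intro l' h
    rcases l' with _ | ⟨_ | _, l'⟩
    · rfl
    all_goals simp [numVal] at h
  | cons b l ih =>
    intro l' h
    rcases l' with _ | ⟨b', l'⟩
    · cases b <;> simp [numVal] at h
    · cases b <;> cases b' <;> simp only [numVal, Bool.false_eq_true, if_true, if_false] at h
      · rw [ih (by omega : numVal l = numVal l')]
      · omega
      · omega
      · rw [ih (by omega : numVal l = numVal l')]

theorem num_numVal (w : List Bool) : num (numVal w) = w := numVal_injective (numVal_num _)

/-- With `k` digits the least value is `2 ^ k - 1`, all digits being 1; the greatest, behind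
`numVal_lt`, is `2 ^ (k + 1) - 2`. -/
theorem two_pow_length_le (w : List Bool) : 2 ^ w.length ≤ numVal w + 1 := by
  induction w with
  | nil => simp [numVal]
  | cons b l ih =>
    rw [List.length_cons, pow_succ, numVal]
    split_ifs <;> omega

theorem numVal_lt (w : List Bool) : numVal w + 1 < 2 ^ (w.length + 1) := by
  induction w with
  | nil => simp [numVal]
  | cons b l ih =>
    rw [List.length_cons, pow_succ, numVal]
    split_ifs <;> omega

theorem length_num_le {n c : ℕ} (h : n < 2 ^ c) : (num n).length ≤ c := by
  have := two_pow_length_le (num n)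
  rw [numVal_num] at this
  exact (Nat.pow_le_pow_iff_right (by norm_num : 1 < 2)).1 (this.trans h)

theorem num_eq_nil_iff {n : ℕ} : num n = [] ↔ n = 0 := by
  constructor
  · intro h
    rw [← numVal_num n, h, numVal]
  · rintro rfl
    rfl

/-! ### Compilation to stack machines -/

namespace RegProg

open Function Relation Turing

variable {R : Type}

/-- The program points of a register program. -/
def Lab : RegProg R → Type
  | .inc _ => Bool
  | .dec _ => Bool
  | .seq p q => Lab p ⊕ Lab q
  | .loop _ p => Option (Lab p)

/-- There are finitely many program points. -/
@[reducible] def labFintype : (p : RegProg R) → Fintype (Lab p)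
  | .inc _ => inferInstanceAs (Fintype Bool)
  | .dec _ => inferInstanceAs (Fintype Bool)
  | .seq p q => @instFintypeSum _ _ (labFintype p) (labFintype q)
  | .loop _ p => @instFintypeOption _ (labFintype p)

/-- The entry point of a program. -/
def entry : (p : RegProg R) → Lab p
  | .inc _ => false
  | .dec _ => false
  | .seq p _ => Sum.inl (entry p)
  | .loop _ _ => none

/-- Statements of the machine with one stack for every register and an additional stack `none`
for carries. -/
abbrev StackStmt (R Λ : Type) : Type := TM2.Stmt (fun _ : Option R => Bool) Λ (Option Bool)

/-- Configurations of the machine with one stack for every register and an additional stack. -/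
abbrev StackCfg (R Λ : Type) : Type := TM2.Cfg (fun _ : Option R => Bool) Λ (Option Bool)

/-- Go to a label with cleared internal state. -/
def jump {Λ : Type} (l : Λ) : StackStmt R Λ := .load (fun _ => none) (.goto fun _ => l)

/-- Move the digits on the additional stack back to the stack of `r`. -/
def restoreStmt {Λ : Type} (r : R) (self exit : Λ) : StackStmt R Λ :=
  .pop none (fun _ x => x)
    (.branch Option.isNone (jump exit) (.push (some r) (fun v => v.getD false) (jump self)))

/-- Propagate a carry. -/
def incStmt {Λ : Type} (r : R) (self next : Λ) : StackStmt R Λ :=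
  .pop (some r) (fun _ x => x)
    (.branch (fun v => v == some true) (.push none (fun _ => false) (jump self))
      (.branch Option.isNone (.push (some r) (fun _ => false) (jump next))
        (.push (some r) (fun _ => true) (jump next))))

/-- Propagate a borrow. -/
def decStmt {Λ : Type} (r : R) (self next : Λ) : StackStmt R Λ :=
  .pop (some r) (fun _ x => x)
    (.branch (fun v => v == some false) (.push none (fun _ => true) (jump self))
      (.branch Option.isNone (.pop none (fun _ _ => none) (jump next))
        (.push (some r) (fun _ => false) (jump next))))

/-- Leave the loop if the register `r` is zero. -/
def testStmt {Λ : Type} (r : R) (body exit : Λ) : StackStmt R Λ :=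
  .peek (some r) (fun _ x => x) (.branch Option.isNone (jump exit) (jump body))

/-- The machine code of a program; `emb` places its program points among all the labels, and
`exit` is the label where to continue after the program. -/
def code : {Λ : Type} → (p : RegProg R) → (Lab p → Λ) → Λ → Lab p → StackStmt R Λ
  | _, .inc r, emb, _, false => incStmt r (emb false) (emb true)
  | _, .inc r, emb, exit, true => restoreStmt r (emb true) exit
  | _, .dec r, emb, _, false => decStmt r (emb false) (emb true)
  | _, .dec r, emb, exit, true => restoreStmt r (emb true) exit
  | _, .seq p q, emb, _, Sum.inl l =>
      code p (fun l => emb (Sum.inl l)) (emb (Sum.inr (entry q))) l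
  | _, .seq _ q, emb, exit, Sum.inr l => code q (fun l => emb (Sum.inr l)) exit l
  | _, .loop r p, emb, exit, none => testStmt r (emb (some (entry p))) exit
  | _, .loop _ p, emb, _, some l => code p (fun l => emb (some l)) (emb none) l

/-- The number of symbols on all the stacks. -/
def stackSize [Fintype R] (S : Option R → List Bool) : ℕ := ∑ k, (S k).length

variable [DecidableEq R] {Λ : Type}

/-- The stacks `S` with new contents for the stack of `r` and the additional stack. -/
def setStacks (S : Option R → List Bool) (r : R) (l t : List Bool) : Option R → List Bool :=
  update (update S (some r) l) none t

theorem setStacks_pop_reg (S : Option R → List Bool) (r : R) (l l' t : List Bool) :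
    update (setStacks S r l t) (some r) l' = setStacks S r l' t := by
  funext k
  rcases k with _ | k
  · simp [setStacks]
  · rcases eq_or_ne k r with rfl | h <;> simp [setStacks, *]

theorem setStacks_pop_none (S : Option R → List Bool) (r : R) (l t t' : List Bool) :
    update (setStacks S r l t) none t' = setStacks S r l t' := by
  simp [setStacks]

@[simp] theorem setStacks_none (S : Option R → List Bool) (r : R) (l t : List Bool) :
    setStacks S r l t none = t := by simp [setStacks]

@[simp] theorem setStacks_some (S : Option R → List Bool) (r : R) (l t : List Bool) :
    setStacks S r l t (some r) = l := by simp [setStacks]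

theorem stackSize_setStacks [Fintype R] (S : Option R → List Bool) (r : R) (l t : List Bool) :
    stackSize (setStacks S r l t) = stackSize (setStacks S r [] []) + l.length + t.length := by
  have key : ∀ l t, stackSize (setStacks S r l t) =
      t.length + (l.length + ∑ k ∈ Finset.univ.erase r, (S (some k)).length) := by
    intro l t
    rw [stackSize, Fintype.sum_option, setStacks_none,
      ← Finset.add_sum_erase _ _ (Finset.mem_univ r), setStacks_some]
    congr 2
    refine Finset.sum_congr rfl fun k hk => ?_
    have : k ≠ r := (Finset.mem_erase.1 hk).1
    simp [setStacks, this]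
  rw [key, key]
  simp only [List.length_nil]
  omega

/-! ### Correctness and space of the machine code -/

/-- One step of the machine, from a configuration of size at most `M`. -/
def SpaceStep [Fintype R] (m : Λ → StackStmt R Λ) (M : ℕ) (a b : StackCfg R Λ) : Prop :=
  TM2.step m a = some b ∧ stackSize a.stk ≤ M

theorem restore_spec [Fintype R] {m : Λ → StackStmt R Λ} {M : ℕ} {r : R} {self exit : Λ}
    (hm : m self = restoreStmt r self exit) (S : Option R → List Bool) :
    ∀ l t : List Bool, stackSize (setStacks S r [] []) + l.length + t.length ≤ M →
      ReflTransGen (SpaceStep m M) ⟨some self, none, setStacks S r l t⟩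
        ⟨some exit, none, setStacks S r (t.reverse ++ l) []⟩ := by
  intro l t
  induction t generalizing l with
  | nil =>
    intro h
    refine .single ⟨?_, (stackSize_setStacks S r l []).le.trans h⟩
    simp [hm, restoreStmt, jump, setStacks_pop_none]
  | cons b t ih =>
    intro h
    refine .head (b := ⟨some self, none, setStacks S r (b :: l) t⟩)
      ⟨?_, (stackSize_setStacks S r l (b :: t)).le.trans h⟩ ?_
    · simp [hm, restoreStmt, jump, setStacks_pop_none, setStacks_pop_reg]
    · have := ih (b :: l) (by simp only [List.length_cons] at h ⊢; omega)
      simpa using this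

/-- The digits passed by the carry wait in `t`, already changed from 2 to 1, so `t` has to be
arbitrary in the induction. The `+ 1` pays for a new leading digit. -/
theorem inc_spec [Fintype R] {m : Λ → StackStmt R Λ} {M : ℕ} {r : R} {self next exit : Λ}
    (hm : m self = incStmt r self next) (hm' : m next = restoreStmt r next exit)
    (S : Option R → List Bool) :
    ∀ l t : List Bool, stackSize (setStacks S r [] []) + l.length + t.length + 1 ≤ M →
      ReflTransGen (SpaceStep m M) ⟨some self, none, setStacks S r l t⟩
        ⟨some exit, none, setStacks S r (t.reverse ++ incWord l) []⟩ := by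
  intro l t
  induction l generalizing t with
  | nil =>
    intro h
    refine .head (b := ⟨some next, none, setStacks S r [false] t⟩)
      ⟨?_, (stackSize_setStacks S r [] t).le.trans (by omega)⟩ (restore_spec hm' S _ _ ?_)
    · simp [hm, incStmt, jump, setStacks_pop_reg]
    · simp only [List.length_nil, List.length_cons] at h ⊢; omega
  | cons b l ih =>
    intro h
    cases b
    · refine .head (b := ⟨some next, none, setStacks S r (true :: l) t⟩)
        ⟨?_, (stackSize_setStacks S r _ t).le.trans (by omega)⟩ (restore_spec hm' S _ _ ?_)
      · simp [hm, incStmt, jump, setStacks_pop_reg]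
      · simp only [List.length_cons] at h ⊢; omega
    · refine .head (b := ⟨some self, none, setStacks S r l (false :: t)⟩)
        ⟨?_, (stackSize_setStacks S r _ t).le.trans (by omega)⟩ ?_
      · simp [hm, incStmt, jump, setStacks_pop_reg, setStacks_pop_none]
      · have := ih (false :: t) (by simp only [List.length_cons] at h ⊢; omega)
        simpa [incWord] using this

theorem dec_spec [Fintype R] {m : Λ → StackStmt R Λ} {M : ℕ} {r : R} {self next exit : Λ}
    (hm : m self = decStmt r self next) (hm' : m next = restoreStmt r next exit)
    (S : Option R → List Bool) (l : List Bool)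
    (h : stackSize (setStacks S r [] []) + l.length ≤ M) :
      ReflTransGen (SpaceStep m M) ⟨some self, none, setStacks S r l []⟩
        ⟨some exit, none, setStacks S r (decWord l) []⟩ := by
  -- For `l = []` and nonempty `t` this would fail, because the code then discards the top digit of
  -- `t`.
  have key : ∀ l t : List Bool, l ≠ [] →
      stackSize (setStacks S r [] []) + l.length + t.length ≤ M →
      ReflTransGen (SpaceStep m M) ⟨some self, none, setStacks S r l t⟩
        ⟨some exit, none, setStacks S r (t.reverse ++ decWord l) []⟩ := by
    intro l t
    induction l generalizing t with
    | nil => exact fun h => absurd rfl h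
    | cons b l ih =>
      intro _ h
      cases b
      · refine .head (b := ⟨some self, none, setStacks S r l (true :: t)⟩)
          ⟨?_, (stackSize_setStacks S r _ t).le.trans (by omega)⟩ ?_
        · simp [hm, decStmt, jump, setStacks_pop_reg, setStacks_pop_none]
        · rcases l with _ | ⟨c, l⟩
          -- The leading digit 1 vanishes: the 2 stored for it is the symbol that the code discards.
          · refine .head (b := ⟨some next, none, setStacks S r [] t⟩)
              ⟨?_, (stackSize_setStacks S r _ _).le.trans ?_⟩ (restore_spec hm' S _ _ ?_)
            · simp [hm, decStmt, jump, setStacks_pop_reg, setStacks_pop_none]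
            · simp only [List.length_cons] at h ⊢; omega
            · simp only [List.length_cons, List.length_nil] at h ⊢; omega
          · have := ih (true :: t) (by simp) (by simp only [List.length_cons] at h ⊢; omega)
            simpa [decWord] using this
      · refine .head (b := ⟨some next, none, setStacks S r (false :: l) t⟩)
          ⟨?_, (stackSize_setStacks S r _ t).le.trans (by omega)⟩ (restore_spec hm' S _ _ ?_)
        · simp [hm, decStmt, jump, setStacks_pop_reg]
        · simp only [List.length_cons] at h ⊢; omega
  rcases eq_or_ne l [] with rfl | hl
  -- For zero both stacks are empty, and popping the additional one has no effect.
  · refine .head (b := ⟨some next, none, setStacks S r [] []⟩)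
      ⟨?_, (stackSize_setStacks S r _ _).le.trans h⟩ (restore_spec hm' S _ _ h)
    simp [hm, decStmt, jump, setStacks_pop_reg, setStacks_pop_none]
  · simpa using key l [] hl h

/-- The stacks that represent the state `s`. -/
def stacksOf (s : R → ℕ) (k : Option R) : List Bool := k.elim [] fun r => num (s r)

theorem setStacks_stacksOf (s : R → ℕ) (r : R) (n : ℕ) :
    setStacks (stacksOf s) r (num n) [] = stacksOf (update s r n) := by
  funext k
  rcases k with _ | k
  · simp [stacksOf]
  · rcases eq_or_ne k r with rfl | h <;> simp [setStacks, stacksOf, *]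

theorem setStacks_stacksOf_self (s : R → ℕ) (r : R) :
    setStacks (stacksOf s) r (num (s r)) [] = stacksOf s := by
  rw [setStacks_stacksOf, update_eq_self]

theorem stackSize_stacksOf_le {R : Type} [Fintype R] {s : R → ℕ} {c : ℕ} (h : ∀ r, s r < 2 ^ c) :
    stackSize (stacksOf s) ≤ Fintype.card R * c := by
  rw [stackSize, Fintype.sum_option]
  simp only [stacksOf, Option.elim, List.length_nil, zero_add]
  refine (Finset.sum_le_card_nsmul _ _ c fun r _ => length_num_le (h r)).trans ?_
  simp

/-- Induction on the run; `exit` varies, since a subprogram continues at a label of its context. At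
rest the stacks need at most `c` digits per register; the extra symbol is for the carry of an
increment. -/
theorem Run.reaches [Fintype R] {B c : ℕ} (hB : B < 2 ^ c) {p : RegProg R} {s s' : R → ℕ}
    (h : Run B p s s') {m : Λ → StackStmt R Λ} {emb : Lab p → Λ} {exit : Λ}
    (hm : ∀ l, m (emb l) = code p emb exit l) (hs : ∀ r, s r ≤ B) :
    ReflTransGen (SpaceStep m (Fintype.card R * c + 1))
      ⟨some (emb (entry p)), none, stacksOf s⟩ ⟨some exit, none, stacksOf s'⟩ := by
  induction h generalizing exit with
  | @inc r s h =>
    have h1 := stackSize_setStacks (stacksOf s) r (num (s r)) []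
    rw [setStacks_stacksOf_self, List.length_nil] at h1
    have h2 := stackSize_stacksOf_le fun r => (hs r).trans_lt hB
    have := inc_spec (hm false) (hm true) (stacksOf s) (num (s r)) []
      (show _ ≤ Fintype.card R * c + 1 by rw [List.length_nil]; omega)
    rwa [setStacks_stacksOf_self, List.reverse_nil, List.nil_append, ← num_succ,
      setStacks_stacksOf] at this
  | @dec r s =>
    have h1 := stackSize_setStacks (stacksOf s) r (num (s r)) []
    rw [setStacks_stacksOf_self, List.length_nil] at h1
    have h2 := stackSize_stacksOf_le fun r => (hs r).trans_lt hB
    have := dec_spec (hm false) (hm true) (stacksOf s) (num (s r))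
      (show _ ≤ Fintype.card R * c + 1 by omega)
    rwa [setStacks_stacksOf_self, decWord_num, setStacks_stacksOf] at this
  | seq h h' ih ih' =>
    exact (ih (fun l => hm (Sum.inl l)) hs).trans (ih' (fun l => hm (Sum.inr l)) (h.le hs))
  | @loop_zero r p s h =>
    refine .single ⟨?_, (stackSize_stacksOf_le fun r => (hs r).trans_lt hB).trans (by simp)⟩
    have := hm none
    simp [entry, this, code, testStmt, jump, stacksOf, h, num]
  | @loop_step r p s s' s'' h h' h'' ih ih' =>
    refine .head (b := ⟨some (emb (some (entry p))), none, stacksOf s⟩)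
      ⟨?_, (stackSize_stacksOf_le fun r => (hs r).trans_lt hB).trans (by simp)⟩
      ((ih (fun l => hm (some l)) hs).trans (ih' hm (h'.le hs)))
    have := hm none
    have h1 : num (s r) ≠ [] := fun e => h (num_eq_nil_iff.1 e)
    obtain ⟨b, l, hbl⟩ := List.exists_cons_of_ne_nil h1
    simp [entry, this, code, testStmt, jump, stacksOf, hbl]

/-- The machine that runs a program and halts. -/
def machine [Fintype R] (p : RegProg R) (i o : R) : FinTM2 :=
  letI := labFintype p
  { K := Option R
    k₀ := some i
    k₁ := some o
    Γ := fun _ => Bool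
    Λ := Option (Lab p)
    main := some (entry p)
    σ := Option Bool
    initialState := none
    Γk₀Fin := inferInstanceAs (Fintype Bool)
    m := fun l => l.elim .halt (code p some none) }

/-- A language is in PSPACE if its characteristic function, with the values `1` and `2`, is
computed by a register program whose registers have polynomially many digits. -/
theorem inPSPACE [Fintype R] (L : Language Bool) (p : RegProg R) (i o : R) (P : Polynomial ℕ)
    (hp : ∀ w : List Bool, ∃ B < 2 ^ P.eval w.length, ∃ b : Bool, (b = true ↔ w ∈ L) ∧
      numVal w ≤ B ∧
      Run B p (update (fun _ => 0) i (numVal w)) (update (fun _ => 0) o (numVal [b]))) :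
    InPSPACE L := by
  refine ⟨machine p i o, Equiv.refl _, Equiv.refl _, Polynomial.C (Fintype.card R) * P + 1,
    fun _ => inferInstanceAs (Finite Bool), fun w => ?_⟩
  obtain ⟨B, hB, b, hb, hwB, hrun⟩ := hp w
  have hs : ∀ r, update (fun _ : R => 0) i (numVal w) r ≤ B := by
    intro r
    rcases eq_or_ne r i with rfl | h <;> simp [*]
  have hpath := hrun.reaches hB (Λ := Option (Lab p)) (emb := some) (exit := none)
    (m := (machine p i o).m) (fun l => rfl) hs
  have hinit : initList (machine p i o) (w.map (Equiv.refl Bool).symm) =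
      ⟨some (some (entry p)), none, stacksOf (update (fun _ : R => 0) i (numVal w))⟩ := by
    unfold initList
    congr 1
    funext k
    rcases k with _ | k
    · rfl
    · by_cases h : k = i
      · subst h
        simp [machine, stacksOf, num_numVal]
        rfl
      · simp [machine, stacksOf, num, h]
  have hhalt : haltList (machine p i o) [(Equiv.refl Bool).symm b] =
      ⟨none, none, stacksOf (update (fun _ : R => 0) o (numVal [b]))⟩ := by
    unfold haltList
    congr 1
    funext k
    rcases k with _ | k
    · rfl
    · by_cases h : k = o
      · subst h
        simp [machine, stacksOf, num_numVal]
        rfl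
      · simp [machine, stacksOf, num, h]
  set M := Fintype.card R * P.eval w.length + 1 with hM
  have hM' : (Polynomial.C (Fintype.card R) * P + 1).eval w.length = M := by simp [hM]
  have hend : stackSize (stacksOf (update (fun _ : R => 0) o (numVal [b]))) ≤ M :=
    (stackSize_stacksOf_le fun r => (hrun.le hs r).trans_lt hB).trans (by omega)
  have hfull := hpath.tail (c := ⟨none, none, stacksOf (update (fun _ : R => 0) o (numVal [b]))⟩)
    ⟨rfl, hend⟩
  have hout : ∀ a, ReflTransGen (SpaceStep (machine p i o).m M) a
      ⟨none, none, stacksOf (update (fun _ : R => 0) o (numVal [b]))⟩ →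
      Nonempty (StateTransition.EvalsTo (machine p i o).step a
          (some ⟨none, none, stacksOf (update (fun _ : R => 0) o (numVal [b]))⟩)) := by
    intro a h
    induction h using ReflTransGen.head_induction_on with
    | refl => exact ⟨.refl _ _⟩
    | head h _ ih =>
      obtain ⟨ih⟩ := ih
      exact ⟨.trans _ _ _ _ ⟨1, h.1⟩ ih⟩
  -- The machine is deterministic, so every reachable configuration lies on the run already found,
  -- where all sizes are bounded.
  have hspace : ∀ a, ReflTransGen (SpaceStep (machine p i o).m M) a
      ⟨none, none, stacksOf (update (fun _ : R => 0) o (numVal [b]))⟩ →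
      ∀ d, StateTransition.Reaches (machine p i o).step a d →
      stackSize d.stk ≤ M := by
    intro a h
    induction h using ReflTransGen.head_induction_on with
    | refl =>
      intro d hd
      rcases ReflTransGen.cases_head hd with rfl | ⟨e, he, _⟩
      · exact hend
      · exact absurd (show (none : Option (machine p i o).Cfg) = some e from he) (by simp)
    | @head a b' h _ ih =>
      intro d hd
      rcases ReflTransGen.cases_head hd with rfl | ⟨e, he, hed⟩
      · exact h.2
      · obtain rfl : b' = e := Option.some_injective _ (h.1.symm.trans he)
        exact ih d hed
  have hfull' : ReflTransGen (SpaceStep (machine p i o).m M)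
      (initList (machine p i o) (w.map (Equiv.refl Bool).symm))
      ⟨none, none, stacksOf (update (fun _ : R => 0) o (numVal [b]))⟩ := by
    rw [hinit]
    exact hfull
  have hout' : Nonempty (TM2Outputs (machine p i o) (w.map (Equiv.refl Bool).symm)
      (some [(Equiv.refl Bool).symm b])) := by
    unfold TM2Outputs
    rw [Option.map_some, hhalt]
    exact hout _ hfull'
  rw [hM']
  exact ⟨⟨b, hb, hout'⟩, hspace _ hfull'⟩

end RegProg

/-! ### Functions that are computable in polynomial space -/

/-- Types whose elements are coded by a fixed number of natural numbers. -/
class Coded (α : Type) where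
  /-- the number of components -/
  dim : ℕ
  /-- the components of an element -/
  get : α → Fin dim → ℕ

/-- Types whose elements are coded by one natural number. -/
class ScalarCoded (α : Type) where
  /-- the code of an element -/
  code : α → ℕ

-- Predicates are functions with values 0 and 1, so one calculus serves for both.
open Classical in
noncomputable instance : ScalarCoded Prop := ⟨fun p => if p then 1 else 0⟩

instance : ScalarCoded ℕ := ⟨id⟩

instance : ScalarCoded (List Bool) := ⟨numVal⟩

instance {α : Type} [ScalarCoded α] : Coded α := ⟨1, fun a _ => ScalarCoded.code a⟩

instance {α β : Type} [Coded α] [Coded β] : Coded (α × β) :=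
  ⟨Coded.dim α + Coded.dim β, fun a => Fin.append (Coded.get a.1) (Coded.get a.2)⟩

/-- The number of bits of the code of an element. -/
def csize {α : Type} [Coded α] (a : α) : ℕ := ∑ i, (Coded.get a i).size

theorem csize_prod {α β : Type} [Coded α] [Coded β] (a : α) (b : β) :
    csize (a, b) = csize a + csize b := by
  simp only [csize]
  change ∑ i : Fin (Coded.dim α + Coded.dim β),
    (Fin.append (Coded.get a) (Coded.get b) i).size = _
  simp [Fin.sum_univ_add]

theorem csize_scalar {α : Type} [ScalarCoded α] (a : α) :
    csize a = (ScalarCoded.code a).size := by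
  change ∑ i : Fin 1, (ScalarCoded.code a).size = _
  simp

theorem eval_mono_nat (P : Polynomial ℕ) {m n : ℕ} (h : m ≤ n) : P.eval m ≤ P.eval n := by
  induction P using Polynomial.induction_on' with
  | add p q hp hq => simpa using add_le_add hp hq
  | monomial k a =>
    simp only [Polynomial.eval_monomial]
    gcongr

/-- `f` is bounded by a polynomial in the number of bits of its argument. -/
def PolyBdd {α : Type} [Coded α] (f : α → ℕ) : Prop :=
  ∃ P : Polynomial ℕ, ∀ a, f a ≤ P.eval (csize a)

namespace RegProg

open Function

/-- The program `p` computes `f` from the registers `x` into the register `o`, with the registers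
from `t` on for auxiliary values, provided that registers may have `P` many bits. -/
def Computes {α : Type} [Coded α] (f : α → ℕ) (P : Polynomial ℕ) (x : Fin (Coded.dim α) → ℕ)
    (o t : ℕ) (p : RegProg ℕ) : Prop :=
  ∀ (s : ℕ → ℕ) (a : α) (B : ℕ), (∀ i, s (x i) = Coded.get a i) → (∀ r, t ≤ r → s r = 0) →
    s o = 0 → (∀ r, s r ≤ B) → 2 ^ P.eval (csize a) ≤ B → Run B p s (update s o (f a))

/-- `f` is computed by register programs in polynomial space. -/
def IsComputable {α : Type} [Coded α] (f : α → ℕ) : Prop :=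
  ∃ P : Polynomial ℕ, ∀ (x : Fin (Coded.dim α) → ℕ) (o t : ℕ), (∀ i, x i < t) → o < t →
    (∀ i, x i ≠ o) → ∃ p, Computes f P x o t p

/-! ### Basic programs and the closure of computable functions -/

/-- Set a register to zero. -/
def clear (r : ℕ) : RegProg ℕ := .loop r (.dec r)

/-- Add the register `a` to the register `b` and set `a` to zero. -/
def move (a b : ℕ) : RegProg ℕ := .loop a (.seq (.dec a) (.inc b))

/-- Add the register `a` to the register `b`, with the auxiliary register `c`. -/
def copy (a b c : ℕ) : RegProg ℕ :=
  .seq (.loop a (.seq (.dec a) (.seq (.inc b) (.inc c)))) (move c a)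

theorem run_clear (B r : ℕ) (s : ℕ → ℕ) : Run B (clear r) s (update s r 0) := by
  obtain ⟨n, hn⟩ : ∃ n, s r = n := ⟨_, rfl⟩
  induction n generalizing s with
  | zero =>
    rw [show update s r 0 = s by rw [← hn, update_eq_self]]
    exact .loop_zero hn
  | succ n ih =>
    have := ih (update s r (s r - 1)) (by simp [hn])
    rw [update_idem] at this
    exact .loop_step (by omega) .dec this

theorem run_move {B a b : ℕ} (hab : a ≠ b) (s : ℕ → ℕ) (h : s b + s a ≤ B) :
    Run B (move a b) s (update (update s a 0) b (s b + s a)) := by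
  obtain ⟨n, hn⟩ : ∃ n, s a = n := ⟨_, rfl⟩
  induction n generalizing s with
  | zero =>
    rw [hn, add_zero, show update s a 0 = s by rw [← hn, update_eq_self], update_eq_self]
    exact .loop_zero hn
  | succ n ih =>
    set s1 := update s a (s a - 1) with hs1
    have e1 : s1 b = s b := by simp [hs1, hab.symm]
    set s2 := update s1 b (s1 b + 1) with hs2
    have ea : s2 a = n := by simp [hs2, hs1, hab, hn]
    have eb : s2 b = s b + 1 := by simp [hs2, e1]
    have := ih s2 (by omega) ea
    refine .loop_step (by omega) (.seq .dec (.inc (by rw [← hs1]; omega))) ?_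
    rw [← hs1, ← hs2]
    change Run B (move a b) s2 _
    convert this using 1
    funext r
    rcases eq_or_ne r b with rfl | hb
    · simp only [update_self]
      omega
    · rcases eq_or_ne r a with rfl | ha <;> simp [*]

theorem run_copy {B a b c : ℕ} (hab : a ≠ b) (hac : a ≠ c) (hbc : b ≠ c) (s : ℕ → ℕ)
    (hc : s c = 0) (hB : ∀ r, s r ≤ B) (h : s b + s a ≤ B) :
    Run B (copy a b c) s (update s b (s b + s a)) := by
  have key : ∀ (n : ℕ) (s : ℕ → ℕ), s a = n → s b + s a ≤ B → s c + s a ≤ B →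
      Run B (.loop a (.seq (.dec a) (.seq (.inc b) (.inc c)))) s
        (update (update (update s a 0) b (s b + s a)) c (s c + s a)) := by
    intro n
    induction n with
    | zero =>
      intro s hn _ _
      rw [hn, add_zero, add_zero, show update s a 0 = s by rw [← hn, update_eq_self],
        update_eq_self, update_eq_self]
      exact .loop_zero hn
    | succ n ih =>
      intro s hn hb hc
      set s1 := update s a (s a - 1) with hs1
      have e1 : s1 b = s b := by simp [hs1, hab.symm]
      set s2 := update s1 b (s1 b + 1) with hs2
      have e2 : s2 c = s c := by simp [hs2, hs1, hac.symm, hbc.symm]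
      set s3 := update s2 c (s2 c + 1) with hs3
      have ea : s3 a = n := by simp [hs3, hs2, hs1, hab, hac, hn]
      have eb : s3 b = s b + 1 := by simp [hs3, hs2, e1, hbc]
      have ec : s3 c = s c + 1 := by simp [hs3, e2]
      have := ih s3 ea (by omega) (by omega)
      refine .loop_step (by omega) (.seq .dec (.seq (.inc (by rw [← hs1]; omega))
        (.inc (by rw [← hs1, ← hs2]; omega)))) ?_
      rw [← hs1, ← hs2, ← hs3]
      convert this using 1
      funext r
      rcases eq_or_ne r c with rfl | hc
      · simp only [update_self]
        omega
      · rcases eq_or_ne r b with rfl | hb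
        · simp only [ne_eq, hc, not_false_eq_true, update_of_ne, update_self]
          omega
        · rcases eq_or_ne r a with rfl | ha <;> simp [*]
  refine .seq (key _ s rfl h (by rw [hc, zero_add]; exact hB a)) ?_
  set s1 := update (update (update s a 0) b (s b + s a)) c (s c + s a) with hs1
  have e1 : s1 a = 0 := by simp [hs1, hab, hac]
  have e2 : s1 c = s a := by simp [hs1, hc]
  have := run_move hac.symm s1 (B := B) (by rw [e1, e2, zero_add]; exact hB a)
  convert this using 1
  funext r
  rcases eq_or_ne r a with rfl | ha
  · simp [*]
  · rcases eq_or_ne r c with rfl | hc'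
    · simp [*, hbc.symm]
    · rcases eq_or_ne r b with rfl | hb <;> simp [*]

/-- The space bound bounds the output too: by `Run.le` the output register ends at most at `B`, and
a `B` with polynomially many bits is enough for the arguments and the program. -/
theorem IsComputable.polyBdd {α : Type} [Coded α] {f : α → ℕ} (hf : IsComputable f) :
    PolyBdd fun a => (f a).size := by
  obtain ⟨P, hP⟩ := hf
  obtain ⟨p, hp⟩ := hP (fun i => i) (Coded.dim α) (Coded.dim α + 1) (fun i => by omega)
    (by omega) (fun i => by omega)
  refine ⟨P + Polynomial.X + 1, fun a => ?_⟩
  let s : ℕ → ℕ := fun r => if h : r < Coded.dim α then Coded.get a ⟨r, h⟩ else 0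
  let B := 2 ^ (P.eval (csize a) + csize a)
  have hs : ∀ r, s r ≤ B := by
    intro r
    simp only [s]
    split_ifs with h
    · refine (Nat.lt_size_self _).le.trans (Nat.pow_le_pow_right (by norm_num) ?_)
      refine le_trans ?_ (Nat.le_add_left _ _)
      exact Finset.single_le_sum (f := fun i => (Coded.get a i).size) (fun i _ => Nat.zero_le _)
        (Finset.mem_univ (⟨r, h⟩ : Fin (Coded.dim α)))
    · exact Nat.zero_le _
  have := hp s a B (fun i => by simp [s]) (fun r hr => by simp [s]; omega) (by simp [s]) hs
    (Nat.pow_le_pow_right (by norm_num) (Nat.le_add_right _ _))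
  have h1 := this.le hs (Coded.dim α)
  rw [update_self] at h1
  simp only [Polynomial.eval_add, Polynomial.eval_X, Polynomial.eval_one]
  rw [Nat.size_le]
  exact h1.trans_lt (Nat.pow_lt_pow_right (by norm_num) (by omega))

theorem isComputable_get {α : Type} [Coded α] (j : Fin (Coded.dim α)) :
    IsComputable fun a : α => Coded.get a j := by
  refine ⟨0, fun x o t hx ho hxo => ⟨copy (x j) o t, fun s a B hs ht hso hB _ => ?_⟩⟩
  have := run_copy (hxo j) (hx j).ne ho.ne s (ht t le_rfl) hB (by rw [hso, zero_add]; exact hB _)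
  rwa [hso, zero_add, hs j] at this

theorem isComputable_zero {α : Type} [Coded α] : IsComputable fun _ : α => 0 := by
  refine ⟨0, fun x o t _ _ _ => ⟨.dec o, fun s a B _ _ hso _ _ => ?_⟩⟩
  have := Run.dec (B := B) (r := o) (s := s)
  rwa [hso] at this

theorem IsComputable.succ {α : Type} [Coded α] {f : α → ℕ} (hf : IsComputable f) :
    IsComputable fun a => f a + 1 := by
  obtain ⟨Q, hQ⟩ := hf.polyBdd
  obtain ⟨P, hP⟩ := hf
  -- The summand `Q` bounds the bits of `f a` and leaves room for the last increment.
  refine ⟨P + Q, fun x o t hx ho hxo => ?_⟩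
  obtain ⟨p, hp⟩ := hP x o t hx ho hxo
  refine ⟨.seq p (.inc o), fun s a B hs ht hso hB hPB => ?_⟩
  rw [Polynomial.eval_add] at hPB
  refine .seq (hp s a B hs ht hso hB
    (le_trans (Nat.pow_le_pow_right (by norm_num) (by omega)) hPB)) ?_
  have h1 : update s o (f a) o < B := by
    rw [update_self]
    exact (Nat.lt_size_self _).trans_le (le_trans (Nat.pow_le_pow_right (by norm_num)
      ((hQ a).trans (by omega))) hPB)
  have := Run.inc h1
  simpa using this

/-- Compute finitely many functions into consecutive registers. -/
theorem exists_run_tuple {α : Type} [Coded α] (n : ℕ) (g : α → ℕ → ℕ) (P : Polynomial ℕ)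
    (x : Fin (Coded.dim α) → ℕ) (t : ℕ) (hx : ∀ i, x i < t)
    (hg : ∀ j < n, ∃ p, Computes (fun a => g a j) P x (t + j) (t + n) p) :
    ∀ k ≤ n, ∃ p : RegProg ℕ, ∀ (s : ℕ → ℕ) (a : α) (B : ℕ), (∀ i, s (x i) = Coded.get a i) →
      (∀ r, t ≤ r → s r = 0) → (∀ r, s r ≤ B) → 2 ^ P.eval (csize a) ≤ B →
      Run B p s (fun r => if t ≤ r ∧ r < t + k then g a (r - t) else s r) := by
  intro k hk
  induction k with
  | zero =>
    -- There is no empty program; decrementing a register that holds zero replaces it.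
    refine ⟨.dec t, fun s a B _ ht _ _ => ?_⟩
    have := Run.dec (B := B) (r := t) (s := s)
    convert this using 1
    funext r
    rcases eq_or_ne r t with rfl | hr
    · simp [ht r le_rfl]
    · simp [hr]
  | succ k ih =>
    obtain ⟨p, hp⟩ := ih (by omega)
    obtain ⟨q, hq⟩ := hg k (by omega)
    refine ⟨.seq p q, fun s a B hs ht hB hPB => ?_⟩
    have h1 := hp s a B hs ht hB hPB
    have h2 := hq _ a B (fun i => ?_) (fun r hr => ?_) ?_ (h1.le hB) hPB
    · convert Run.seq h1 h2 using 1
      funext r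
      rcases eq_or_ne r (t + k) with rfl | hr
      · simp
      · have : (t ≤ r ∧ r < t + (k + 1)) ↔ (t ≤ r ∧ r < t + k) := by omega
        simp [hr, this]
    · have := hx i
      simp only [show ¬ (t ≤ x i ∧ x i < t + k) by omega, if_false, hs i]
    · simp only [show ¬ (t ≤ r ∧ r < t + k) by omega, if_false]
      exact ht r (by omega)
    · simp only [show ¬ (t ≤ t + k ∧ t + k < t + k) by omega, if_false]
      exact ht _ (by omega)

theorem exists_run_clear (t n u : ℕ) (hu : t + n ≤ u) : ∃ p : RegProg ℕ, ∀ (s : ℕ → ℕ) (B : ℕ),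
    s u = 0 → Run B p s (fun r => if t ≤ r ∧ r < t + n then 0 else s r) := by
  induction n with
  | zero =>
    refine ⟨.dec u, fun s B hs => ?_⟩
    have := Run.dec (B := B) (r := u) (s := s)
    convert this using 1
    funext r
    rcases eq_or_ne r u with rfl | hr
    · simp [hs]
    · simp [hr]
  | succ k ih =>
    obtain ⟨p, hp⟩ := ih (by omega)
    refine ⟨.seq p (clear (t + k)), fun s B hs => ?_⟩
    convert Run.seq (hp s B hs) (run_clear _ _ _) using 1
    funext r
    rcases eq_or_ne r (t + k) with rfl | hr
    · simp
    · have : (t ≤ r ∧ r < t + (k + 1)) ↔ (t ≤ r ∧ r < t + k) := by omega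
      simp [hr, this]

/-- Composition: `f` may be given on the codes of arbitrary arguments. -/
theorem IsComputable.comp {α β : Type} [Coded α] [Coded β] {f : β → ℕ} {φ : α → β}
    (hf : IsComputable f) (hφ : ∀ j, IsComputable fun a => Coded.get (φ a) j) :
    IsComputable fun a => f (φ a) := by
  choose Q hQ using fun j => (hφ j).polyBdd
  choose Pφ hPφ using hφ
  obtain ⟨P, hP⟩ := hf
  let n := Coded.dim β
  let P' := ∑ j, Pφ j
  -- The size of `φ a` is at most the sum of the `Q j`; the program for `f` runs on an argument of
  -- that size.
  refine ⟨P.comp (∑ j, Q j) + P', fun x o t hx ho hxo => ?_⟩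
  let g : α → ℕ → ℕ := fun a j => if h : j < n then Coded.get (φ a) ⟨j, h⟩ else 0
  obtain ⟨p₁, hp₁⟩ := exists_run_tuple n g P' x t hx (fun j hj => by
    obtain ⟨p, hp⟩ := hPφ ⟨j, hj⟩ x (t + j) (t + n) (fun i => (hx i).trans_le (by omega))
      (by omega) (fun i => by have := hx i; omega)
    refine ⟨p, fun s a B hs ht hso hB hPB => ?_⟩
    have := hp s a B hs ht hso hB (le_trans (Nat.pow_le_pow_right (by norm_num) ?_) hPB)
    · simpa [g, hj] using this
    · simp only [P', Polynomial.eval_finsetSum]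
      exact Finset.single_le_sum (f := fun j => (Pφ j).eval (csize a))
        (fun i _ => Nat.zero_le _) (Finset.mem_univ _)) n le_rfl
  obtain ⟨p₂, hp₂⟩ := hP (fun j => t + j) o (t + n) (fun j => by omega) (by omega)
    (fun j => by omega)
  obtain ⟨p₃, hp₃⟩ := exists_run_clear t n (t + n) le_rfl
  refine ⟨.seq p₁ (.seq p₂ p₃), fun s a B hs ht hso hB hPB => ?_⟩
  rw [Polynomial.eval_add] at hPB
  have h1 := hp₁ s a B hs ht hB (le_trans (Nat.pow_le_pow_right (by norm_num) (by omega)) hPB)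
  have hle : csize (φ a) ≤ (∑ j, Q j).eval (csize a) := by
    rw [Polynomial.eval_finsetSum]
    exact Finset.sum_le_sum fun j _ => hQ j a
  have h2 := hp₂ _ (φ a) B (fun j => ?_) (fun r hr => ?_) ?_ (h1.le hB)
    (le_trans (Nat.pow_le_pow_right (by norm_num)
      (le_trans (eval_mono_nat P hle) (by rw [← Polynomial.eval_comp]; omega))) hPB)
  · have h3 := hp₃ (update (fun r => if t ≤ r ∧ r < t + n then g a (r - t) else s r) o (f (φ a)))
      B ?_
    · convert Run.seq h1 (.seq h2 h3) using 1
      funext r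
      by_cases hr : t ≤ r ∧ r < t + n
      · have : r ≠ o := by omega
        simp [hr, this, ht r hr.1]
      · rcases eq_or_ne r o with rfl | hro
        · simp [hr]
        · simp [hr, hro]
    · rw [update_of_ne (by omega)]
      simp only [show ¬ (t ≤ t + n ∧ t + n < t + n) by omega, if_false]
      exact ht _ (by omega)
  · have hj : (j : ℕ) < n := j.isLt
    simp [g, hj]
  · simp only [show ¬ (t ≤ r ∧ r < t + n) by omega, if_false]
    exact ht r (by omega)
  · simp only [show ¬ (t ≤ o ∧ o < t + n) by omega, if_false]
    exact hso

/-- Recursion along the natural numbers with polynomially many bits in the intermediate values. -/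
theorem IsComputable.recur {α β : Type} [Coded α] [ScalarCoded β] {f : α → β}
    {h : α × ℕ × β → β} {c : α → ℕ} (hf : IsComputable fun a => ScalarCoded.code (f a))
    (hh : IsComputable fun a => ScalarCoded.code (h a)) (hc : IsComputable c)
    (F : α → ℕ → β) (hF0 : ∀ a, F a 0 = f a) (hFs : ∀ a i, F a (i + 1) = h (a, i, F a i))
    (hF : ∃ P : Polynomial ℕ, ∀ a, ∀ i ≤ c a, (ScalarCoded.code (F a i)).size ≤ P.eval (csize a)) :
    IsComputable fun a => ScalarCoded.code (F a (c a)) := by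
  obtain ⟨Q, hQ⟩ := hF
  obtain ⟨Qc, hQc⟩ := hc.polyBdd
  obtain ⟨Pc, hPc⟩ := hc
  obtain ⟨Pf, hPf⟩ := hf
  obtain ⟨Ph, hPh⟩ := hh
  -- The argument of `h` consists of `a`, an index below `c a` and a value of `F`, whence the size
  -- at which `Ph` is evaluated. The last `Qc` lets the index grow to `c a`.
  refine ⟨Pc + Pf + Ph.comp (Polynomial.X + Qc + Q) + Qc, fun x o t hx ho hxo => ?_⟩
  obtain ⟨pc, hpc⟩ := hPc x t (t + 3) (fun i => (hx i).trans (by omega)) (by omega)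
    (fun i => (hx i).ne)
  obtain ⟨pf, hpf⟩ := hPf x o (t + 3) (fun i => (hx i).trans (by omega)) (by omega) hxo
  obtain ⟨ph, hph⟩ := hPh (Fin.append (m := Coded.dim α) (n := Coded.dim (ℕ × β)) x
    (Fin.append (m := 1) (n := 1) (fun _ => t + 1) (fun _ => o))) (t + 2) (t + 3)
    (by
      intro i
      refine Fin.addCases (fun i => ?_) (fun i => ?_) i
      · rw [Fin.append_left]
        exact (hx i).trans (by omega)
      · rw [Fin.append_right]
        refine Fin.addCases (m := 1) (n := 1) (fun i => ?_) (fun i => ?_) i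
        · rw [Fin.append_left]; omega
        · rw [Fin.append_right]; omega) (by omega)
    (by
      intro i
      refine Fin.addCases (fun i => ?_) (fun i => ?_) i
      · rw [Fin.append_left]
        have := hx i
        omega
      · rw [Fin.append_right]
        refine Fin.addCases (m := 1) (n := 1) (fun i => ?_) (fun i => ?_) i
        · rw [Fin.append_left]; omega
        · rw [Fin.append_right]; omega)
  -- Register `t` counts the remaining rounds, `t + 1` holds the index, `t + 2` receives the new
  -- value, and `o` holds the current one.
  let body : RegProg ℕ :=
    .seq (.dec t) (.seq ph (.seq (clear o) (.seq (move (t + 2) o) (.inc (t + 1)))))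
  refine ⟨.seq pc (.seq pf (.seq (.loop t body) (clear (t + 1)))),
    fun s a B hs ht hso hB hPB => ?_⟩
  simp only [Polynomial.eval_add, Polynomial.eval_comp, Polynomial.eval_X] at hPB
  have hpow : ∀ {k}, k ≤ Pc.eval (csize a) + Pf.eval (csize a) +
      Ph.eval (csize a + Qc.eval (csize a) + Q.eval (csize a)) + Qc.eval (csize a) → 2 ^ k ≤ B :=
    fun hk => (Nat.pow_le_pow_right (by norm_num) hk).trans hPB
  have hcB : c a < B :=
    (Nat.lt_size_self _).trans_le (hpow ((hQc a).trans (by omega)))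
  -- The state with `k` rounds left and `i` rounds done.
  let S : ℕ → ℕ → ℕ → ℕ := fun k i =>
    update (update (update s t k) (t + 1) i) o (ScalarCoded.code (F a i))
  have ho1 : o ≠ t := by omega
  have ho2 : o ≠ t + 1 := by omega
  have ho3 : o ≠ t + 2 := by omega
  have hx0 : ∀ i, x i ≠ t := fun i => (hx i).ne
  have hx1 : ∀ i, x i ≠ t + 1 := fun i => by have := hx i; omega
  have hloop : ∀ k i, k + i = c a → (∀ r, S k i r ≤ B) →
      Run B (.loop t body) (S k i) (S 0 (c a)) := by
    intro k
    induction k with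
    | zero =>
      intro i hi _
      rw [← hi, zero_add]
      exact .loop_zero (by simp [S, ho1.symm])
    | succ k ih =>
      intro i hi hSB
      have r1 := Run.dec (B := B) (r := t) (s := S (k + 1) i)
      have e1 : update (S (k + 1) i) t (S (k + 1) i t - 1) = S k i := by
        funext r
        rcases eq_or_ne r t with rfl | hr
        · simp [S, ho1.symm]
        · simp only [S, update_of_ne hr]
          rcases eq_or_ne r o with rfl | hro
          · simp
          · rcases eq_or_ne r (t + 1) with rfl | hr1 <;> simp [*]
      rw [e1] at r1
      have hSk := r1.le hSB
      have r2 := hph (S k i) (a, i, F a i) B ?_ ?_ ?_ hSk ?_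
      · have hS2 := r2.le hSk
        have r3 := run_clear B o (update (S k i) (t + 2) (ScalarCoded.code (h (a, i, F a i))))
        have r4 := run_move (B := B) (a := t + 2) (b := o) ho3.symm
          (update (update (S k i) (t + 2) (ScalarCoded.code (h (a, i, F a i)))) o 0) (by
          have := hS2 (t + 2)
          rw [update_self] at this
          rw [update_self, zero_add, update_of_ne ho3.symm, update_self]
          exact this)
        have r34 := r3.seq r4
        have e2 : update (update (update (update (S k i) (t + 2)
            (ScalarCoded.code (h (a, i, F a i)))) o 0) (t + 2) 0) o
            (update (update (S k i) (t + 2) (ScalarCoded.code (h (a, i, F a i)))) o 0 o +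
              update (update (S k i) (t + 2) (ScalarCoded.code (h (a, i, F a i)))) o 0 (t + 2)) =
            update (update (update s t k) (t + 1) i) o (ScalarCoded.code (F a (i + 1))) := by
          funext r
          rcases eq_or_ne r o with rfl | hro
          · simp [hFs, ho3.symm]
          · rcases eq_or_ne r (t + 2) with rfl | hr2
            · simp [ho3.symm, ht (t + 2) (by omega)]
            · simp [hro, hr2, S]
        rw [e2] at r34
        have r5 := Run.inc (B := B) (r := t + 1)
          (s := update (update (update s t k) (t + 1) i) o (ScalarCoded.code (F a (i + 1))))
          (by
            rw [update_of_ne ho2.symm, update_self]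
            omega)
        have e3 : update (update (update (update s t k) (t + 1) i) o
            (ScalarCoded.code (F a (i + 1)))) (t + 1) (update (update (update s t k) (t + 1) i) o
            (ScalarCoded.code (F a (i + 1))) (t + 1) + 1) = S k (i + 1) := by
          funext r
          rcases eq_or_ne r (t + 1) with rfl | hr1
          · simp [S, ho2.symm]
          · rcases eq_or_ne r o with rfl | hro
            · simp [S, hr1]
            · simp [S, hr1, hro]
        rw [e3] at r5
        have hbody : Run B body (S (k + 1) i) (S k (i + 1)) := by
          refine r1.seq (r2.seq ?_)
          cases r34 with
          | seq ra rb => exact ra.seq (rb.seq r5)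
        exact .loop_step (by simp [S, ho1.symm]) hbody (ih (i + 1) (by omega) (hbody.le hSB))
      · intro j
        refine Fin.addCases (m := Coded.dim α) (n := Coded.dim (ℕ × β)) (fun j => ?_)
          (fun j => ?_) j
        · rw [Fin.append_left]
          change _ = Fin.append (Coded.get a) (Coded.get (i, F a i)) _
          rw [Fin.append_left, ← hs j]
          simp [S, hx0, hx1, hxo]
        · rw [Fin.append_right]
          change _ = Fin.append (Coded.get a) (Coded.get (i, F a i)) _
          rw [Fin.append_right]
          refine Fin.addCases (m := 1) (n := 1) (fun j => ?_) (fun j => ?_) j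
          · rw [Fin.append_left]
            change _ = Fin.append (m := 1) (n := 1) (Coded.get i) (Coded.get (F a i)) _
            rw [Fin.append_left]
            simp only [S, update_of_ne ho2.symm, update_self]
            rfl
          · rw [Fin.append_right]
            change _ = Fin.append (m := 1) (n := 1) (Coded.get i) (Coded.get (F a i)) _
            rw [Fin.append_right]
            simp only [S, update_self]
            rfl
      · intro r hr
        have h1 : r ≠ t := by omega
        have h2 : r ≠ t + 1 := by omega
        have h3 : r ≠ o := by omega
        simp [S, h1, h2, h3, ht r (by omega)]
      · simp [S, ho3.symm, ht (t + 2) (by omega)]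
      · refine hpow (le_trans (eval_mono_nat Ph (?_ : _ ≤
          csize a + Qc.eval (csize a) + Q.eval (csize a))) (by omega))
        rw [csize_prod, csize_prod, csize_scalar, csize_scalar, add_assoc]
        have h1 : (ScalarCoded.code i).size ≤ Qc.eval (csize a) :=
          (Nat.size_le_size (show i ≤ c a by omega)).trans (hQc a)
        have h2 := hQ a i (by omega)
        omega
  have r1 := hpc s a B hs (fun r hr => ht r (by omega)) (ht t le_rfl) hB (hpow (by omega))
  have r2 := hpf _ a B (fun i => by rw [update_of_ne (hx0 i), hs]) (fun r hr => by
    rw [update_of_ne (by omega), ht r (by omega)]) (by rw [update_of_ne ho1, hso])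
    (r1.le hB) (hpow (by omega))
  have e2 : update (update s t (c a)) o (ScalarCoded.code (f a)) = S (c a) 0 := by
    funext r
    rcases eq_or_ne r o with rfl | hro
    · simp [S, hF0]
    · rcases eq_or_ne r (t + 1) with rfl | hr1
      · simp [S, hro, ht (t + 1) (by omega)]
      · simp [S, hro, hr1]
  have hB2 := r2.le (r1.le hB)
  rw [e2] at r2 hB2
  have r3 := hloop (c a) 0 (by omega) hB2
  have r4 := run_clear B (t + 1) (S 0 (c a))
  convert r1.seq (r2.seq (r3.seq r4)) using 1
  funext r
  rcases eq_or_ne r o with rfl | hro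
  · simp [S, ho2]
  · rcases eq_or_ne r (t + 1) with rfl | hr1
    · simp [hro, ht (t + 1) (by omega)]
    · rcases eq_or_ne r t with rfl | hr0
      · simp [S, hro, ht r le_rfl]
      · simp [S, hro, hr1, hr0]

/-! #### Finitely many registers -/

/-- Rename the registers of a program. -/
def map {R R' : Type} (e : R → R') : RegProg R → RegProg R'
  | .inc r => .inc (e r)
  | .dec r => .dec (e r)
  | .seq p q => .seq (map e p) (map e q)
  | .loop r p => .loop (e r) (map e p)

/-- All the registers of the program are smaller than this number. -/
def regBound : RegProg ℕ → ℕ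
  | .inc r => r + 1
  | .dec r => r + 1
  | .seq p q => max (regBound p) (regBound q)
  | .loop r p => max (r + 1) (regBound p)

/-- A machine has finitely many stacks. Reduction modulo `N` makes no two registers of the program
collide, as they are all below `regBound p`. -/
theorem Run.map_fin {N B : ℕ} [NeZero N] {p : RegProg ℕ} {s s' : ℕ → ℕ} (h : Run B p s s')
    (hN : regBound p ≤ N) :
    Run B (p.map (Fin.ofNat N)) (fun i : Fin N => s i) (fun i : Fin N => s' i) := by
  have hupd : ∀ (s : ℕ → ℕ) (r v : ℕ), r < N →
      (fun i : Fin N => update s r v i) = update (fun i : Fin N => s i) (Fin.ofNat N r) v := by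
    intro s r v hr
    funext i
    by_cases hi : i = Fin.ofNat N r
    · subst hi
      simp [Nat.mod_eq_of_lt hr]
    · have : (i : ℕ) ≠ r := by
        rintro rfl
        exact hi (by simp)
      rw [update_of_ne this, update_of_ne hi]
  have hval : ∀ (s : ℕ → ℕ) (r : ℕ), r < N → s (Fin.ofNat N r) = s r := by
    intro s r hr
    simp [Nat.mod_eq_of_lt hr]
  induction h with
  | @inc r s h =>
    rw [hupd _ _ _ hN, ← hval s r hN]
    exact .inc (by rw [hval s r hN]; exact h)
  | @dec r s =>
    rw [hupd _ _ _ hN, ← hval s r hN]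
    exact .dec
  | seq _ _ ih ih' =>
    exact .seq (ih ((le_max_left _ _).trans hN)) (ih' ((le_max_right _ _).trans hN))
  | @loop_zero r p s h =>
    exact .loop_zero (by rw [hval s r ((le_max_left _ _).trans hN)]; exact h)
  | @loop_step r p s s' s'' h _ _ ih ih' =>
    exact .loop_step (by rw [hval s r ((le_max_left _ _).trans hN)]; exact h)
      (ih ((le_max_right _ _).trans hN)) (ih' hN)

/-- A language with computable membership is in PSPACE. -/
theorem IsComputable.inPSPACE {L : Language Bool}
    (hL : IsComputable fun w : List Bool => ScalarCoded.code (w ∈ L)) : InPSPACE L := by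
  obtain ⟨P, hP⟩ := hL
  obtain ⟨p, hp⟩ := hP (fun _ => 0) 1 2 (fun _ => by omega) (by omega) (fun _ => by omega)
  -- Nothing but the answer may remain, so the input is cleared; the truth value 0 or 1 is raised to
  -- 1 or 2, the values of `[false]` and `[true]`.
  let q : RegProg ℕ := .seq p (.seq (clear 0) (.inc 1))
  have : NeZero (max (regBound q) 2) := ⟨by omega⟩
  set N := max (regBound q) 2 with hN
  refine RegProg.inPSPACE L (q.map (Fin.ofNat N)) (Fin.ofNat N 0) (Fin.ofNat N 1)
    (P.comp (Polynomial.X + 1) + Polynomial.X + 3) fun w => ?_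
  classical
  have hsz : csize w ≤ w.length + 1 := by
    rw [csize_scalar, Nat.size_le]
    have := numVal_lt w
    exact (Nat.lt_succ_self _).trans this
  set B := 2 ^ (P.eval (w.length + 1) + w.length + 2) with hBdef
  have hwB : numVal w ≤ B := by
    have h1 := numVal_lt w
    have h2 : 2 ^ (w.length + 1) ≤ B := Nat.pow_le_pow_right (by norm_num) (by omega)
    omega
  have hB4 : 2 ^ 2 ≤ B := Nat.pow_le_pow_right (by norm_num) (by omega)
  refine ⟨B, ?_, decide (w ∈ L), by simp, hwB, ?_⟩
  · simp only [Polynomial.eval_add, Polynomial.eval_comp, Polynomial.eval_X,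
      Polynomial.eval_one, Polynomial.eval_ofNat]
    exact Nat.pow_lt_pow_right (by norm_num) (by omega)
  have r1 := hp (update (fun _ => 0) 0 (numVal w)) w B (fun i => rfl)
    (fun r hr => update_of_ne (by omega) _ _) rfl
    (fun r => by
      rcases eq_or_ne r 0 with rfl | h
      · exact hwB
      · rw [update_of_ne h]
        exact Nat.zero_le _)
    (Nat.pow_le_pow_right (by norm_num) ((eval_mono_nat P hsz).trans (by omega)))
  have r2 := run_clear B 0 (update (update (fun _ => 0) 0 (numVal w)) 1
    (ScalarCoded.code (w ∈ L)))
  have hcode : ScalarCoded.code (w ∈ L) ≤ 1 := by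
    simp only [ScalarCoded.code]
    split_ifs <;> omega
  have r3 := Run.inc (B := B) (r := 1) (s := update (update (update (fun _ => 0) 0 (numVal w)) 1
    (ScalarCoded.code (w ∈ L))) 0 0) (by
      simp only [ne_eq, one_ne_zero, not_false_eq_true, update_of_ne, update_self]
      omega)
  have r := (r1.seq (r2.seq r3)).map_fin (N := N) (le_max_left _ _)
  have h01 : Fin.ofNat N 0 ≠ Fin.ofNat N 1 := by
    intro h
    have := congrArg Fin.val h
    simp only [Fin.val_ofNat] at this
    rw [Nat.mod_eq_of_lt (by omega), Nat.mod_eq_of_lt (by omega)] at this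
    omega
  have hv : ∀ r < 2, ∀ i : Fin N, ((i : ℕ) = r ↔ i = Fin.ofNat N r) := by
    intro r hr i
    rw [Fin.ext_iff, Fin.val_ofNat, Nat.mod_eq_of_lt (by omega)]
  convert r using 1
  · funext i
    by_cases h : i = Fin.ofNat N 0
    · have h' := (hv 0 (by omega) i).2 h
      rw [h', update_self, h, update_self]
    · have h' : (i : ℕ) ≠ 0 := fun h' => h ((hv 0 (by omega) i).1 h')
      rw [update_of_ne h, update_of_ne h']
  · funext i
    by_cases h : i = Fin.ofNat N 1
    · have h' := (hv 1 (by omega) i).2 h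
      rw [h', update_self, h, update_self]
      simp only [ne_eq, one_ne_zero, not_false_eq_true, update_of_ne, update_self,
        ScalarCoded.code]
      by_cases hw : w ∈ L <;> simp [hw, numVal]
    · have h' : (i : ℕ) ≠ 1 := fun h' => h ((hv 1 (by omega) i).1 h')
      rw [update_of_ne h, update_of_ne h']
      by_cases h0 : (i : ℕ) = 0
      · rw [h0, update_self]
      · rw [update_of_ne h0, update_of_ne h', update_of_ne h0]

end RegProg

section

open RegProg

/-- `f` is computable in polynomial space. -/
@[fun_prop]
def PSpace {α β : Type} [Coded α] [Coded β] (f : α → β) : Prop :=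
  ∀ j, IsComputable fun a => Coded.get (f a) j

/-! ### Polynomial bounds -/

namespace PolyBdd

variable {α β : Type} [Coded α] [Coded β] {f g : α → ℕ}

theorem mono (hg : PolyBdd g) (h : ∀ a, f a ≤ g a) : PolyBdd f := by
  obtain ⟨P, hP⟩ := hg
  exact ⟨P, fun a => (h a).trans (hP a)⟩

theorem const (n : ℕ) : PolyBdd fun _ : α => n := ⟨n, fun a => by simp⟩

theorem csize : PolyBdd fun a : α => csize a := ⟨Polynomial.X, fun a => by simp⟩

theorem add (hf : PolyBdd f) (hg : PolyBdd g) : PolyBdd fun a => f a + g a := by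
  obtain ⟨P, hP⟩ := hf
  obtain ⟨Q, hQ⟩ := hg
  exact ⟨P + Q, fun a => by simpa using add_le_add (hP a) (hQ a)⟩

theorem mul (hf : PolyBdd f) (hg : PolyBdd g) : PolyBdd fun a => f a * g a := by
  obtain ⟨P, hP⟩ := hf
  obtain ⟨Q, hQ⟩ := hg
  exact ⟨P * Q, fun a => by simpa using Nat.mul_le_mul (hP a) (hQ a)⟩

theorem size (hf : PSpace f) : PolyBdd fun a => (f a).size := (hf (0 : Fin 1)).polyBdd

theorem csize_comp {φ : α → β} (hφ : PSpace φ) : PolyBdd fun a => _root_.csize (φ a) := by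
  choose P hP using fun j => (hφ j).polyBdd
  refine ⟨∑ j, P j, fun a => ?_⟩
  rw [Polynomial.eval_finsetSum]
  exact Finset.sum_le_sum fun j _ => hP j a

theorem comp {f : β → ℕ} (hf : PolyBdd f) {φ : α → β} (hφ : PSpace φ) :
    PolyBdd fun a => f (φ a) := by
  obtain ⟨P, hP⟩ := hf
  obtain ⟨Q, hQ⟩ := csize_comp hφ
  refine ⟨P.comp Q, fun a => (hP _).trans ?_⟩
  rw [Polynomial.eval_comp]
  exact eval_mono_nat P (hQ a)

theorem length : PolyBdd fun w : List Bool => w.length := by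
  refine csize.mono fun w => ?_
  rw [csize_scalar]
  have h1 := two_pow_length_le w
  have h2 := Nat.lt_size_self (numVal w)
  exact (Nat.pow_le_pow_iff_right (by norm_num : 1 < 2)).1 (h1.trans h2)

end PolyBdd

theorem size_numVal_le (w : List Bool) : (numVal w).size ≤ w.length + 1 := by
  rw [Nat.size_le]
  have := numVal_lt w
  omega

theorem length_le_numVal (w : List Bool) : w.length ≤ numVal w := by
  induction w with
  | nil => rfl
  | cons b w ih =>
    rw [numVal, List.length_cons]
    split_ifs <;> omega

/-! ### Closure properties of `PSpace` -/

namespace PSpace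

variable {α β γ : Type} [Coded α] [Coded β] [Coded γ]

theorem of_code {δ : Type} [ScalarCoded δ] {f : α → δ} {g : α → ℕ} (hg : PSpace g)
    (h : ∀ a, ScalarCoded.code (f a) = g a) : PSpace f := by
  intro j
  have : (fun a => ScalarCoded.code (f a)) = g := funext h
  change IsComputable fun a => ScalarCoded.code (f a)
  rw [this]
  exact hg (0 : Fin 1)

theorem code {δ : Type} [ScalarCoded δ] {f : α → δ} (hf : PSpace f) :
    PSpace fun a => ScalarCoded.code (f a) := fun _ => hf (0 : Fin 1)

@[fun_prop]
theorem comp {g : β → γ} {f : α → β} (hg : PSpace g) (hf : PSpace f) :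
    PSpace fun a => g (f a) := fun j => (hg j).comp hf

@[fun_prop]
theorem id : PSpace fun a : α => a := fun j => isComputable_get j

@[fun_prop]
theorem const (b : β) : PSpace fun _ : α => b := by
  intro j
  change IsComputable fun _ => Coded.get b j
  induction Coded.get b j with
  | zero => exact isComputable_zero
  | succ n ih => exact ih.succ

@[fun_prop]
theorem fst : PSpace fun a : α × β => a.1 := by
  intro j
  have h := isComputable_get (α := α × β) (Fin.castAdd (Coded.dim β) j)
  convert h using 2 with a
  change _ = Fin.append (Coded.get a.1) (Coded.get a.2) _
  rw [Fin.append_left]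

@[fun_prop]
theorem snd : PSpace fun a : α × β => a.2 := by
  intro j
  have h := isComputable_get (α := α × β) (Fin.natAdd (Coded.dim α) j)
  convert h using 2 with a
  change _ = Fin.append (Coded.get a.1) (Coded.get a.2) _
  rw [Fin.append_right]

@[fun_prop]
theorem prodMk {f : α → β} {g : α → γ} (hf : PSpace f) (hg : PSpace g) :
    PSpace fun a => (f a, g a) := by
  intro j
  refine Fin.addCases (m := Coded.dim β) (n := Coded.dim γ) (fun j => ?_) (fun j => ?_) j
  · convert hf j using 2 with a
    change Fin.append (Coded.get (f a)) (Coded.get (g a)) _ = _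
    rw [Fin.append_left]
  · convert hg j using 2 with a
    change Fin.append (Coded.get (f a)) (Coded.get (g a)) _ = _
    rw [Fin.append_right]

@[fun_prop]
theorem succ {f : α → ℕ} (hf : PSpace f) : PSpace fun a => f a + 1 := fun _ =>
  (hf (0 : Fin 1)).succ

theorem recur {δ : Type} [ScalarCoded δ] {f : α → δ} {h : α × ℕ × δ → δ} {c : α → ℕ}
    (hf : PSpace f) (hh : PSpace h) (hc : PSpace c) (F : α → ℕ → δ) (hF0 : ∀ a, F a 0 = f a)
    (hFs : ∀ a i, F a (i + 1) = h (a, i, F a i)) {b : α → ℕ} (hb : PolyBdd b)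
    (hF : ∀ a, ∀ i ≤ c a, (ScalarCoded.code (F a i)).size ≤ b a) : PSpace fun a => F a (c a) := by
  obtain ⟨P, hP⟩ := hb
  exact fun _ => IsComputable.recur (hf (0 : Fin 1)) (hh (0 : Fin 1)) (hc (0 : Fin 1)) F hF0 hFs
    ⟨P, fun a i hi => (hF a i hi).trans (hP a)⟩

/-- Recursion with a computable bound on the intermediate values. -/
theorem recur_of_le {δ : Type} [ScalarCoded δ] {f : α → δ} {h : α × ℕ × δ → δ} {c b : α → ℕ}
    (hf : PSpace f) (hh : PSpace h) (hc : PSpace c) (F : α → ℕ → δ) (hF0 : ∀ a, F a 0 = f a)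
    (hFs : ∀ a i, F a (i + 1) = h (a, i, F a i)) (hb : PSpace b)
    (hF : ∀ a, ∀ i ≤ c a, ScalarCoded.code (F a i) ≤ b a) : PSpace fun a => F a (c a) :=
  recur hf hh hc F hF0 hFs (.size hb) fun a i hi => Nat.size_le_size (hF a i hi)

theorem size_add_le (m n : ℕ) : (m + n).size ≤ m.size + n.size + 1 := by
  rw [Nat.size_le]
  have h1 := Nat.lt_size_self m
  have h2 := Nat.lt_size_self n
  have h3 : 2 ^ m.size ≤ 2 ^ (m.size + n.size) := Nat.pow_le_pow_right (by norm_num) (by omega)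
  have h4 : 2 ^ n.size ≤ 2 ^ (m.size + n.size) := Nat.pow_le_pow_right (by norm_num) (by omega)
  rw [pow_succ]
  omega

theorem size_mul_le (m n : ℕ) : (m * n).size ≤ m.size + n.size := by
  rw [Nat.size_le, pow_add]
  exact Nat.mul_lt_mul'' (Nat.lt_size_self m) (Nat.lt_size_self n)

-- Repeated increments may take exponentially many rounds, but only the sizes of the partial sums
-- count.
@[fun_prop]
theorem add {f g : α → ℕ} (hf : PSpace f) (hg : PSpace g) : PSpace fun a => f a + g a :=
  recur (h := fun x : α × ℕ × ℕ => x.2.2 + 1) hf (by fun_prop) hg (fun a i => f a + i)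
    (fun _ => rfl) (fun _ _ => rfl) (((PolyBdd.size hf).add (.size hg)).add (.const 1))
    fun a _ hi => (Nat.size_le_size (Nat.add_le_add_left hi (f a))).trans (size_add_le _ _)

@[fun_prop]
theorem mul {f g : α → ℕ} (hf : PSpace f) (hg : PSpace g) : PSpace fun a => f a * g a :=
  recur (h := fun x : α × ℕ × ℕ => x.2.2 + f x.1) (const 0) (by fun_prop) hg (fun a i => f a * i)
    (fun _ => rfl) (fun _ _ => rfl) ((PolyBdd.size hf).add (.size hg))
    fun a _ hi => (Nat.size_le_size (Nat.mul_le_mul_left (f a) hi)).trans (size_mul_le _ _)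

theorem pred {f : α → ℕ} (hf : PSpace f) : PSpace fun a => f a - 1 :=
  recur_of_le (h := fun x : α × ℕ × ℕ => x.2.1) (const 0) (by fun_prop) hf (fun _ i => i - 1)
    (fun _ => rfl) (fun _ _ => rfl) hf fun _ _ hi => (Nat.sub_le _ _).trans hi

@[fun_prop]
theorem sub {f g : α → ℕ} (hf : PSpace f) (hg : PSpace g) : PSpace fun a => f a - g a :=
  recur_of_le (h := fun x : α × ℕ × ℕ => x.2.2 - 1) hf (pred (by fun_prop)) hg (fun a i => f a - i)
    (fun _ => rfl) (fun _ _ => rfl) hf fun _ _ _ => Nat.sub_le _ _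

/-! #### Predicates -/

@[simp] theorem code_true {p : Prop} (h : p) : ScalarCoded.code p = 1 := by
  simp [ScalarCoded.code, h]

@[simp] theorem code_false {p : Prop} (h : ¬ p) : ScalarCoded.code p = 0 := by
  simp [ScalarCoded.code, h]

theorem code_prop_le (p : Prop) : ScalarCoded.code p ≤ 1 := by
  by_cases h : p <;> simp [h]

theorem congr_prop {p q : α → Prop} (hp : PSpace p) (h : ∀ a, q a ↔ p a) : PSpace q := by
  rwa [show q = p from funext fun a => propext (h a)]

theorem eq_zero {f : α → ℕ} (hf : PSpace f) : PSpace fun a => f a = 0 :=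
  of_code (sub (const 1) hf) fun a => by
    by_cases h : f a = 0
    · simp [h]
    · rw [code_false h]
      omega

@[fun_prop]
theorem not {p : α → Prop} (hp : PSpace p) : PSpace fun a => ¬ p a :=
  of_code (sub (const 1) hp.code) fun a => by by_cases h : p a <;> simp [h]

@[fun_prop]
theorem and {p q : α → Prop} (hp : PSpace p) (hq : PSpace q) : PSpace fun a => p a ∧ q a :=
  of_code (mul hp.code hq.code) fun a => by by_cases h : p a <;> by_cases h' : q a <;> simp [h, h']

@[fun_prop]
theorem or {p q : α → Prop} (hp : PSpace p) (hq : PSpace q) : PSpace fun a => p a ∨ q a :=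
  congr_prop (not (and (not hp) (not hq))) fun a => by tauto

@[fun_prop]
theorem imp {p q : α → Prop} (hp : PSpace p) (hq : PSpace q) : PSpace fun a => p a → q a :=
  congr_prop (or (not hp) hq) fun a => by tauto

@[fun_prop]
theorem iff {p q : α → Prop} (hp : PSpace p) (hq : PSpace q) : PSpace fun a => p a ↔ q a :=
  congr_prop (and (imp hp hq) (imp hq hp)) fun a => by tauto

@[fun_prop]
theorem le {f g : α → ℕ} (hf : PSpace f) (hg : PSpace g) : PSpace fun a => f a ≤ g a :=
  congr_prop (eq_zero (sub hf hg)) fun a => by omega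

@[fun_prop]
theorem lt {f g : α → ℕ} (hf : PSpace f) (hg : PSpace g) : PSpace fun a => f a < g a :=
  le (succ hf) hg

@[fun_prop]
theorem eq {f g : α → ℕ} (hf : PSpace f) (hg : PSpace g) : PSpace fun a => f a = g a :=
  congr_prop (and (le hf hg) (le hg hf)) fun a => by omega

-- A recursion with as many rounds as the truth value of `p`: no round leaves `g a`, one round
-- replaces it by `f a`.
@[fun_prop]
theorem ite {δ : Type} [ScalarCoded δ] {p : α → Prop} [∀ a, Decidable (p a)] {f g : α → δ}
    (hp : PSpace p) (hf : PSpace f) (hg : PSpace g) : PSpace fun a => if p a then f a else g a := by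
  have h := recur (h := fun x : α × ℕ × δ => f x.1) (c := fun a => ScalarCoded.code (p a)) hg
    (by fun_prop) hp.code
    (fun a i => if i = 0 then g a else f a) (fun _ => by simp) (fun _ _ => by simp)
    ((PolyBdd.size hf.code).add (.size hg.code)) fun a i _ => by
      by_cases h : i = 0 <;> simp [h]
  convert h using 2 with a
  by_cases h : p a <;> simp [h]

/-- Exhaustive search remembers one bit besides the current candidate, so the bound may be
exponential in the input. -/
theorem bex {p : α → ℕ → Prop} {b : α → ℕ} (hb : PSpace b)
    (hp : PSpace fun x : α × ℕ => p x.1 x.2) : PSpace fun a => ∃ x < b a, p a x := by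
  refine recur_of_le (h := fun x : α × ℕ × Prop => x.2.2 ∨ p x.1 x.2.1) (const False) ?_ hb
    (fun a n => ∃ x < n, p a x) (fun a => by simp) (fun a n => ?_) (const 1)
    fun _ _ _ => code_prop_le _
  · have : PSpace fun x : α × ℕ × Prop => p x.1 x.2.1 :=
      comp (f := fun x : α × ℕ × Prop => (x.1, x.2.1)) hp (by fun_prop)
    fun_prop
  · refine propext ⟨?_, ?_⟩
    · rintro ⟨x, hx, h⟩
      rcases Nat.lt_succ_iff_lt_or_eq.1 hx with hx | rfl
      · exact Or.inl ⟨x, hx, h⟩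
      · exact Or.inr h
    · rintro (⟨x, hx, h⟩ | h)
      · exact ⟨x, by omega, h⟩
      · exact ⟨n, by omega, h⟩

theorem ball {p : α → ℕ → Prop} {b : α → ℕ} (hb : PSpace b)
    (hp : PSpace fun x : α × ℕ => p x.1 x.2) : PSpace fun a => ∀ x < b a, p a x :=
  congr_prop (not (bex hb (p := fun a x => ¬ p a x) (not hp))) fun a => by push Not; rfl

/-- A function with a computable graph and a computable bound is computable. -/
theorem of_graph {f b : α → ℕ} (hb : PSpace b) (hfb : ∀ a, f a < b a)
    (hf : PSpace fun x : α × ℕ => f x.1 = x.2) : PSpace f := by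
  have h := recur_of_le (h := fun x : α × ℕ × ℕ => if f x.1 = x.2.1 then x.2.1 else x.2.2)
    (const 0)
    (ite (comp (f := fun x : α × ℕ × ℕ => (x.1, x.2.1)) hf (by fun_prop))
      (by fun_prop) (by fun_prop)) hb
    (fun a n => if f a < n then f a else 0) (fun a => by simp) (fun a n => ?_) hb (fun a n hn => ?_)
  · convert h using 2 with a
    simp [hfb a]
  · rcases lt_trichotomy (f a) n with h | h | h
    · simp [h, h.ne, h.le]
    · simp [h]
    · simp [h.ne', show ¬ f a < n + 1 by omega, show ¬ f a < n by omega]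
  · change (if f a < n then f a else 0) ≤ b a
    have := hfb a
    split_ifs <;> omega

/-! #### Arithmetic -/

@[fun_prop]
theorem div {f g : α → ℕ} (hf : PSpace f) (hg : PSpace g) : PSpace fun a => f a / g a := by
  refine of_graph (b := fun a => f a + 1) (by fun_prop)
    (fun a => Nat.lt_succ_of_le (Nat.div_le_self _ _)) ?_
  -- The first alternative is the convention that division by zero gives zero.
  refine congr_prop (p := fun x : α × ℕ => (g x.1 = 0 ∧ x.2 = 0) ∨
    (¬ g x.1 = 0 ∧ x.2 * g x.1 ≤ f x.1 ∧ f x.1 < (x.2 + 1) * g x.1)) (by fun_prop) ?_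
  rintro ⟨a, k⟩
  rcases Nat.eq_zero_or_pos (g a) with h | h
  · simp [h, eq_comm]
  · simp only [h.ne', false_and, not_false_eq_true, true_and, false_or]
    rw [Nat.div_eq_iff h]
    have : (k + 1) * g a = k * g a + g a := by ring
    omega

@[fun_prop]
theorem mod {f g : α → ℕ} (hf : PSpace f) (hg : PSpace g) : PSpace fun a => f a % g a := by
  have : PSpace fun a => f a - g a * (f a / g a) := by fun_prop
  convert this using 2 with a
  exact Nat.mod_eq_sub_mul_div

theorem size_pow_le (m n : ℕ) : (m ^ n).size ≤ m.size * n + 1 := by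
  rw [Nat.size_le]
  calc m ^ n ≤ (2 ^ m.size) ^ n := Nat.pow_le_pow_left (Nat.lt_size_self m).le n
    _ = 2 ^ (m.size * n) := (pow_mul _ _ _).symm
    _ < _ := Nat.pow_lt_pow_right (by norm_num) (by omega)

/-- The exponent itself has to be polynomially bounded, not only its number of bits, or the power
would be too long. -/
theorem pow {f g : α → ℕ} (hf : PSpace f) (hg : PSpace g) (hg' : PolyBdd g) :
    PSpace fun a => f a ^ g a :=
  recur (h := fun x : α × ℕ × ℕ => x.2.2 * f x.1) (const 1) (by fun_prop) hg (fun a i => f a ^ i)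
    (fun _ => pow_zero _) (fun _ _ => pow_succ _ _)
    (((PolyBdd.size hf).mul hg').add (.const 1)) fun _ _ hi =>
      (size_pow_le _ _).trans (Nat.succ_le_succ (Nat.mul_le_mul_left _ hi))

/-- Dividing repeatedly avoids the power, which may have exponentially many bits; hence no bound on
the exponent is needed. -/
theorem div_pow {f g h : α → ℕ} (hf : PSpace f) (hg : PSpace g) (hh : PSpace h) :
    PSpace fun a => f a / g a ^ h a :=
  recur_of_le (h := fun x : α × ℕ × ℕ => x.2.2 / g x.1) hf (by fun_prop) hh
    (fun a i => f a / g a ^ i) (fun _ => by simp)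
    (fun _ _ => by rw [pow_succ, Nat.div_div_eq_div_mul]) hf fun _ _ _ => Nat.div_le_self _ _

@[fun_prop]
theorem testBit {f g : α → ℕ} (hf : PSpace f) (hg : PSpace g) :
    PSpace fun a => (f a).testBit (g a) = true := by
  have := div_pow hf (const 2) hg
  refine congr_prop (p := fun a => f a / 2 ^ g a % 2 = 1) (by fun_prop) fun a => ?_
  rw [Nat.testBit_eq_decide_div_mod_eq, decide_eq_true_iff]

/-! #### Words -/

theorem numVal_tail (w : List Bool) : numVal w.tail = (numVal w - 1) / 2 := by
  rcases w with _ | ⟨b, w⟩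
  · rfl
  · cases b <;> simp [numVal]
    omega

@[fun_prop]
theorem tail {f : α → List Bool} (hf : PSpace f) : PSpace fun a => (f a).tail :=
  of_code (g := fun a => (ScalarCoded.code (f a) - 1) / 2)
    (div (sub hf.code (const 1)) (const 2)) fun a => numVal_tail (f a)

@[fun_prop]
theorem eq_nil {f : α → List Bool} (hf : PSpace f) : PSpace fun a => f a = [] :=
  congr_prop (eq_zero hf.code) fun a => by
    rcases f a with _ | ⟨b, w⟩
    · simp [ScalarCoded.code, numVal]
    · cases b <;> simp [ScalarCoded.code, numVal]

@[fun_prop]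
theorem head_true {f : α → List Bool} (hf : PSpace f) : PSpace fun a => (f a).head? = some true :=
  congr_prop (p := fun a => ¬ ScalarCoded.code (f a) = 0 ∧ ScalarCoded.code (f a) % 2 = 0)
    (and (not (eq_zero hf.code)) (eq (mod hf.code (const 2)) (const 0))) fun a => by
    rcases f a with _ | ⟨b, w⟩
    · simp [ScalarCoded.code, numVal]
    · cases b
      · simp [ScalarCoded.code, numVal]
      · simp [ScalarCoded.code, numVal]

/-- Words that never grow keep every iterate within the size of the first one, for any number of
iterations. -/
theorem iterate {T : List Bool → List Bool} (hT : PSpace T) (hT' : ∀ w, (T w).length ≤ w.length)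
    {f : α → List Bool} {n : α → ℕ} (hf : PSpace f) (hn : PSpace n) :
    PSpace fun a => T^[n a] (f a) := by
  refine recur (h := fun x : α × ℕ × List Bool => T x.2.2) hf (by fun_prop) hn
    (fun a i => T^[i] (f a)) (fun _ => rfl) (fun _ _ => Function.iterate_succ_apply' _ _ _)
    ((PolyBdd.length.comp hf).add (.const 1)) fun a i hi => ?_
  clear hi
  have : (T^[i] (f a)).length ≤ (f a).length := by
    induction i with
    | zero => rfl
    | succ i ih =>
      rw [Function.iterate_succ_apply']
      exact (hT' _).trans ih
  exact (size_numVal_le _).trans (Nat.succ_le_succ this)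

@[fun_prop]
theorem drop {f : α → List Bool} {n : α → ℕ} (hf : PSpace f) (hn : PSpace n) :
    PSpace fun a => (f a).drop (n a) := by
  have := iterate (tail PSpace.id) (fun w => by simp) hf hn
  convert this using 2 with a
  generalize n a = k
  induction k with
  | zero => rfl
  | succ k ih => rw [Function.iterate_succ_apply', ← ih, List.tail_drop]

@[fun_prop]
theorem length {f : α → List Bool} (hf : PSpace f) : PSpace fun a => (f a).length := by
  refine of_graph (b := fun a => ScalarCoded.code (f a) + 1) (succ hf.code)
    (fun a => Nat.lt_succ_of_le (length_le_numVal _)) ?_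
  refine congr_prop (p := fun x : α × ℕ => (f x.1).drop x.2 = [] ∧
    ∀ j < x.2, ¬ (f x.1).drop j = []) (and (by fun_prop) (ball (by fun_prop) (by fun_prop))) ?_
  rintro ⟨a, k⟩
  simp only [List.drop_eq_nil_iff]
  constructor
  · rintro rfl
    exact ⟨le_rfl, fun j hj => by omega⟩
  · rintro ⟨h1, h2⟩
    by_contra h
    exact h2 (f a).length (by omega) le_rfl

end PSpace

end

/-! ### Walks -/

/-- `NWalk R n a b`: there is a walk with `n` steps from `a` to `b`. -/
inductive NWalk {X : Type} (R : X → X → Prop) : ℕ → X → X → Prop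
  | refl (a : X) : NWalk R 0 a a
  | tail {n : ℕ} {a b c : X} (h : NWalk R n a b) (h' : R b c) : NWalk R (n + 1) a c

namespace NWalk

open Relation

variable {X : Type} {R : X → X → Prop}

theorem trans {n k : ℕ} {a b c : X} (h : NWalk R n a b) (h' : NWalk R k b c) :
    NWalk R (n + k) a c := by
  induction h' with
  | refl => exact h
  | tail _ h2 ih => exact (ih h).tail h2

theorem exists_of_reflTransGen {a b : X} (h : ReflTransGen R a b) : ∃ n, NWalk R n a b := by
  induction h with
  | refl => exact ⟨0, .refl a⟩
  | tail _ h2 ih =>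
    obtain ⟨n, hn⟩ := ih
    exact ⟨n + 1, hn.tail h2⟩

/-- The function stays at `b` from `n` on, so that it can be padded to any greater length. -/
theorem exists_fun {n : ℕ} {a b : X} (h : NWalk R n a b) :
    ∃ f : ℕ → X, f 0 = a ∧ (∀ i, n ≤ i → f i = b) ∧ ∀ i < n, R (f i) (f (i + 1)) := by
  induction h with
  | refl a => exact ⟨fun _ => a, rfl, fun _ _ => rfl, fun i hi => absurd hi (by omega)⟩
  | @tail n a b c h h' ih =>
    obtain ⟨f, h0, hn, hf⟩ := ih
    refine ⟨fun i => if i ≤ n then f i else c, by simp [h0], fun i hi => ?_, fun i hi => ?_⟩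
    · simp [show ¬ i ≤ n by omega]
    · rcases Nat.lt_succ_iff_lt_or_eq.1 hi with hi | rfl
      · simp only [hi.le, if_true, show i + 1 ≤ n by omega]
        exact hf i hi
      · simp only [le_refl, if_true, show ¬ i + 1 ≤ i by omega, if_false, hn i le_rfl]
        exact h'

theorem of_fun {n : ℕ} {f : ℕ → X} (hf : ∀ i < n, R (f i) (f (i + 1))) {i j : ℕ} (hij : i ≤ j)
    (hj : j ≤ n) : NWalk R (j - i) (f i) (f j) := by
  induction j, hij using Nat.le_induction with
  | base => rw [Nat.sub_self]; exact .refl _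
  | succ j hij ih =>
    rw [Nat.succ_sub hij]
    exact (ih (by omega)).tail (hf j hj)

/-- A piece of a walk can be replayed from another label; this allows pieces to be cut out. -/
theorem translate {V : Type} [AddCommGroup V] {R : X × V → X × V → Prop}
    (hR : ∀ x v y u w, R (x, v) (y, u) → R (x, v + w) (y, u + w)) {n : ℕ} {a b : X × V}
    (h : NWalk R n a b) (w : V) : NWalk R n (a.1, a.2 + w) (b.1, b.2 + w) := by
  induction h with
  | refl => exact .refl _
  | tail _ h2 ih => exact ih.tail (hR _ _ _ _ w h2)

end NWalk

open Relation in
/-- In a graph with labels from a vector space over the field with two elements, whenever there is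
a walk with a given sum of labels, there is one whose length is linear in the dimension. -/
theorem exists_short_walk {X V : Type} [Fintype X] [AddCommGroup V] [Module (ZMod 2) V]
    [Module.Finite (ZMod 2) V] {R : X × V → X × V → Prop}
    (hR : ∀ x v y u w, R (x, v) (y, u) → R (x, v + w) (y, u + w)) {a b : X × V}
    (h : ReflTransGen R a b) :
    ∃ n ≤ Fintype.card X * (Module.finrank (ZMod 2) V + 1), NWalk R n a b := by
  classical
  set d := Module.finrank (ZMod 2) V with hd
  have hex := NWalk.exists_of_reflTransGen h
  -- A shortest walk; if it is too long, it will be shortened.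
  set n := Nat.find hex with hn
  have hw : NWalk R n a b := Nat.find_spec hex
  refine ⟨n, ?_, hw⟩
  by_contra hlt
  obtain ⟨F, hF0, hFn, hF⟩ := hw.exists_fun
  -- The `n + 1` positions exceed `card X * (d + 1)`, so some `x` is visited `d + 2` times, and `d +
  -- 1` closed pieces lie between these visits.
  obtain ⟨x, -, hx⟩ := Finset.exists_lt_card_fiber_of_mul_lt_card_of_maps_to
    (s := Finset.range (n + 1)) (t := (Finset.univ : Finset X)) (f := fun i => (F i).1)
    (n := d + 1) (fun _ _ => Finset.mem_univ _) (by
      rw [Finset.card_range, Finset.card_univ]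
      omega)
  set T := {i ∈ Finset.range (n + 1) | (F i).1 = x} with hT
  set t := T.orderEmbOfCardLe (k := d + 2) hx with ht
  have htT : ∀ i, t i ∈ T := fun i => Finset.orderEmbOfCardLe_mem T hx i
  have htn : ∀ i, t i ≤ n := fun i => by
    have := (Finset.mem_filter.1 (htT i)).1
    rw [Finset.mem_range] at this
    omega
  have htx : ∀ i, (F (t i)).1 = x := fun i => (Finset.mem_filter.1 (htT i)).2
  let g : Fin (d + 1) → V := fun i => (F (t i.succ)).2 - (F (t i.castSucc)).2
  let len : Fin (d + 1) → ℕ := fun i => t i.succ - t i.castSucc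
  have htlt : ∀ i : Fin (d + 1), t i.castSucc < t i.succ := fun i =>
    t.strictMono Fin.castSucc_lt_succ
  -- These are `d + 1` labels in a space of dimension `d`.
  have hdep : ¬ LinearIndependent (ZMod 2) g := by
    intro hli
    have := hli.fintype_card_le_finrank
    rw [Fintype.card_fin] at this
    omega
  obtain ⟨c, hc, i₀, hi₀⟩ := Fintype.not_linearIndependent_iff.1 hdep
  -- All the pieces start and end at `x`, so any selection of them can be concatenated after
  -- translation.
  have hclosed : ∀ (S : Finset (Fin (d + 1))) (v : V),
      NWalk R (∑ i ∈ S, len i) (x, v) (x, v + ∑ i ∈ S, g i) := by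
    intro S
    induction S using Finset.induction_on with
    | empty =>
      intro v
      simpa using NWalk.refl (R := R) (x, v)
    | insert i S hi ih =>
      intro v
      rw [Finset.sum_insert hi, Finset.sum_insert hi]
      have h1 := (NWalk.of_fun hF (htlt i).le (htn _)).translate hR (v - (F (t i.castSucc)).2)
      rw [htx, htx] at h1
      have h2 := h1.trans (ih _)
      convert h2 using 2
      · simp
      · simp only [g]
        abel
  -- Keep the pieces with coefficient 0. The others have coefficient 1, so the dependency says that
  -- their labels sum to zero.
  let S : Finset (Fin (d + 1)) := {i | c i = 0}
  have hsum : ∑ i ∈ S, g i = (F (t (Fin.last _))).2 - (F (t 0)).2 := by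
    have h1 : ∑ i, g i = (F (t (Fin.last _))).2 - (F (t 0)).2 := by
      have h0 : ∀ (k : ℕ) (y : Fin (k + 1) → V),
          ∑ i : Fin k, (y i.succ - y i.castSucc) = y (Fin.last k) - y 0 := by
        intro k
        induction k with
        | zero => simp
        | succ k ih =>
          intro y
          rw [Fin.sum_univ_castSucc]
          have := ih fun i => y i.castSucc
          simp only [Fin.succ_castSucc, Fin.succ_last] at this ⊢
          rw [this]
          simp
      exact h0 _ fun i => (F (t i)).2
    have h2 : ∑ i ∈ S, g i + ∑ i, c i • g i = ∑ i, g i := by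
      rw [Finset.sum_filter, ← Finset.sum_add_distrib]
      refine Finset.sum_congr rfl fun i _ => ?_
      have : c i = 0 ∨ c i = 1 := by
        generalize c i = z
        revert z
        decide
      rcases this with h | h <;> simp [h]
    rw [← h1, ← h2, hc, add_zero]
  -- The piece `i₀` is dropped and has positive length.
  have hlen : ∑ i ∈ S, len i < t (Fin.last _) - t 0 := by
    have h0 : ∀ (k : ℕ) (y : Fin (k + 1) → ℕ), Monotone y →
        ∑ i : Fin k, (y i.succ - y i.castSucc) = y (Fin.last k) - y 0 := by
      intro k
      induction k with
      | zero => simp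
      | succ k ih =>
        intro y hy
        rw [Fin.sum_univ_castSucc]
        have := ih (fun i => y i.castSucc) (fun i j hij => hy (by simpa using hij))
        simp only [Fin.succ_castSucc, Fin.succ_last] at this ⊢
        rw [this]
        have h1 : y (Fin.castSucc 0) ≤ _ := hy (Fin.zero_le (Fin.castSucc (Fin.last k)))
        have h2 := hy (Fin.le_last (Fin.castSucc (Fin.last k)))
        change y (Fin.last k).castSucc - y (Fin.castSucc 0) +
          (y (Fin.last (k + 1)) - y (Fin.last k).castSucc) = y (Fin.last (k + 1)) - y (Fin.castSucc 0)
        omega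
    rw [← h0 _ (fun i => t i) t.monotone]
    refine Finset.sum_lt_sum_of_subset (i := i₀) (Finset.subset_univ _) (Finset.mem_univ _) ?_ ?_ ?_
    · simp [S, hi₀]
    · exact Nat.sub_pos_of_lt (htlt i₀)
    · intros
      exact Nat.zero_le _
  have w1 := NWalk.of_fun hF (Nat.zero_le (t 0)) (htn _)
  have w2 := hclosed S (F (t 0)).2
  have w3 := NWalk.of_fun hF (htn (Fin.last _)) le_rfl
  rw [hF0] at w1
  rw [hsum, add_sub_cancel] at w2
  have e1 : (x, (F (t 0)).2) = F (t 0) := by rw [← htx 0]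
  have e2 : (x, (F (t (Fin.last _))).2) = F (t (Fin.last (d + 1))) := by rw [← htx (Fin.last _)]
  rw [e1, e2] at w2
  rw [hFn n le_rfl] at w3
  refine Nat.find_min hex (m := t 0 - 0 + ∑ i ∈ S, len i + (n - t (Fin.last _))) ?_
    ((w1.trans w2).trans w3)
  have h1 := htn (Fin.last (d + 1))
  have h2 : t 0 ≤ t (Fin.last (d + 1)) := t.monotone (Fin.zero_le _)
  omega

/-! ### Cut-offs and parities -/

namespace RvProtocol

open Relation

variable {QP QL A : Type}

/-- There is an edge between two process states. -/
def ProcAdj (P : RvProtocol QP QL A) (q q' : QP) : Prop :=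
  ∃ a, (q, RvAction.req a, q') ∈ P.procEdges

/-- The edge from `q` to `q'` with letter `a` is on a path from the initial to the final process
state. -/
def UsefulEdge (P : RvProtocol QP QL A) (q : QP) (a : A) (q' : QP) : Prop :=
  (q, RvAction.req a, q') ∈ P.procEdges ∧ ReflTransGen P.ProcAdj P.procInit q ∧
    ReflTransGen P.ProcAdj q' P.procFinal

/-- All the processes are in states that are reachable from the initial state. -/
def AllReach (P : RvProtocol QP QL A) (C : Multiset (QP ⊕ QL)) : Prop :=
  ∀ q, Sum.inl q ∈ C → ReflTransGen P.ProcAdj P.procInit q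

/-- All the processes are in states from which the final state is reachable. -/
def AllCoreach (P : RvProtocol QP QL A) (C : Multiset (QP ⊕ QL)) : Prop :=
  ∀ q, Sum.inl q ∈ C → ReflTransGen P.ProcAdj q P.procFinal

variable {P : RvProtocol QP QL A}

/-! ### Reachable states and moves of pairs -/

/-- In symmetric protocols a step is given by two edges with requests. -/
theorem IsSymmetric.step_iff (hP : P.IsSymmetric) {C C' : Multiset (QP ⊕ QL)} :
    P.Step C C' ↔ ∃ (a : A) (q₁ q₂ q₁' q₂' : QP ⊕ QL) (D : Multiset (QP ⊕ QL)),
      P.HasEdge q₁ (.req a) q₂ ∧ P.HasEdge q₁' (.req a) q₂' ∧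
      C = {q₁, q₁'} + D ∧ C' = {q₂, q₂'} + D := by
  unfold Step
  simp only [hP _ _ _]

theorem HasEdge.reach {q q' : QP ⊕ QL} {a : A} (h : P.HasEdge q (.req a) q') {p' : QP}
    (hp' : q' = Sum.inl p') : ∃ p, q = Sum.inl p ∧ P.ProcAdj p p' := by
  subst hp'
  cases h with
  | proc q _ _ h => exact ⟨q, rfl, a, h⟩

theorem HasEdge.coreach {q q' : QP ⊕ QL} {a : A} (h : P.HasEdge q (.req a) q') {p : QP}
    (hp : q = Sum.inl p) : ∃ p', q' = Sum.inl p' ∧ P.ProcAdj p p' := by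
  subst hp
  cases h with
  | proc _ q' _ h => exact ⟨q', rfl, a, h⟩

theorem IsSymmetric.allReach (hP : P.IsSymmetric) {C C' : Multiset (QP ⊕ QL)} (h : P.Step C C')
    (hC : P.AllReach C) : P.AllReach C' := by
  obtain ⟨a, q₁, q₂, q₁', q₂', D, h₁, h₂, rfl, rfl⟩ := hP.step_iff.1 h
  intro q hq
  simp only [Multiset.insert_eq_cons, Multiset.cons_add, Multiset.singleton_add,
    Multiset.mem_cons] at hq
  rcases hq with rfl | rfl | hq
  · obtain ⟨p, rfl, hp⟩ := h₁.reach rfl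
    exact (hC p (by simp)).tail hp
  · obtain ⟨p, rfl, hp⟩ := h₂.reach rfl
    exact (hC p (by simp)).tail hp
  · exact hC q (by simp [hq])

/-- This goes backwards from the final configuration, as `IsSymmetric.allReach` goes forwards from
the initial one; together they make every process edge of a run useful. -/
theorem IsSymmetric.allCoreach (hP : P.IsSymmetric) {C C' : Multiset (QP ⊕ QL)} (h : P.Step C C')
    (hC : P.AllCoreach C') : P.AllCoreach C := by
  obtain ⟨a, q₁, q₂, q₁', q₂', D, h₁, h₂, rfl, rfl⟩ := hP.step_iff.1 h
  intro q hq
  simp only [Multiset.insert_eq_cons, Multiset.cons_add, Multiset.singleton_add,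
    Multiset.mem_cons] at hq
  rcases hq with rfl | rfl | hq
  · obtain ⟨p, rfl, hp⟩ := h₁.coreach rfl
    exact .head hp (hC p (by simp))
  · obtain ⟨p, rfl, hp⟩ := h₂.coreach rfl
    exact .head hp (hC p (by simp))
  · exact hC q (by simp [hq])

theorem step_card {C C' : Multiset (QP ⊕ QL)} (h : P.Step C C') :
    Multiset.card C' = Multiset.card C := by
  obtain ⟨a, q₁, q₂, q₁', q₂', D, h₁, h₂, rfl, rfl⟩ := h
  simp

theorem reachable_card {C C' : Multiset (QP ⊕ QL)} (h : ReflTransGen P.Step C C') :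
    Multiset.card C' = Multiset.card C := by
  induction h with
  | refl => rfl
  | tail _ h ih => rw [step_card h, ih]

/-- The two processes meet each other: by symmetry one can answer on the edge on which the other
requests. -/
theorem IsSymmetric.move_pair (hP : P.IsSymmetric) {q q' : QP}
    (h : ReflTransGen P.ProcAdj q q') (D : Multiset (QP ⊕ QL)) :
    ReflTransGen P.Step ({Sum.inl q, Sum.inl q} + D) ({Sum.inl q', Sum.inl q'} + D) := by
  induction h with
  | refl => exact .refl
  | tail _ h ih =>
    obtain ⟨a, h⟩ := h
    exact ih.tail (hP.step_iff.2 ⟨a, _, _, _, _, D, .proc _ _ _ h, .proc _ _ _ h, rfl, rfl⟩)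

theorem IsSymmetric.move_pairs (hP : P.IsSymmetric) {q q' : QP}
    (h : ReflTransGen P.ProcAdj q q') (k : ℕ) (D : Multiset (QP ⊕ QL)) :
    ReflTransGen P.Step (Multiset.replicate (2 * k) (Sum.inl q) + D)
      (Multiset.replicate (2 * k) (Sum.inl q') + D) := by
  induction k generalizing D with
  | zero => exact .refl
  | succ k ih =>
    have e : ∀ q : QP, Multiset.replicate (2 * (k + 1)) (Sum.inl q : QP ⊕ QL) + D =
        {Sum.inl q, Sum.inl q} + (Multiset.replicate (2 * k) (Sum.inl q) + D) := by
      intro q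
      rw [show 2 * (k + 1) = 2 * k + 1 + 1 by ring, Multiset.replicate_succ,
        Multiset.replicate_succ]
      simp
    have h1 := ih ({Sum.inl q', Sum.inl q'} + D)
    rw [add_left_comm, ← add_left_comm ({Sum.inl q', Sum.inl q'} : Multiset (QP ⊕ QL))] at h1
    rw [e, e]
    refine (hP.move_pair h _).trans ?_
    rw [add_left_comm] at h1
    rwa [add_left_comm]

/-! ### The abstraction to parities -/

variable [DecidableEq QP]

/-- The change of the parities when a process moves from `q` to `q'`. -/
def toggle (q q' : QP) : QP → ZMod 2 := Pi.single q 1 + Pi.single q' 1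

/-- The steps on pairs of a leader state and the parities of the numbers of processes. -/
inductive ParityStep (P : RvProtocol QP QL A) :
    QL × (QP → ZMod 2) → QL × (QP → ZMod 2) → Prop
  | proc {x : QL} {v : QP → ZMod 2} {a : A} {q₁ q₁' q₂ q₂' : QP} (h₁ : P.UsefulEdge q₁ a q₁')
      (h₂ : P.UsefulEdge q₂ a q₂') : ParityStep P (x, v) (x, v + (toggle q₁ q₁' + toggle q₂ q₂'))
  | leader {x x' : QL} {v : QP → ZMod 2} {a : A} {q q' : QP}
      (h₁ : (x, RvAction.req a, x') ∈ P.leaderEdges) (h₂ : P.UsefulEdge q a q') :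
      ParityStep P (x, v) (x', v + toggle q q')

/-- Whether a parity step is available does not depend on the vector; this is the hypothesis of
`exists_short_walk`. -/
theorem ParityStep.translate (x : QL) (v : QP → ZMod 2) (y : QL)
    (u w : QP → ZMod 2) (h : P.ParityStep (x, v) (y, u)) : P.ParityStep (x, v + w) (y, u + w) := by
  cases h with
  | proc h₁ h₂ => rw [add_right_comm]; exact .proc h₁ h₂
  | leader h₁ h₂ => rw [add_right_comm]; exact .leader h₁ h₂

theorem ParityStep.reach {a b : QL × (QP → ZMod 2)} (h : P.ParityStep a b) :
    ReflTransGen P.ProcAdj P.procInit P.procFinal := by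
  have : ∀ {q a q'}, P.UsefulEdge q a q' → ReflTransGen P.ProcAdj P.procInit P.procFinal :=
    fun h => (h.2.1.tail ⟨_, h.1⟩).trans h.2.2
  cases h with
  | proc h₁ _ => exact this h₁
  | leader _ h₂ => exact this h₂

/-- Many processes can be brought to all the states of a set of reachable states. -/
theorem IsSymmetric.spread (hP : P.IsSymmetric) (j : ℕ) (S : Finset QP)
    (hS : ∀ q ∈ S, ReflTransGen P.ProcAdj P.procInit q) (r : ℕ) :
    ReflTransGen P.Step (P.initConfig (r + 2 * j * S.card))
      ({Sum.inr P.leaderInit} + Multiset.replicate r (Sum.inl P.procInit) +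
        ∑ q ∈ S, Multiset.replicate (2 * j) (Sum.inl q)) := by
  induction S using Finset.induction_on generalizing r with
  | empty => simpa [initConfig] using ReflTransGen.refl
  | insert q S hq ih =>
    have h1 := ih (fun q hq => hS q (Finset.mem_insert_of_mem hq)) (r + 2 * j)
    rw [Finset.card_insert_of_notMem hq, Finset.sum_insert hq]
    rw [show r + 2 * j + 2 * j * S.card = r + 2 * j * (S.card + 1) by ring] at h1
    refine h1.trans ?_
    have h2 := hP.move_pairs (hS q (Finset.mem_insert_self q S)) j
      ({Sum.inr P.leaderInit} + Multiset.replicate r (Sum.inl P.procInit) +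
        ∑ q ∈ S, Multiset.replicate (2 * j) (Sum.inl q))
    rw [Multiset.replicate_add]
    convert h2 using 1 <;> abel

variable [DecidableEq QL]

/-- The parities of the numbers of processes. -/
def parity (C : Multiset (QP ⊕ QL)) : QP → ZMod 2 := fun q => (C.count (Sum.inl q) : ZMod 2)

theorem parity_add (C D : Multiset (QP ⊕ QL)) : parity (C + D) = parity C + parity D := by
  funext q
  simp [parity]

theorem parity_inl (q : QP) : parity ({Sum.inl q} : Multiset (QP ⊕ QL)) = Pi.single q 1 := by
  funext q'
  by_cases h : q' = q
  · subst h
    simp [parity]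
  · simp [parity, h]

theorem parity_inr (x : QL) : parity ({Sum.inr x} : Multiset (QP ⊕ QL)) = 0 := by
  funext q'
  simp [parity]

theorem parity_replicate (n : ℕ) (q : QP) :
    parity (Multiset.replicate n (Sum.inl q : QP ⊕ QL)) = n • Pi.single q 1 := by
  rw [← Multiset.nsmul_singleton]
  induction n with
  | zero => funext; simp [parity]
  | succ n ih => rw [succ_nsmul, succ_nsmul, parity_add, ih, parity_inl]

theorem add_self_parity {QP : Type} (v : QP → ZMod 2) : v + v = 0 := by
  funext q
  exact CharTwo.add_self_eq_zero _

/-- The configuration `C` has the leader state `x` and the parities `v`. -/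
def HasParity (C : Multiset (QP ⊕ QL)) (x : QL) (v : QP → ZMod 2) : Prop :=
  Sum.inr x ∈ C ∧ C.countP (fun q => q.isRight) = 1 ∧ parity C = v

theorem parity_pair (q q' : QP ⊕ QL) (D : Multiset (QP ⊕ QL)) :
    parity ({q, q'} + D) = parity {q} + parity {q'} + parity D := by
  rw [Multiset.insert_eq_cons, ← Multiset.singleton_add, parity_add, parity_add]

theorem parity_move (q₁ q₂ q₁' q₂' : QP) (D : Multiset (QP ⊕ QL)) :
    parity ({Sum.inl q₂, Sum.inl q₂'} + D) =
      parity ({Sum.inl q₁, Sum.inl q₁'} + D) + (toggle q₁ q₂ + toggle q₁' q₂') := by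
  simp only [parity_pair, parity_inl, toggle]
  linear_combination -(add_self_parity (Pi.single q₁ 1)) - add_self_parity (Pi.single q₁' 1)

theorem parity_move_leader (q q' : QP) (x x' : QL) (D : Multiset (QP ⊕ QL)) :
    parity ({Sum.inl q', Sum.inr x'} + D) =
      parity ({Sum.inl q, Sum.inr x} + D) + toggle q q' := by
  simp only [parity_pair, parity_inl, parity_inr, toggle]
  linear_combination -(add_self_parity (Pi.single q 1))

theorem hasParity_move {q₁ q₂ q₁' q₂' : QP} {D : Multiset (QP ⊕ QL)} {x : QL} {v : QP → ZMod 2}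
    (h : HasParity ({Sum.inl q₁, Sum.inl q₁'} + D) x v) :
    HasParity ({Sum.inl q₂, Sum.inl q₂'} + D) x (v + (toggle q₁ q₂ + toggle q₁' q₂')) := by
  obtain ⟨h1, h2, h3⟩ := h
  exact ⟨by simpa using h1, by simpa using h2, by rw [parity_move q₁ q₂ q₁' q₂', h3]⟩

theorem hasParity_move_leader {q q' : QP} {D : Multiset (QP ⊕ QL)} {x y x' : QL}
    {v : QP → ZMod 2} (h : HasParity ({Sum.inl q, Sum.inr y} + D) x v) :
    x = y ∧ HasParity ({Sum.inl q', Sum.inr x'} + D) x' (v + toggle q q') := by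
  obtain ⟨h1, h2, h3⟩ := h
  refine ⟨?_, by simp, by simpa [Multiset.countP_cons] using h2, by rw [parity_move_leader q q' y x', h3]⟩
  have h4 : D.countP (fun q => q.isRight) = 0 := by simpa [Multiset.countP_cons] using h2
  have h5 : Sum.inr x ∉ D := fun h => by
    have := Multiset.countP_eq_zero.1 h4 _ h
    simp at this
  simpa [h5] using h1

/-- Steps between useful configurations induce steps of the parities. -/
theorem IsSymmetric.parityStep (hP : P.IsSymmetric) {C C' : Multiset (QP ⊕ QL)}
    (h : P.Step C C') (hC : P.AllReach C) (hC' : P.AllCoreach C') {x : QL} {v : QP → ZMod 2}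
    (hv : HasParity C x v) : ∃ x' v', HasParity C' x' v' ∧ P.ParityStep (x, v) (x', v') := by
  obtain ⟨a, q₁, q₂, q₁', q₂', D, h₁, h₂, rfl, rfl⟩ := hP.step_iff.1 h
  cases h₁ with
  | proc q₁ q₂ _ h₁ =>
    cases h₂ with
    | proc q₁' q₂' _ h₂ =>
      exact ⟨x, _, hasParity_move hv, .proc (a := a)
        ⟨h₁, hC _ (by simp), hC' _ (by simp)⟩ ⟨h₂, hC _ (by simp), hC' _ (by simp)⟩⟩
    | leader x₁ x₁' _ h₂ =>
      obtain ⟨rfl, h'⟩ := hasParity_move_leader (q' := q₂) (x' := x₁') hv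
      exact ⟨_, _, h', .leader h₂ ⟨h₁, hC _ (by simp), hC' _ (by simp)⟩⟩
  | leader x₁ x₁' _ h₁ =>
    cases h₂ with
    | proc q₁' q₂' _ h₂ =>
      rw [Multiset.pair_comm] at hv ⊢
      obtain ⟨rfl, h'⟩ := hasParity_move_leader (q' := q₂') (x' := x₁') hv
      exact ⟨_, _, h', .leader h₁ ⟨h₂, hC _ (by simp), hC' _ (by simp)⟩⟩
    | leader x₂ x₂' _ h₂ =>
      -- Two leaders would have to meet, but there is only one.
      have := hv.2.1
      simp [Multiset.countP_cons] at this

/-- Coreachability is inherited from the end of the run and reachability from its start. Hence the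
first is proved along the induction, while the second is assumed for each starting configuration. -/
theorem IsSymmetric.reachable_parity (hP : P.IsSymmetric) {C C' : Multiset (QP ⊕ QL)}
    (h : ReflTransGen P.Step C C') (hC' : P.AllCoreach C') :
    P.AllCoreach C ∧ ∀ x v, P.AllReach C → HasParity C x v →
      ∃ x' v', HasParity C' x' v' ∧ ReflTransGen P.ParityStep (x, v) (x', v') := by
  induction h using ReflTransGen.head_induction_on with
  | refl => exact ⟨hC', fun x v _ hv => ⟨x, v, hv, .refl⟩⟩
  | head h _ ih =>
    obtain ⟨ih1, ih2⟩ := ih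
    refine ⟨hP.allCoreach h ih1, fun x v hC hv => ?_⟩
    obtain ⟨x', v', hv', hs⟩ := hP.parityStep h hC ih1 hv
    obtain ⟨x'', v'', hv'', hs'⟩ := ih2 x' v' (hP.allReach h hC) hv'
    exact ⟨x'', v'', hv'', .head hs hs'⟩

theorem hasParity_replicate (x : QL) (n : ℕ) (q : QP) :
    HasParity ({Sum.inr x} + Multiset.replicate n (Sum.inl q)) x (n • Pi.single q 1) := by
  refine ⟨by simp, ?_, by rw [parity_add, parity_inr, parity_replicate, zero_add]⟩
  simp [Multiset.countP_cons, Multiset.countP_eq_zero, Multiset.mem_replicate]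

theorem HasParity.eq_of_replicate {x x' : QL} {n : ℕ} {q : QP} {v : QP → ZMod 2}
    (h : HasParity ({Sum.inr x} + Multiset.replicate n (Sum.inl q)) x' v) :
    x' = x ∧ v = n • Pi.single q 1 := by
  obtain ⟨h1, -, h3⟩ := h
  refine ⟨by simpa [Multiset.mem_replicate] using h1, ?_⟩
  rw [← h3, parity_add, parity_inr, parity_replicate, zero_add]

/-- All entities of the initial and of the final configuration satisfy the (co)reachability
conditions trivially. -/
theorem IsSymmetric.parity_of_reachable (hP : P.IsSymmetric) {n : ℕ}
    (h : ReflTransGen P.Step (P.initConfig n) (P.finalConfig n)) :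
    ReflTransGen P.ParityStep (P.leaderInit, n • Pi.single P.procInit 1)
      (P.leaderFinal, n • Pi.single P.procFinal 1) := by
  obtain ⟨x, v, hv, hs⟩ := (hP.reachable_parity h (fun q hq => by
    have : q = P.procFinal := by
      have : n ≠ 0 ∧ q = P.procFinal := by simpa [finalConfig, Multiset.mem_replicate] using hq
      exact this.2
    rw [this])).2 _ _ (fun q hq => by
      have : n ≠ 0 ∧ q = P.procInit := by simpa [initConfig, Multiset.mem_replicate] using hq
      rw [this.2]) (hasParity_replicate P.leaderInit n P.procInit)
  obtain ⟨rfl, rfl⟩ := hv.eq_of_replicate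
  exact hs

/-! #### From parities to configurations -/

/-- Every step of the parities is induced by a step between configurations with enough
processes. -/
theorem IsSymmetric.step_of_parityStep (hP : P.IsSymmetric) {x x' : QL} {v v' : QP → ZMod 2}
    (h : P.ParityStep (x, v) (x', v')) {C : Multiset (QP ⊕ QL)} (hC : HasParity C x v)
    (hco : P.AllCoreach C)
    (h2 : ∀ q, ReflTransGen P.ProcAdj P.procInit q → ReflTransGen P.ProcAdj q P.procFinal →
      2 ≤ C.count (Sum.inl q)) :
    ∃ C', P.Step C C' ∧ HasParity C' x' v' ∧ P.AllCoreach C' ∧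
      ∀ q, C.count (Sum.inl q) ≤ C'.count (Sum.inl q) + 2 := by
  -- Two processes are enough even when both edges of the step leave the same state.
  have huse : ∀ {q a q'}, P.UsefulEdge q a q' → 2 ≤ C.count (Sum.inl q) := fun h =>
    h2 _ h.2.1 (.head ⟨_, h.1⟩ h.2.2)
  cases h with
  | @proc _ _ a q₁ q₁' q₂ q₂' h₁ h₂ =>
    obtain ⟨D, rfl⟩ : ∃ D, C = {Sum.inl q₁, Sum.inl q₂} + D := by
      refine Multiset.le_iff_exists_add.1 (Multiset.le_iff_count.2 fun r => ?_)
      have h3 := huse h₁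
      have h4 := huse h₂
      have e : ({Sum.inl q₁, Sum.inl q₂} : Multiset (QP ⊕ QL)).count r =
          (if r = Sum.inl q₂ then 1 else 0) + if r = Sum.inl q₁ then 1 else 0 := by
        rw [Multiset.insert_eq_cons, Multiset.count_cons, Multiset.count_singleton]
      rw [e]
      by_cases hr : r = Sum.inl q₁
      · subst hr
        split_ifs <;> omega
      · by_cases hr' : r = Sum.inl q₂
        · subst hr'
          split_ifs <;> omega
        · simp [hr, hr']
    refine ⟨{Sum.inl q₁', Sum.inl q₂'} + D, hP.step_iff.2 ⟨a, _, _, _, _, D, .proc _ _ _ h₁.1,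
      .proc _ _ _ h₂.1, rfl, rfl⟩, hasParity_move hC, fun q hq => ?_, fun q => ?_⟩
    · simp only [Multiset.insert_eq_cons, Multiset.cons_add, Multiset.singleton_add,
        Multiset.mem_cons, Sum.inl.injEq] at hq
      rcases hq with rfl | rfl | hq
      · exact h₁.2.2
      · exact h₂.2.2
      · exact hco q (by simp [hq])
    · simp only [Multiset.insert_eq_cons, Multiset.cons_add, Multiset.singleton_add,
        Multiset.count_cons]
      split_ifs <;> omega
  | @leader _ _ _ a q q' h₁ h₂ =>
    obtain ⟨D, rfl⟩ : ∃ D, C = {Sum.inl q, Sum.inr x} + D := by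
      refine Multiset.le_iff_exists_add.1 (Multiset.le_iff_count.2 fun r => ?_)
      have h3 := huse h₂
      have h4 := Multiset.one_le_count_iff_mem.2 hC.1
      have e : ({Sum.inl q, Sum.inr x} : Multiset (QP ⊕ QL)).count r =
          (if r = Sum.inr x then 1 else 0) + if r = Sum.inl q then 1 else 0 := by
        rw [Multiset.insert_eq_cons, Multiset.count_cons, Multiset.count_singleton]
      rw [e]
      by_cases hr : r = Sum.inl q
      · subst hr
        simp
        omega
      · by_cases hr' : r = Sum.inr x
        · subst hr'
          rw [if_pos rfl, if_neg hr]
          exact h4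
        · simp [hr, hr']
    refine ⟨{Sum.inl q', Sum.inr x'} + D, hP.step_iff.2 ⟨a, _, _, _, _, D, .proc _ _ _ h₂.1,
      .leader _ _ _ h₁, rfl, rfl⟩, (hasParity_move_leader hC).2, fun p hp => ?_, fun p => ?_⟩
    · simp only [Multiset.insert_eq_cons, Multiset.cons_add, Multiset.singleton_add,
        Multiset.mem_cons, Sum.inl.injEq, reduceCtorEq, false_or] at hp
      rcases hp with rfl | hp
      · exact h₂.2.2
      · exact hco p (by simp [hp])
    · simp only [Multiset.insert_eq_cons, Multiset.cons_add, Multiset.singleton_add,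
        Multiset.count_cons]
      split_ifs <;> omega

/-- Each step removes at most two processes from a state, so a reserve of `2 * n` in every useful
state lasts for `n` steps. -/
theorem IsSymmetric.walk_of_parity (hP : P.IsSymmetric) {n : ℕ} {a b : QL × (QP → ZMod 2)}
    (h : NWalk P.ParityStep n a b) {C : Multiset (QP ⊕ QL)} (hC : HasParity C a.1 a.2)
    (hco : P.AllCoreach C)
    (h2 : ∀ q, ReflTransGen P.ProcAdj P.procInit q → ReflTransGen P.ProcAdj q P.procFinal →
      2 * n ≤ C.count (Sum.inl q)) :
    ∃ C', ReflTransGen P.Step C C' ∧ HasParity C' b.1 b.2 ∧ P.AllCoreach C' := by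
  suffices ∃ C', ReflTransGen P.Step C C' ∧ HasParity C' b.1 b.2 ∧ P.AllCoreach C' ∧
      ∀ q, C.count (Sum.inl q) ≤ C'.count (Sum.inl q) + 2 * n by
    obtain ⟨C', h1, h2, h3, -⟩ := this
    exact ⟨C', h1, h2, h3⟩
  induction h with
  | refl => exact ⟨C, .refl, hC, hco, fun q => le_rfl⟩
  | tail _ h' ih =>
    obtain ⟨C', h3, h4, h5, h6⟩ := ih hC fun q hq hq' => le_trans (by omega) (h2 q hq hq')
    obtain ⟨C'', h7, h8, h9, h10⟩ := hP.step_of_parityStep h' h4 h5 fun q hq hq' => by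
      have := h2 q hq hq'
      have := h6 q
      omega
    refine ⟨C'', h3.tail h7, h8, h9, fun q => ?_⟩
    have := h6 q
    have := h10 q
    omega

/-- Processes that come in pairs can all be moved to the final state. -/
theorem IsSymmetric.finish (hP : P.IsSymmetric) {x : QL} {n : ℕ} {C : Multiset (QP ⊕ QL)}
    (hC : HasParity C x (n • Pi.single P.procFinal 1)) (hco : P.AllCoreach C)
    (hcard : Multiset.card C = n + 1) :
    ReflTransGen P.Step C ({Sum.inr x} + Multiset.replicate n (Sum.inl P.procFinal)) := by
  -- Induction on the number of entities outside the final process state; the leader is counted but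
  -- never moves.
  obtain ⟨k, hk⟩ : ∃ k, C.countP (fun q => q ≠ Sum.inl P.procFinal) = k := ⟨_, rfl⟩
  induction k using Nat.strong_induction_on generalizing C with
  | h k ih =>
    by_cases hq : ∃ q, q ≠ P.procFinal ∧ Sum.inl q ∈ C
    · obtain ⟨q, hqf, hqC⟩ := hq
      have h1 := Multiset.one_le_count_iff_mem.2 hqC
      -- The parity vanishes outside the final state, so an occupied state holds at least two
      -- processes.
      have h2 : (C.count (Sum.inl q) : ZMod 2) = 0 := by
        have := congrFun hC.2.2 q
        simpa [parity, hqf] using this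
      have h3 : 2 ≤ C.count (Sum.inl q) := by
        rw [ZMod.natCast_eq_zero_iff] at h2
        omega
      obtain ⟨D, rfl⟩ : ∃ D, C = {Sum.inl q, Sum.inl q} + D := by
        refine Multiset.le_iff_exists_add.1 ?_
        have : ({Sum.inl q, Sum.inl q} : Multiset (QP ⊕ QL)) = Multiset.replicate 2 (Sum.inl q) :=
          rfl
        rw [this]
        exact Multiset.le_count_iff_replicate_le.1 h3
      refine (hP.move_pair (hco q hqC) D).trans (ih _ ?_ ?_ ?_ ?_ rfl)
      · rw [← hk]
        simp [hqf]
      · have := hasParity_move (q₂ := P.procFinal) (q₂' := P.procFinal) hC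
        rwa [add_self_parity, add_zero] at this
      · intro p hp
        simp only [Multiset.insert_eq_cons, Multiset.cons_add, Multiset.singleton_add,
          Multiset.mem_cons, Sum.inl.injEq] at hp
        rcases hp with rfl | rfl | hp
        · exact .refl
        · exact .refl
        · exact hco p (by simp [hp])
      · simpa using hcard
    · push Not at hq
      obtain ⟨D, rfl⟩ := Multiset.exists_cons_of_mem hC.1
      have h1 : D.countP (fun q => q.isRight) = 0 := by
        simpa [Multiset.countP_cons] using hC.2.1
      have h2 : D = Multiset.replicate n (Sum.inl P.procFinal) := by
        refine Multiset.eq_replicate.2 ⟨by simpa using hcard, fun r hr => ?_⟩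
        rcases r with q | y
        · by_contra hne
          exact hq q (fun h => hne (by rw [h])) (by simp [hr])
        · exact absurd rfl (Multiset.countP_eq_zero.1 h1 _ hr)
      rw [h2]
      exact .refl

-- Three phases: spread pairs over all the useful states, imitate the parity walk, collect the
-- processes in pairs. The number of processes enters the walk through its parity only.
open Classical in
theorem IsSymmetric.eventually_reachable [Fintype QP] (hP : P.IsSymmetric) {N : ℕ}
    {e : ℕ} (hco : ReflTransGen P.ProcAdj P.procInit P.procFinal)
    (h : NWalk P.ParityStep N (P.leaderInit, e • Pi.single P.procInit 1)
      (P.leaderFinal, e • Pi.single P.procFinal 1)) (n : ℕ) (hn : 2 * N * Fintype.card QP ≤ n)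
    (hne : (n : ZMod 2) = e) :
    ReflTransGen P.Step (P.initConfig n) (P.finalConfig n) := by
  let S : Finset QP := {q | ReflTransGen P.ProcAdj P.procInit q ∧
    ReflTransGen P.ProcAdj q P.procFinal}
  have hS : ∀ q, q ∈ S ↔ ReflTransGen P.ProcAdj P.procInit q ∧
    ReflTransGen P.ProcAdj q P.procFinal := by simp [S]
  have hle : 2 * N * S.card ≤ n := le_trans (Nat.mul_le_mul_left _ S.card_le_univ) hn
  have hsm : ∀ q : QP, n • (Pi.single q 1 : QP → ZMod 2) = e • Pi.single q 1 := by
    intro q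
    rw [← Nat.cast_smul_eq_nsmul (ZMod 2), hne, Nat.cast_smul_eq_nsmul]
  obtain ⟨r, hr⟩ := Nat.exists_eq_add_of_le' hle
  have h1 := hP.spread N S (fun q hq => ((hS q).1 hq).1) r
  rw [← hr] at h1
  set C := {Sum.inr P.leaderInit} + Multiset.replicate r (Sum.inl P.procInit) +
        ∑ q ∈ S, Multiset.replicate (2 * N) (Sum.inl q) with hC
  have hcount : ∀ q ∈ S, 2 * N ≤ C.count (Sum.inl q) := by
    intro q hq
    rw [hC, Multiset.count_add, Multiset.count_sum']
    refine le_trans ?_ (Nat.le_add_left _ _)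
    refine le_trans ?_ (Finset.single_le_sum (f := fun p : QP =>
      Multiset.count (Sum.inl q) (Multiset.replicate (2 * N) (Sum.inl p : QP ⊕ QL)))
      (fun _ _ => Nat.zero_le _) hq)
    simp
  have hpar : HasParity C P.leaderInit (e • Pi.single P.procInit 1) := by
    refine ⟨by simp [hC], ?_, ?_⟩
    · have : (∑ q ∈ S, Multiset.replicate (2 * N) (Sum.inl q : QP ⊕ QL)).countP
          (fun q => q.isRight) = 0 := by
        refine Multiset.countP_eq_zero.2 fun p hp => ?_
        obtain ⟨q, -, hq⟩ := Multiset.mem_sum.1 hp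
        rw [Multiset.eq_of_mem_replicate hq]
        simp
      rw [hC, Multiset.countP_add, this]
      simp [Multiset.countP_cons, Multiset.countP_eq_zero, Multiset.mem_replicate]
    · have h2 : ∀ S : Finset QP,
          parity (∑ q ∈ S, Multiset.replicate (2 * N) (Sum.inl q : QP ⊕ QL)) = 0 := by
        intro S
        induction S using Finset.induction_on with
        | empty => funext; simp [parity]
        | insert q S hq ih =>
          rw [Finset.sum_insert hq, parity_add, ih, parity_replicate, mul_nsmul', two_nsmul,
            add_self_parity, add_zero]
      rw [hC, parity_add, parity_add, parity_inr, h2, parity_replicate, ← hsm, hr, zero_add,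
        add_zero, add_nsmul, mul_assoc, mul_nsmul' _ 2, two_nsmul, add_self_parity, add_zero]
  have hcoC : P.AllCoreach C := by
    intro q hq
    simp only [hC, Multiset.mem_add, Multiset.mem_singleton, reduceCtorEq, false_or] at hq
    rcases hq with hq | hq
    · rw [Sum.inl.inj (Multiset.eq_of_mem_replicate hq)]
      exact hco
    · obtain ⟨p, hp, hq⟩ := Multiset.mem_sum.1 hq
      rw [Sum.inl.inj (Multiset.eq_of_mem_replicate hq)]
      exact ((hS p).1 hp).2
  obtain ⟨C', h2, h3, h4⟩ := hP.walk_of_parity h hpar hcoC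
    (fun q hq hq' => hcount q ((hS q).2 ⟨hq, hq'⟩))
  refine h1.trans (h2.trans ?_)
  rw [← hsm] at h3
  refine hP.finish h3 h4 ?_
  rw [reachable_card h2, reachable_card h1]
  simp [initConfig, add_comm]

/-- A symmetric protocol has a cut-off iff the final parities are reachable from the initial ones,
both for even and for odd numbers of processes. -/
theorem IsSymmetric.hasCutoff_iff [Fintype QP] (hP : P.IsSymmetric) :
    P.HasCutoff ↔
      ReflTransGen P.ParityStep (P.leaderInit, 0) (P.leaderFinal, 0) ∧
      ReflTransGen P.ParityStep (P.leaderInit, Pi.single P.procInit 1)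
        (P.leaderFinal, Pi.single P.procFinal 1) := by
  constructor
  · rintro ⟨B, hB⟩
    -- One even and one odd number from `B` on suffice.
    have h1 := hP.parity_of_reachable (hB (2 * B) (by omega))
    have h2 := hP.parity_of_reachable (hB (2 * B + 1) (by omega))
    simp only [add_nsmul, mul_nsmul' _ 2, two_nsmul, add_self_parity, zero_add, one_nsmul] at h1 h2
    exact ⟨h1, h2⟩
  · rintro ⟨h0, h1⟩
    have hco : ReflTransGen P.ProcAdj P.procInit P.procFinal := by
      -- If the walk is empty, the initial and the final process state coincide; otherwise its first
      -- step uses a useful edge.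
      rcases ReflTransGen.cases_head h1 with h | ⟨c, h, -⟩
      · have h2 := congrFun (congrArg Prod.snd h) P.procInit
        have h3 : P.procInit = P.procFinal := by
          by_contra hne
          simp [hne] at h2
        rw [← h3]
      · exact h.reach
    obtain ⟨N₀, w0⟩ := NWalk.exists_of_reflTransGen h0
    obtain ⟨N₁, w1⟩ := NWalk.exists_of_reflTransGen h1
    refine ⟨2 * N₀ * Fintype.card QP + 2 * N₁ * Fintype.card QP, fun n hn => ?_⟩
    rcases Nat.even_or_odd n with he | ho
    · exact hP.eventually_reachable (e := 0) hco (by simpa using w0) n (by omega)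
        (by simpa using (ZMod.natCast_eq_zero_iff_even).2 he)
    · exact hP.eventually_reachable (e := 1) hco (by simpa using w1) n (by omega)
        (by simpa using (ZMod.natCast_eq_one_iff_odd).2 ho)

end RvProtocol

/-! ### Bounded reachability in polynomial space -/

/-- There is a walk with at most `K` steps through numbers below `N`. -/
def BddWalk (R : ℕ → ℕ → Prop) (N K x y : ℕ) : Prop :=
  ∃ f : ℕ → ℕ, (∀ i ≤ K, f i < N) ∧ f 0 = x ∧ f K = y ∧
    ∀ i < K, f i = f (i + 1) ∨ R (f i) (f (i + 1))

/-- Digits in base `N` code a whole sequence by one number. -/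
theorem exists_digits (N : ℕ) : ∀ (k : ℕ) (f : ℕ → ℕ), (∀ i < k, f i < N) →
    ∃ z < N ^ k, ∀ i < k, z / N ^ i % N = f i := by
  intro k
  induction k with
  | zero => exact fun f _ => ⟨0, by simp, fun i hi => absurd hi (by omega)⟩
  | succ k ih =>
    intro f hf
    obtain ⟨z, hz, h⟩ := ih (fun i => f (i + 1)) fun i hi => hf (i + 1) (by omega)
    have h0 := hf 0 (by omega)
    have hN : 0 < N := by omega
    refine ⟨f 0 + N * z, ?_, fun i hi => ?_⟩
    · calc f 0 + N * z < N + N * z := by omega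
        _ = N * (z + 1) := by ring
        _ ≤ N * N ^ k := Nat.mul_le_mul_left _ hz
        _ = N ^ (k + 1) := by ring
    · rcases i with _ | i
      · simp [Nat.mod_eq_of_lt h0]
      · rw [pow_succ', ← Nat.div_div_eq_div_mul, Nat.add_mul_div_left _ _ hN,
          Nat.div_eq_of_lt h0, zero_add]
        exact h i (by omega)

/-- The walk is sought as a single number in base `N a` with `K a + 1` digits. It has polynomially
many bits because `K` is polynomially bounded, which is why `hK'` is about `K` and not about its
size. -/
theorem PSpace.bddWalk {α : Type} [Coded α] {R : α → ℕ → ℕ → Prop} {N K x y : α → ℕ}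
    (hR : PSpace fun z : α × ℕ × ℕ => R z.1 z.2.1 z.2.2) (hN : PSpace N) (hK : PSpace K)
    (hK' : PolyBdd K) (hx : PSpace x) (hy : PSpace y) :
    PSpace fun a => BddWalk (R a) (N a) (K a) (x a) (y a) := by
  have hdig : PSpace fun z : (α × ℕ) × ℕ => z.1.2 / N z.1.1 ^ z.2 % N z.1.1 := by
    have := div_pow (f := fun z : (α × ℕ) × ℕ => z.1.2) (g := fun z => N z.1.1)
      (h := fun z => z.2) (by fun_prop) (by fun_prop) (by fun_prop)
    fun_prop
  refine congr_prop (p := fun a => ∃ z < N a ^ (K a + 1), (z / N a ^ 0 % N a = x a ∧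
    z / N a ^ K a % N a = y a) ∧ ∀ i < K a, z / N a ^ i % N a = z / N a ^ (i + 1) % N a ∨
      R a (z / N a ^ i % N a) (z / N a ^ (i + 1) % N a)) ?_ fun a => ?_
  · refine bex (pow hN (by fun_prop) (hK'.add (.const 1))) (and (and ?_ ?_) (ball ?_ (or ?_ ?_)))
    · exact eq (hdig.comp (f := fun z : α × ℕ => (z, 0)) (by fun_prop)) (by fun_prop)
    · exact eq (hdig.comp (f := fun z : α × ℕ => (z, K z.1)) (by fun_prop)) (by fun_prop)
    · fun_prop
    · exact eq hdig (hdig.comp (f := fun z : (α × ℕ) × ℕ => (z.1, z.2 + 1)) (by fun_prop))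
    · exact hR.comp (prodMk (by fun_prop) (prodMk hdig
        (hdig.comp (f := fun z : (α × ℕ) × ℕ => (z.1, z.2 + 1)) (by fun_prop))))
  · constructor
    · rintro ⟨f, hf, h0, hfK, hstep⟩
      obtain ⟨z, hz, h⟩ := exists_digits (N a) (K a + 1) f fun i hi => hf i (by omega)
      refine ⟨z, hz, ⟨by rw [h 0 (by omega), h0], by rw [h (K a) (by omega), hfK]⟩, fun i hi => ?_⟩
      rw [h i (by omega), h (i + 1) (by omega)]
      exact hstep i hi
    · rintro ⟨z, hz, ⟨h0, hfK⟩, h⟩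
      refine ⟨fun i => z / N a ^ i % N a, fun i _ => Nat.mod_lt _ ?_, h0, hfK, h⟩
      -- For `N a = 0` there is no candidate `z` at all.
      by_contra h
      rw [Nat.eq_zero_of_not_pos h, zero_pow (by omega)] at hz
      omega

-- The code `φ` is a bijection onto the numbers below `N`, so intermediate numbers are codes as
-- well. Idle steps pad walks shorter than `K`.
open Relation in
theorem bddWalk_iff {X : Type} {R : X → X → Prop} {R' : ℕ → ℕ → Prop} {N K : ℕ} {φ : X → ℕ}
    (hφN : ∀ a, φ a < N) (hφ : ∀ n < N, ∃ a, φ a = n) (hinj : Function.Injective φ)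
    (hR : ∀ a b, R' (φ a) (φ b) ↔ R a b)
    (hK : ∀ a b, ReflTransGen R a b → ∃ n ≤ K, NWalk R n a b) (a b : X) :
    BddWalk R' N K (φ a) (φ b) ↔ ReflTransGen R a b := by
  constructor
  · rintro ⟨f, hf, h0, hfK, hstep⟩
    have key : ∀ i ≤ K, ∃ c, f i = φ c ∧ ReflTransGen R a c := by
      intro i hi
      induction i with
      | zero => exact ⟨a, h0, .refl⟩
      | succ i ih =>
        obtain ⟨c, hc, hac⟩ := ih (by omega)
        rcases hstep i (by omega) with h | h
        · exact ⟨c, by rw [← h, hc], hac⟩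
        · obtain ⟨d, hd⟩ := hφ _ (hf (i + 1) hi)
          rw [hc, ← hd, hR] at h
          exact ⟨d, hd.symm, hac.tail h⟩
    obtain ⟨c, hc, hac⟩ := key K le_rfl
    rwa [hinj (hfK.symm.trans hc)]
  · intro h
    obtain ⟨n, hn, hw⟩ := hK a b h
    obtain ⟨g, h0, hgn, hg⟩ := hw.exists_fun
    refine ⟨fun i => φ (g i), fun i _ => hφN _, congrArg φ h0, congrArg φ (hgn K hn), fun i hi => ?_⟩
    rcases Nat.lt_or_ge i n with h | h
    · exact Or.inr ((hR _ _).2 (hg i h))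
    · exact Or.inl (congrArg φ ((hgn i h).trans (hgn (i + 1) (by omega)).symm))

/-! ### Reading codes of protocols -/

/-- The number at the beginning of a word. -/
def field : List Bool → ℕ
  | true :: w => field w + 1
  | _ => 0

/-- The rest of a word after the number at its beginning. -/
def afterField (w : List Bool) : List Bool := w.drop (field w + 1)

theorem field_unaryCode (n : ℕ) (w : List Bool) : field (unaryCode n ++ w) = n := by
  induction n with
  | zero => rfl
  | succ n ih =>
    rw [unaryCode, List.replicate_succ]
    exact congrArg (· + 1) ih

theorem length_unaryCode (n : ℕ) : (unaryCode n).length = n + 1 := by simp [unaryCode]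

theorem afterField_unaryCode (n : ℕ) (w : List Bool) : afterField (unaryCode n ++ w) = w := by
  rw [afterField, field_unaryCode, ← length_unaryCode n, List.drop_left]

theorem field_le_length (w : List Bool) : field w ≤ w.length := by
  induction w with
  | nil => simp [field]
  | cons b w ih => cases b <;> simp [field, ih]

/-- There is a complete number at the beginning of the word. -/
def HasField (w : List Bool) : Prop := field w < w.length

theorem hasField_unaryCode (n : ℕ) (w : List Bool) : HasField (unaryCode n ++ w) := by
  rw [HasField, field_unaryCode, List.length_append, length_unaryCode]
  omega

/-- Since `field` also returns a number when the closing `false` is missing, completeness is needed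
here. -/
theorem HasField.eq {w : List Bool} (h : HasField w) :
    w = unaryCode (field w) ++ afterField w := by
  induction w with
  | nil => simp [HasField] at h
  | cons b w ih =>
    cases b
    · simp [field, afterField, unaryCode]
    · have h' : HasField w := by simpa [HasField, field] using h
      conv_lhs => rw [ih h']
      simp [field, afterField, unaryCode, List.replicate_succ]

theorem length_afterField_le (w : List Bool) : (afterField w).length ≤ w.length := by
  simp [afterField]

@[fun_prop]
theorem PSpace.field {α : Type} [Coded α] {f : α → List Bool} (hf : PSpace f) :
    PSpace fun a => field (f a) := by
  refine of_graph (b := fun a => (f a).length + 1) (by fun_prop)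
    (fun a => Nat.lt_succ_of_le (field_le_length _)) ?_
  refine congr_prop (p := fun x : α × ℕ => (∀ j < x.2, ((f x.1).drop j).head? = some true) ∧
    ¬ ((f x.1).drop x.2).head? = some true) (and (ball (by fun_prop) (by fun_prop))
      (by fun_prop)) ?_
  rintro ⟨a, k⟩
  simp only
  generalize f a = w
  induction w generalizing k with
  | nil =>
    rcases k with _ | k
    · simp [_root_.field]
    · simp only [_root_.field, List.drop_nil, List.head?_nil]
      refine iff_of_false (by omega) fun h => ?_
      simpa using h.1 0 (by omega)
  | cons b w ih =>
    cases b
    · rcases k with _ | k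
      · simp [_root_.field]
      · refine iff_of_false (by simp [_root_.field]) fun h => ?_
        simpa using h.1 0 (by omega)
    · rcases k with _ | k
      · simp [_root_.field]
      · simp only [_root_.field, Nat.add_right_cancel_iff, List.drop_succ_cons]
        rw [ih]
        refine and_congr_left fun _ => ⟨fun h j hj => ?_, fun h j hj => h (j + 1) (by omega)⟩
        rcases j with _ | j
        · rfl
        · exact h j (by omega)

@[fun_prop]
theorem PSpace.afterField {α : Type} [Coded α] {f : α → List Bool} (hf : PSpace f) :
    PSpace fun a => afterField (f a) := by
  unfold _root_.afterField
  fun_prop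

@[fun_prop]
theorem PSpace.hasField {α : Type} [Coded α] {f : α → List Bool} (hf : PSpace f) :
    PSpace fun a => HasField (f a) := by
  unfold HasField
  fun_prop

/-! ### Reading edges -/

/-- An edge between numbered states, of a process or of the leader. -/
@[ext]
structure RawEdge where
  /-- it is an edge of a process -/
  proc : Bool
  /-- source -/
  src : ℕ
  /-- it is an answer -/
  ans : Bool
  /-- letter -/
  letter : ℕ
  /-- target -/
  tgt : ℕ

/-- The code of an edge. -/
def RawEdge.code (e : RawEdge) : List Bool :=
  e.proc :: (unaryCode e.src ++ e.ans :: unaryCode e.letter ++ unaryCode e.tgt)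

/-- The edge at the beginning of a word. -/
def readEdge (u : List Bool) : RawEdge where
  proc := decide (u.head? = some true)
  src := field u.tail
  ans := decide ((afterField u.tail).head? = some true)
  letter := field (afterField u.tail).tail
  tgt := field (afterField (afterField u.tail).tail)

/-- The rest of the word after the edge at its beginning. -/
def afterEdge (u : List Bool) : List Bool :=
  afterField (afterField (afterField u.tail).tail)

/-- There is a complete edge at the beginning of the word. -/
def HasEdgeCode (u : List Bool) : Prop :=
  ¬ u = [] ∧ HasField u.tail ∧ ¬ afterField u.tail = [] ∧ HasField (afterField u.tail).tail ∧
    HasField (afterField (afterField u.tail).tail)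

theorem readEdge_code (e : RawEdge) (u : List Bool) :
    readEdge (e.code ++ u) = e ∧ afterEdge (e.code ++ u) = u ∧ HasEdgeCode (e.code ++ u) := by
  have h1 : (e.code ++ u).tail =
      unaryCode e.src ++ (e.ans :: (unaryCode e.letter ++ (unaryCode e.tgt ++ u))) := by
    simp [RawEdge.code]
  have h2 : (e.code ++ u).head? = some e.proc := rfl
  refine ⟨?_, ?_, ?_⟩
  · ext <;> simp [readEdge, h1, h2, afterField_unaryCode, field_unaryCode]
  · simp [afterEdge, h1, afterField_unaryCode]
  · refine ⟨by simp [RawEdge.code], ?_⟩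
    simp [h1, afterField_unaryCode, hasField_unaryCode]

/-- `readEdge` falls back on defaults for truncated words; the conditions of `HasEdgeCode` say that
no default was used. -/
theorem HasEdgeCode.eq {u : List Bool} (h : HasEdgeCode u) :
    u = (readEdge u).code ++ afterEdge u := by
  obtain ⟨h1, h2, h3, h4, h5⟩ := h
  have key : ∀ w : List Bool, w ≠ [] → w = decide (w.head? = some true) :: w.tail := by
    intro w hw
    rcases w with _ | ⟨b, w⟩
    · exact absurd rfl hw
    · simp
  conv_lhs => rw [key u h1, h2.eq, key _ h3, h4.eq, h5.eq]
  simp [RawEdge.code, readEdge, afterEdge]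

theorem length_afterEdge_le (u : List Bool) : (afterEdge u).length ≤ u.length := by
  refine (length_afterField_le _).trans ((length_afterField_le _).trans ?_)
  rw [List.length_tail]
  refine (Nat.sub_le _ _).trans ((length_afterField_le _).trans ?_)
  rw [List.length_tail]
  exact Nat.sub_le _ _

@[fun_prop]
theorem PSpace.afterEdge {α : Type} [Coded α] {f : α → List Bool} (hf : PSpace f) :
    PSpace fun a => afterEdge (f a) := by
  unfold _root_.afterEdge
  fun_prop

@[fun_prop]
theorem PSpace.hasEdgeCode {α : Type} [Coded α] {f : α → List Bool} (hf : PSpace f) :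
    PSpace fun a => HasEdgeCode (f a) := by
  unfold HasEdgeCode
  fun_prop

/-! ### The header and the list of edges -/

/-- The `j`-th number at the beginning of a word. -/
def header (j : ℕ) (w : List Bool) : ℕ := field (afterField^[j] w)

/-- The codes of the edges from the `i`-th one on. -/
def edgesFrom (w : List Bool) (i : ℕ) : List Bool := afterEdge^[i] (afterField^[7] w)

/-- The edge `e` is listed in the word. -/
def ListsEdge (w : List Bool) (e : RawEdge) : Prop :=
  ∃ i < w.length + 1, ¬ edgesFrom w i = [] ∧ readEdge (edgesFrom w i) = e

theorem header_le_length (j : ℕ) (w : List Bool) : header j w ≤ w.length := by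
  refine (field_le_length _).trans ?_
  induction j with
  | zero => rfl
  | succ j ih =>
    rw [Function.iterate_succ_apply']
    exact (length_afterField_le _).trans ih

@[fun_prop]
theorem PSpace.iterate_afterField {α : Type} [Coded α] {f : α → List Bool} (hf : PSpace f)
    (j : ℕ) : PSpace fun a => _root_.afterField^[j] (f a) :=
  iterate (by fun_prop) length_afterField_le hf (const j)

@[fun_prop]
theorem PSpace.header {α : Type} [Coded α] {f : α → List Bool} (hf : PSpace f) (j : ℕ) :
    PSpace fun a => header j (f a) := by
  unfold _root_.header
  fun_prop

theorem PolyBdd.header {α : Type} [Coded α] {f : α → List Bool} (hf : PSpace f) (j : ℕ) :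
    PolyBdd fun a => header j (f a) :=
  (PolyBdd.length.comp hf).mono fun _ => header_le_length j _

@[fun_prop]
theorem PSpace.edgesFrom {α : Type} [Coded α] {f : α → List Bool} {i : α → ℕ} (hf : PSpace f)
    (hi : PSpace i) : PSpace fun a => edgesFrom (f a) (i a) :=
  iterate (by fun_prop) length_afterEdge_le (by fun_prop) hi

/-- Past the end `afterEdge` stays at the empty word, as `List.drop` does, so `i` is unrestricted.
-/
theorem iterate_afterEdge (E : List RawEdge) (i : ℕ) :
    afterEdge^[i] (E.flatMap RawEdge.code) = (E.drop i).flatMap RawEdge.code := by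
  induction i generalizing E with
  | zero => rfl
  | succ i ih =>
    rw [Function.iterate_succ_apply]
    rcases E with _ | ⟨e, E⟩
    · change afterEdge^[i] (afterEdge []) = []
      rw [show afterEdge [] = [] from rfl]
      simpa using ih []
    · rw [List.flatMap_cons, (readEdge_code e _).2.1, ih]
      rfl

theorem length_flatMap_code (E : List RawEdge) :
    E.length ≤ (E.flatMap RawEdge.code).length := by
  induction E with
  | nil => rfl
  | cons e E ih =>
    simp only [List.flatMap_cons, List.length_append, List.length_cons, RawEdge.code]
    omega

theorem length_iterate_afterField_le (j : ℕ) (w : List Bool) :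
    (afterField^[j] w).length ≤ w.length := by
  induction j with
  | zero => rfl
  | succ j ih =>
    rw [Function.iterate_succ_apply']
    exact (length_afterField_le _).trans ih

section

variable {w : List Bool} {E : List RawEdge} (hE : afterField^[7] w = E.flatMap RawEdge.code)

include hE

theorem edgesFrom_eq (i : ℕ) : edgesFrom w i = (E.drop i).flatMap RawEdge.code := by
  rw [edgesFrom, hE, iterate_afterEdge]

theorem length_edges_le : E.length ≤ w.length := by
  refine (length_flatMap_code E).trans ?_
  rw [← hE]
  exact length_iterate_afterField_le 7 w

theorem edgesFrom_eq_nil {i : ℕ} : edgesFrom w i = [] ↔ E.length ≤ i := by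
  rw [edgesFrom_eq hE, ← List.drop_eq_nil_iff]
  constructor
  · intro h
    have := length_flatMap_code (E.drop i)
    rw [h] at this
    exact List.eq_nil_of_length_eq_zero (Nat.le_zero.1 this)
  · intro h
    rw [h]
    rfl

theorem readEdge_edgesFrom {i : ℕ} (hi : i < E.length) :
    readEdge (edgesFrom w i) = E[i] ∧ HasEdgeCode (edgesFrom w i) := by
  rw [edgesFrom_eq hE, List.drop_eq_getElem_cons hi, List.flatMap_cons]
  exact ⟨(readEdge_code _ _).1, (readEdge_code _ _).2.2⟩

theorem lists_iff {e : RawEdge} : ListsEdge w e ↔ e ∈ E := by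
  constructor
  · rintro ⟨i, -, hi, rfl⟩
    rw [edgesFrom_eq_nil hE, not_le] at hi
    rw [(readEdge_edgesFrom hE hi).1]
    exact List.getElem_mem hi
  · intro h
    obtain ⟨i, hi, rfl⟩ := List.getElem_of_mem h
    -- Each edge takes at least one symbol, so the bound on positions in `ListsEdge` loses nothing.
    have := length_edges_le hE
    exact ⟨i, by omega, by rw [edgesFrom_eq_nil hE]; omega, (readEdge_edgesFrom hE hi).1⟩

end

/-- Each successful reading splits off one code by `HasEdgeCode.eq`, and after `J` of them nothing
is left. -/
theorem edgesFrom_eq_flatMap {w : List Bool} {J : ℕ} (hJ : edgesFrom w J = [])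
    (h : ∀ i < J, HasEdgeCode (edgesFrom w i)) :
    afterField^[7] w = ((List.range J).map fun i => readEdge (edgesFrom w i)).flatMap
      RawEdge.code := by
  have key : ∀ (J : ℕ) (u : List Bool), afterEdge^[J] u = [] →
      (∀ i < J, HasEdgeCode (afterEdge^[i] u)) →
      u = ((List.range J).map fun i => readEdge (afterEdge^[i] u)).flatMap RawEdge.code := by
    intro J
    induction J with
    | zero => exact fun u hu _ => by simpa using hu
    | succ J ih =>
      intro u hu h
      rw [List.range_succ_eq_map, List.map_cons, List.flatMap_cons, List.map_map]
      have h1 := ih (afterEdge u) hu fun i hi => h (i + 1) (by omega)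
      conv_lhs => rw [HasEdgeCode.eq (u := u) (h 0 (by omega)), h1]
      rfl
  exact key J _ hJ h

section

open Relation

/-! ### Words that are codes of protocols -/

/-- An edge of processes (`b = true`) or of the leader (`b = false`), as an edge between numbers. -/
def rawEdge {m s : ℕ} (b : Bool) : Fin m × RvAction (Fin s) × Fin m → RawEdge
  | (q, RvAction.req a, q') => ⟨b, q, false, a, q'⟩
  | (q, RvAction.ans a, q') => ⟨b, q, true, a, q'⟩

theorem code_rawEdge {m s : ℕ} (b : Bool) (e : Fin m × RvAction (Fin s) × Fin m) :
    (rawEdge b e).code = b :: edgeCode e := by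
  rcases e with ⟨q, a | a, q'⟩ <;> rfl

theorem rawEdge_proc {m s : ℕ} (b : Bool) (e : Fin m × RvAction (Fin s) × Fin m) :
    (rawEdge b e).proc = b := by
  rcases e with ⟨q, a | a, q'⟩ <;> rfl

theorem rawEdge_injective {m s : ℕ} (b : Bool) :
    Function.Injective (rawEdge b : Fin m × RvAction (Fin s) × Fin m → RawEdge) := by
  rintro ⟨q, a | a, q'⟩ ⟨p, c | c, p'⟩ h <;> simp [rawEdge, Fin.val_inj] at h ⊢ <;> exact h

theorem exists_rawEdge {m s : ℕ} {b : Bool} {e : RawEdge} (hb : e.proc = b) (h1 : e.src < m)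
    (h2 : e.letter < s) (h3 : e.tgt < m) :
    ∃ x : Fin m × RvAction (Fin s) × Fin m, rawEdge b x = e := by
  rcases e with ⟨_, q, _ | _, a, q'⟩
  · exact ⟨(⟨q, h1⟩, .req ⟨a, h2⟩, ⟨q', h3⟩), by subst hb; rfl⟩
  · exact ⟨(⟨q, h1⟩, .ans ⟨a, h2⟩, ⟨q', h3⟩), by subst hb; rfl⟩

/-- The word lists edges with numbers in the correct ranges, first the ones of the processes. -/
def EdgesWellFormed (w : List Bool) : Prop :=
  ∃ J < w.length + 1, ∃ k < w.length + 1, edgesFrom w J = [] ∧ ∀ i < J,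
    HasEdgeCode (edgesFrom w i) ∧ ((readEdge (edgesFrom w i)).proc = true ↔ i < k) ∧
    (readEdge (edgesFrom w i)).letter < header 2 w ∧
    (i < k → (readEdge (edgesFrom w i)).src < header 0 w ∧
      (readEdge (edgesFrom w i)).tgt < header 0 w) ∧
    (¬ i < k → (readEdge (edgesFrom w i)).src < header 1 w ∧
      (readEdge (edgesFrom w i)).tgt < header 1 w)

/-- The word is the code of a protocol. -/
def WellFormed (w : List Bool) : Prop :=
  (∀ j < 7, HasField (afterField^[j] w)) ∧
    (header 3 w < header 0 w ∧ header 4 w < header 0 w ∧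
      header 5 w < header 1 w ∧ header 6 w < header 1 w) ∧ EdgesWellFormed w

/-- The word `w` is a code of the protocol `P`. -/
structure Describes {m l s : ℕ} (w : List Bool) (P : RvProtocol (Fin m) (Fin l) (Fin s)) :
    Prop where
  wellFormed : WellFormed w
  header0 : header 0 w = m
  header1 : header 1 w = l
  header2 : header 2 w = s
  header3 : header 3 w = P.procInit
  header4 : header 4 w = P.procFinal
  header5 : header 5 w = P.leaderInit
  header6 : header 6 w = P.leaderFinal
  lists_proc : ∀ e, e.proc = true → (ListsEdge w e ↔ ∃ x ∈ P.procEdges, rawEdge true x = e)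
  lists_leader : ∀ e, e.proc = false → (ListsEdge w e ↔ ∃ x ∈ P.leaderEdges, rawEdge false x = e)

theorem RvProtocol.IsEncodedBy.describes {m l s : ℕ} {w : List Bool}
    {P : RvProtocol (Fin m) (Fin l) (Fin s)} (h : P.IsEncodedBy w) : Describes w P := by
  obtain ⟨EP, EL, hEP, hEL, hw⟩ := h
  set E := EP.map (rawEdge true) ++ EL.map (rawEdge false) with hEdef
  have hflat : EP.flatMap (fun e => true :: edgeCode e) ++ EL.flatMap (fun e => false :: edgeCode e)
      = E.flatMap RawEdge.code := by
    simp only [hEdef, List.flatMap_append, List.flatMap_map, code_rawEdge]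
  simp only [List.append_assoc] at hw
  rw [hflat] at hw
  -- The numbers of the header are peeled off one by one; unification supplies the remaining words.
  have a1 : afterField^[1] w = _ := (congrArg afterField hw).trans (afterField_unaryCode _ _)
  have a2 : afterField^[2] w = _ := (congrArg afterField a1).trans (afterField_unaryCode _ _)
  have a3 : afterField^[3] w = _ := (congrArg afterField a2).trans (afterField_unaryCode _ _)
  have a4 : afterField^[4] w = _ := (congrArg afterField a3).trans (afterField_unaryCode _ _)
  have a5 : afterField^[5] w = _ := (congrArg afterField a4).trans (afterField_unaryCode _ _)
  have a6 : afterField^[6] w = _ := (congrArg afterField a5).trans (afterField_unaryCode _ _)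
  have hE : afterField^[7] w = _ := (congrArg afterField a6).trans (afterField_unaryCode _ _)
  have f0 : header 0 w = m := (congrArg field hw).trans (field_unaryCode _ _)
  have f1 : header 1 w = l := (congrArg field a1).trans (field_unaryCode _ _)
  have f2 : header 2 w = s := (congrArg field a2).trans (field_unaryCode _ _)
  have f3 : header 3 w = P.procInit := (congrArg field a3).trans (field_unaryCode _ _)
  have f4 : header 4 w = P.procFinal := (congrArg field a4).trans (field_unaryCode _ _)
  have f5 : header 5 w = P.leaderInit := (congrArg field a5).trans (field_unaryCode _ _)
  have f6 : header 6 w = P.leaderFinal := (congrArg field a6).trans (field_unaryCode _ _)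
  have hlen := length_edges_le hE
  have hlenE : E.length = EP.length + EL.length := by simp [hEdef]
  refine ⟨⟨fun j hj => ?_, ⟨?_, ?_, ?_, ?_⟩, E.length, by omega, EP.length, by omega,
    (edgesFrom_eq_nil hE).2 le_rfl, fun i hi => ?_⟩, f0, f1, f2, f3, f4, f5, f6,
    fun e he => ?_, fun e he => ?_⟩
  · interval_cases j
    · rw [Function.iterate_zero_apply, hw]
      exact hasField_unaryCode _ _
    · rw [a1]; exact hasField_unaryCode _ _
    · rw [a2]; exact hasField_unaryCode _ _
    · rw [a3]; exact hasField_unaryCode _ _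
    · rw [a4]; exact hasField_unaryCode _ _
    · rw [a5]; exact hasField_unaryCode _ _
    · rw [a6]; exact hasField_unaryCode _ _
  · rw [f3, f0]; exact P.procInit.isLt
  · rw [f4, f0]; exact P.procFinal.isLt
  · rw [f5, f1]; exact P.leaderInit.isLt
  · rw [f6, f1]; exact P.leaderFinal.isLt
  · obtain ⟨h1, h2⟩ := readEdge_edgesFrom hE hi
    refine ⟨h2, ?_⟩
    rw [h1, f0, f1, f2]
    have hbound : ∀ {n : ℕ} (b : Bool) (x : Fin n × RvAction (Fin s) × Fin n),
        (rawEdge b x).letter < s ∧ (rawEdge b x).src < n ∧ (rawEdge b x).tgt < n := by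
      rintro n b ⟨q, a | a, q'⟩ <;> exact ⟨a.isLt, q.isLt, q'.isLt⟩
    by_cases hik : i < EP.length
    · have : E[i] = rawEdge true EP[i] := by
        simp [hEdef, List.getElem_append_left, hik]
      rw [this, rawEdge_proc]
      have := hbound true EP[i]
      exact ⟨by simp [hik], this.1, fun _ => this.2, fun h => absurd hik h⟩
    · have : E[i] = rawEdge false EL[i - EP.length] := by
        simp [hEdef, List.getElem_append, hik]
      rw [this, rawEdge_proc]
      have := hbound false EL[i - EP.length]
      exact ⟨by simp [hik], this.1, fun h => absurd h hik, fun _ => this.2⟩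
  · rw [lists_iff hE, hEdef, List.mem_append, List.mem_map, List.mem_map]
    constructor
    · rintro (⟨x, hx, rfl⟩ | ⟨x, hx, rfl⟩)
      · exact ⟨x, (hEP x).1 hx, rfl⟩
      · rw [rawEdge_proc] at he
        exact absurd he (by simp)
    · rintro ⟨x, hx, rfl⟩
      exact Or.inl ⟨x, (hEP x).2 hx, rfl⟩
  · rw [lists_iff hE, hEdef, List.mem_append, List.mem_map, List.mem_map]
    constructor
    · rintro (⟨x, hx, rfl⟩ | ⟨x, hx, rfl⟩)
      · rw [rawEdge_proc] at he
        exact absurd he (by simp)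
      · exact ⟨x, (hEL x).1 hx, rfl⟩
    · rintro ⟨x, hx, rfl⟩
      exact Or.inr ⟨x, (hEL x).2 hx, rfl⟩

theorem exists_map_rawEdge {m s : ℕ} (b : Bool) (E : List RawEdge)
    (h : ∀ e ∈ E, e.proc = b ∧ e.src < m ∧ e.letter < s ∧ e.tgt < m) :
    ∃ L : List (Fin m × RvAction (Fin s) × Fin m), L.map (rawEdge b) = E := by
  induction E with
  | nil => exact ⟨[], rfl⟩
  | cons e E ih =>
    obtain ⟨L, hL⟩ := ih fun e he => h e (List.mem_cons_of_mem _ he)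
    obtain ⟨h1, h2, h3, h4⟩ := h e List.mem_cons_self
    obtain ⟨x, hx⟩ := exists_rawEdge h1 h2 h3 h4
    exact ⟨x :: L, by rw [List.map_cons, hx, hL]⟩

/-- The parsed list is cut at position `k` into edges of processes and of the leader. The range
conditions turn their numbers into elements of `Fin`, and the protocol is given exactly these edges.
-/
theorem WellFormed.exists_isEncodedBy {w : List Bool} (h : WellFormed w) :
    ∃ P : RvProtocol (Fin (header 0 w)) (Fin (header 1 w)) (Fin (header 2 w)),
      P.IsEncodedBy w := by
  obtain ⟨hf, ⟨h3, h4, h5, h6⟩, J, -, k, -, hJ, hE⟩ := h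
  have hbody := edgesFrom_eq_flatMap hJ fun i hi => (hE i hi).1
  set E := (List.range J).map fun i => readEdge (edgesFrom w i) with hEdef
  obtain ⟨EP, hEP⟩ : ∃ L : List (Fin (header 0 w) × RvAction (Fin (header 2 w)) × _),
      L.map (rawEdge true) = E.take k := exists_map_rawEdge true _ (by
    intro e he
    obtain ⟨i, hi, rfl⟩ := List.getElem_of_mem he
    simp only [hEdef, List.length_take, List.length_map, List.length_range] at hi
    have hi' : i < k := by omega
    obtain ⟨-, e1, e2, e3, -⟩ := hE i (by omega)
    simp only [hEdef, List.getElem_take, List.getElem_map, List.getElem_range]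
    exact ⟨e1.2 hi', (e3 hi').1, e2, (e3 hi').2⟩)
  obtain ⟨EL, hEL⟩ : ∃ L : List (Fin (header 1 w) × RvAction (Fin (header 2 w)) × _),
      L.map (rawEdge false) = E.drop k := exists_map_rawEdge false _ (by
    intro e he
    obtain ⟨i, hi, rfl⟩ := List.getElem_of_mem he
    simp only [hEdef, List.length_drop, List.length_map, List.length_range] at hi
    have hi' : ¬ k + i < k := by omega
    obtain ⟨-, e1, e2, -, e3⟩ := hE (k + i) (by omega)
    simp only [hEdef, List.getElem_drop, List.getElem_map, List.getElem_range]
    exact ⟨by simpa using fun h => hi' (e1.1 h), (e3 hi').1, e2, (e3 hi').2⟩)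
  refine ⟨⟨⟨_, h3⟩, ⟨_, h4⟩, ⟨_, h5⟩, ⟨_, h6⟩, {x | x ∈ EP}, {x | x ∈ EL}⟩, EP, EL,
    fun _ => Iff.rfl, fun _ => Iff.rfl, ?_⟩
  have hflat : EP.flatMap (fun e => true :: edgeCode e) ++
      EL.flatMap (fun e => false :: edgeCode e) = E.flatMap RawEdge.code := by
    rw [← List.take_append_drop k E, ← hEP, ← hEL]
    simp only [List.flatMap_append, List.flatMap_map, code_rawEdge]
  have hstep : ∀ j < 7, afterField^[j] w = unaryCode (header j w) ++ afterField^[j + 1] w := by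
    intro j hj
    rw [Function.iterate_succ_apply']
    exact (hf j hj).eq
  simp only [List.append_assoc]
  rw [hflat, ← hbody, ← hstep 6 (by omega), ← hstep 5 (by omega), ← hstep 4 (by omega),
    ← hstep 3 (by omega), ← hstep 2 (by omega), ← hstep 1 (by omega), ← hstep 0 (by omega)]
  rfl

/-! ### The decision procedure -/

/-- The listed edges are symmetric. -/
def ListsSymmetric (w : List Bool) : Prop :=
  ∀ e, ListsEdge w e → ListsEdge w ⟨e.proc, e.src, !e.ans, e.letter, e.tgt⟩

/-- There is a listed edge from the process state `q` to `q'`. -/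
def ListsAdj (w : List Bool) (q q' : ℕ) : Prop :=
  ∃ a < header 2 w, ListsEdge w ⟨true, q, false, a, q'⟩

/-- The process state `q'` is reachable from `q` through listed edges. -/
def ListsReach (w : List Bool) (q q' : ℕ) : Prop :=
  BddWalk (ListsAdj w) (header 0 w) (header 0 w) q q'

/-- There is a listed useful edge. -/
def ListsUseful (w : List Bool) (q a q' : ℕ) : Prop :=
  ListsEdge w ⟨true, q, false, a, q'⟩ ∧ ListsReach w (header 3 w) q ∧ ListsReach w q' (header 4 w)

/-- A step of the parities on numbers: the high bits are the leader state, and the `header 0 w`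
low bits are the parities. -/
def NumStep (w : List Bool) (c c' : ℕ) : Prop :=
  (c / 2 ^ header 0 w = c' / 2 ^ header 0 w ∧ ∃ a < header 2 w, ∃ q₁ < header 0 w,
    ∃ q₁' < header 0 w, ∃ q₂ < header 0 w, ∃ q₂' < header 0 w,
    ListsUseful w q₁ a q₁' ∧ ListsUseful w q₂ a q₂' ∧ ∀ i < header 0 w,
      (c'.testBit i = true ↔
        (c.testBit i = true ↔ ((i = q₁ ↔ i = q₁') ↔ (i = q₂ ↔ i = q₂'))))) ∨
  ∃ a < header 2 w, ∃ q < header 0 w, ∃ q' < header 0 w,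
    ListsEdge w ⟨false, c / 2 ^ header 0 w, false, a, c' / 2 ^ header 0 w⟩ ∧
    ListsUseful w q a q' ∧ ∀ i < header 0 w,
      (c'.testBit i = true ↔ (c.testBit i = true ↔ (i = q ↔ i = q')))

/-- Walks of the parities on numbers. -/
def NumWalk (w : List Bool) (c c' : ℕ) : Prop :=
  BddWalk (NumStep w) (2 ^ header 0 w * header 1 w) (header 1 w * (header 0 w + 1)) c c'

/-- The property of words that is decided by the machine. -/
def Accepts (w : List Bool) : Prop :=
  WellFormed w ∧ ListsSymmetric w ∧
    NumWalk w (2 ^ header 0 w * header 5 w) (2 ^ header 0 w * header 6 w) ∧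
    NumWalk w (2 ^ header 0 w * header 5 w + 2 ^ header 3 w)
      (2 ^ header 0 w * header 6 w + 2 ^ header 4 w)

/-! ### Listed edges and the protocol they describe -/

namespace Describes

variable {m l s : ℕ} {w : List Bool} {P : RvProtocol (Fin m) (Fin l) (Fin s)}

theorem req_proc (h : Describes w P) {q q' : Fin m} {a : Fin s} :
    ListsEdge w ⟨true, q, false, a, q'⟩ ↔ (q, RvAction.req a, q') ∈ P.procEdges := by
  rw [h.lists_proc _ rfl]
  exact ⟨fun ⟨x, hx, e⟩ => (rawEdge_injective true (e.trans rfl) : x = (q, .req a, q')) ▸ hx,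
    fun hx => ⟨_, hx, rfl⟩⟩

theorem ans_proc (h : Describes w P) {q q' : Fin m} {a : Fin s} :
    ListsEdge w ⟨true, q, true, a, q'⟩ ↔ (q, RvAction.ans a, q') ∈ P.procEdges := by
  rw [h.lists_proc _ rfl]
  exact ⟨fun ⟨x, hx, e⟩ => (rawEdge_injective true (e.trans rfl) : x = (q, .ans a, q')) ▸ hx,
    fun hx => ⟨_, hx, rfl⟩⟩

theorem req_leader (h : Describes w P) {q q' : Fin l} {a : Fin s} :
    ListsEdge w ⟨false, q, false, a, q'⟩ ↔ (q, RvAction.req a, q') ∈ P.leaderEdges := by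
  rw [h.lists_leader _ rfl]
  exact ⟨fun ⟨x, hx, e⟩ => (rawEdge_injective false (e.trans rfl) : x = (q, .req a, q')) ▸ hx,
    fun hx => ⟨_, hx, rfl⟩⟩

theorem ans_leader (h : Describes w P) {q q' : Fin l} {a : Fin s} :
    ListsEdge w ⟨false, q, true, a, q'⟩ ↔ (q, RvAction.ans a, q') ∈ P.leaderEdges := by
  rw [h.lists_leader _ rfl]
  exact ⟨fun ⟨x, hx, e⟩ => (rawEdge_injective false (e.trans rfl) : x = (q, .ans a, q')) ▸ hx,
    fun hx => ⟨_, hx, rfl⟩⟩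

theorem isSymmetric_iff (h : Describes w P) : P.IsSymmetric ↔ ListsSymmetric w := by
  constructor
  · intro hP e he
    rcases hb : e.proc
    · obtain ⟨⟨q, a | a, q'⟩, hx, rfl⟩ := (h.lists_leader e hb).1 he
      · refine h.ans_leader.2 ?_
        have := (hP _ _ _).2 (.leader _ _ _ hx)
        cases this
        assumption
      · refine h.req_leader.2 ?_
        have := (hP _ _ _).1 (.leader _ _ _ hx)
        cases this
        assumption
    · obtain ⟨⟨q, a | a, q'⟩, hx, rfl⟩ := (h.lists_proc e hb).1 he
      · refine h.ans_proc.2 ?_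
        have := (hP _ _ _).2 (.proc _ _ _ hx)
        cases this
        assumption
      · refine h.req_proc.2 ?_
        have := (hP _ _ _).1 (.proc _ _ _ hx)
        cases this
        assumption
  · intro hw q q' a
    constructor
    · intro he
      cases he with
      | proc _ _ _ hx => exact .proc _ _ _ (h.req_proc.1 (hw _ (h.ans_proc.2 hx)))
      | leader _ _ _ hx => exact .leader _ _ _ (h.req_leader.1 (hw _ (h.ans_leader.2 hx)))
    · intro he
      cases he with
      | proc _ _ _ hx => exact .proc _ _ _ (h.ans_proc.1 (hw _ (h.req_proc.2 hx)))
      | leader _ _ _ hx => exact .leader _ _ _ (h.ans_leader.1 (hw _ (h.req_leader.2 hx)))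

theorem adj_iff (h : Describes w P) (q q' : Fin m) : ListsAdj w q q' ↔ P.ProcAdj q q' := by
  unfold ListsAdj
  rw [h.header2]
  constructor
  · rintro ⟨a, ha, he⟩
    exact ⟨⟨a, ha⟩, h.req_proc.1 he⟩
  · rintro ⟨a, he⟩
    exact ⟨a, a.isLt, h.req_proc.2 he⟩

theorem reach_iff (h : Describes w P) (q q' : Fin m) :
    ListsReach w q q' ↔ ReflTransGen P.ProcAdj q q' := by
  unfold ListsReach
  rw [h.header0]
  refine bddWalk_iff (fun a => a.isLt) (fun n hn => ⟨⟨n, hn⟩, rfl⟩) Fin.val_injective h.adj_iff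
    (fun a b hab => ?_) q q'
  -- With labels in a space of dimension 0 the length bound is the number of states.
  obtain ⟨n, hn, hw⟩ := exists_short_walk (X := Fin m) (V := Fin 0 → ZMod 2)
    (R := fun a b => P.ProcAdj a.1 b.1) (fun _ _ _ _ _ h => h) (a := (a, 0)) (b := (b, 0))
    (hab.lift (fun x => (x, 0)) fun _ _ h => h)
  refine ⟨n, by simpa using hn, ?_⟩
  have : ∀ {n : ℕ} {a b : Fin m × (Fin 0 → ZMod 2)},
      NWalk (fun a b => P.ProcAdj a.1 b.1) n a b → NWalk P.ProcAdj n a.1 b.1 := by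
    intro n a b hw
    induction hw with
    | refl => exact .refl _
    | tail _ h' ih => exact ih.tail h'
  exact this hw

theorem useful_iff (h : Describes w P) (q : Fin m) (a : Fin s) (q' : Fin m) :
    ListsUseful w q a q' ↔ P.UsefulEdge q a q' := by
  unfold ListsUseful RvProtocol.UsefulEdge
  rw [h.req_proc, h.header3, h.header4, h.reach_iff, h.reach_iff]

end Describes

/-! ### Parity vectors as binary numbers -/

/-- The number that codes a leader state and parities. -/
def parityCode {m l : ℕ} (x : Fin l × (Fin m → ZMod 2)) : ℕ :=
  2 ^ m * x.1 + Nat.ofBits fun i => decide (x.2 i = 1)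

section parityCode

variable {m l : ℕ}

theorem parityCode_div (x : Fin l × (Fin m → ZMod 2)) : parityCode x / 2 ^ m = x.1 := by
  rw [parityCode, Nat.mul_add_div (by positivity), Nat.div_eq_of_lt (Nat.ofBits_lt_two_pow _),
    add_zero]

theorem testBit_parityCode (x : Fin l × (Fin m → ZMod 2)) (i : Fin m) :
    (parityCode x).testBit i = true ↔ x.2 i = 1 := by
  rw [parityCode, Nat.testBit_two_pow_mul_add _ (Nat.ofBits_lt_two_pow _), if_pos i.isLt,
    Nat.testBit_ofBits_lt _ _ i.isLt, decide_eq_true_iff]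

theorem eq_of_eq_one_iff {z z' : ZMod 2} (h : z = 1 ↔ z' = 1) : z = z' := by
  revert z z'
  decide

theorem parityCode_injective : Function.Injective (parityCode : Fin l × (Fin m → ZMod 2) → ℕ) := by
  intro x y h
  refine Prod.ext (Fin.ext ?_) (funext fun i => eq_of_eq_one_iff ?_)
  · rw [← parityCode_div x, ← parityCode_div y, h]
  · rw [← testBit_parityCode, ← testBit_parityCode, h]

theorem parityCode_lt (x : Fin l × (Fin m → ZMod 2)) : parityCode x < 2 ^ m * l := by
  rw [mul_comm, ← Nat.div_lt_iff_lt_mul (by positivity), parityCode_div]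
  exact x.1.isLt

theorem exists_parityCode {n : ℕ} (hn : n < 2 ^ m * l) :
    ∃ x : Fin l × (Fin m → ZMod 2), parityCode x = n := by
  refine ⟨(⟨n / 2 ^ m, (Nat.div_lt_iff_lt_mul (by positivity)).2 (mul_comm l _ ▸ hn)⟩,
    fun i => if n.testBit i then 1 else 0), ?_⟩
  have : (fun i : Fin m => decide ((if n.testBit i then 1 else 0 : ZMod 2) = 1)) =
      fun i : Fin m => n.testBit i := by
    funext i
    cases n.testBit i <;> simp
  rw [parityCode]
  simp only [this]
  rw [Nat.ofBits_testBit, Nat.div_add_mod]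

theorem parityCode_zero (x : Fin l) :
    parityCode (x, (0 : Fin m → ZMod 2)) = 2 ^ m * x := by
  rw [parityCode]
  simp only [Nat.add_eq_left]
  refine Nat.eq_of_testBit_eq fun i => ?_
  rw [Nat.testBit_ofBits]
  simp

theorem parityCode_single (x : Fin l) (q : Fin m) :
    parityCode (x, (Pi.single q 1 : Fin m → ZMod 2)) = 2 ^ m * x + 2 ^ (q : ℕ) := by
  rw [parityCode]
  simp only [Nat.add_left_cancel_iff]
  refine Nat.eq_of_testBit_eq fun i => ?_
  rw [Nat.testBit_ofBits, Nat.testBit_two_pow]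
  by_cases hi : i < m
  · by_cases hq : q = ⟨i, hi⟩
    · simp [hq, hi]
    · have : (q : ℕ) ≠ i := fun h => hq (Fin.ext h)
      simp [hi, this, Ne.symm hq]
  · have : (q : ℕ) ≠ i := by have := q.isLt; omega
    simp [hi, this]

/-- The added term is 1 exactly when `p` and `p'` differ; `↔` is the negation of addition in `ZMod
2`, and the two negations cancel. -/
theorem eq_add_ite_iff (z z' : ZMod 2) (p p' : Prop) [Decidable p] [Decidable p'] :
    z' = z + ((if p then 1 else 0) + if p' then 1 else 0) ↔ (z' = 1 ↔ (z = 1 ↔ (p ↔ p'))) := by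
  by_cases hp : p <;> by_cases hp' : p' <;> simp only [hp, hp', if_true, if_false] <;>
    revert z z' <;> decide

theorem toggle_iff (z z' : ZMod 2) (i q q' : Fin m) :
    z' = z + RvProtocol.toggle q q' i ↔
      (z' = 1 ↔ (z = 1 ↔ ((i : ℕ) = q ↔ (i : ℕ) = q'))) := by
  simp only [RvProtocol.toggle, Pi.add_apply, Pi.single_apply, Fin.val_inj]
  exact eq_add_ite_iff z z' _ _

theorem toggle_toggle_iff (z z' : ZMod 2) (i q₁ q₁' q₂ q₂' : Fin m) :
    z' = z + (RvProtocol.toggle q₁ q₁' i + RvProtocol.toggle q₂ q₂' i) ↔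
      (z' = 1 ↔ (z = 1 ↔ (((i : ℕ) = q₁ ↔ (i : ℕ) = q₁') ↔ ((i : ℕ) = q₂ ↔ (i : ℕ) = q₂')))) := by
  rw [← add_assoc, toggle_iff]
  have := (toggle_iff z (z + RvProtocol.toggle q₁ q₁' i) i q₁ q₁').1 rfl
  rw [this]
  exact iff_congr Iff.rfl _root_.iff_assoc

end parityCode

namespace Describes

variable {m l s : ℕ} {w : List Bool} {P : RvProtocol (Fin m) (Fin l) (Fin s)}

theorem numStep_iff (h : Describes w P) (x y : Fin l × (Fin m → ZMod 2)) :
    NumStep w (parityCode x) (parityCode y) ↔ P.ParityStep x y := by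
  obtain ⟨x, v⟩ := x
  obtain ⟨y, u⟩ := y
  unfold NumStep
  rw [h.header0, h.header2, parityCode_div, parityCode_div]
  constructor
  · rintro (⟨hxy, a, ha, q₁, hq₁, q₁', hq₁', q₂, hq₂, q₂', hq₂', h1, h2, hbit⟩ |
      ⟨a, ha, q, hq, q', hq', hxy, h1, hbit⟩)
    · obtain rfl : x = y := Fin.ext hxy
      have hu : u = v + (RvProtocol.toggle ⟨q₁, hq₁⟩ ⟨q₁', hq₁'⟩ +
          RvProtocol.toggle ⟨q₂, hq₂⟩ ⟨q₂', hq₂'⟩) := by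
        funext i
        have := hbit i i.isLt
        rw [testBit_parityCode, testBit_parityCode] at this
        exact (toggle_toggle_iff _ _ _ _ _ _ _).2 this
      rw [hu]
      exact .proc ((h.useful_iff ⟨q₁, hq₁⟩ ⟨a, ha⟩ ⟨q₁', hq₁'⟩).1 h1)
        ((h.useful_iff ⟨q₂, hq₂⟩ ⟨a, ha⟩ ⟨q₂', hq₂'⟩).1 h2)
    · have hu : u = v + RvProtocol.toggle ⟨q, hq⟩ ⟨q', hq'⟩ := by
        funext i
        have := hbit i i.isLt
        rw [testBit_parityCode, testBit_parityCode] at this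
        exact (toggle_iff _ _ _ _ _).2 this
      rw [hu]
      exact .leader ((h.req_leader (a := ⟨a, ha⟩)).1 hxy)
        ((h.useful_iff ⟨q, hq⟩ ⟨a, ha⟩ ⟨q', hq'⟩).1 h1)
  · intro hstep
    cases hstep with
    | @proc _ _ a q₁ q₁' q₂ q₂' h1 h2 =>
      refine Or.inl ⟨rfl, a, a.isLt, q₁, q₁.isLt, q₁', q₁'.isLt, q₂, q₂.isLt, q₂', q₂'.isLt,
        (h.useful_iff _ _ _).2 h1, (h.useful_iff _ _ _).2 h2, fun i hi => ?_⟩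
      have h3 := testBit_parityCode (x, v) ⟨i, hi⟩
      have h4 := testBit_parityCode
        (x, v + (RvProtocol.toggle q₁ q₁' + RvProtocol.toggle q₂ q₂')) ⟨i, hi⟩
      simp only at h3 h4
      rw [h3, h4]
      exact (toggle_toggle_iff _ _ ⟨i, hi⟩ _ _ _ _).1 rfl
    | @leader _ _ _ a q q' h1 h2 =>
      refine Or.inr ⟨a, a.isLt, q, q.isLt, q', q'.isLt, h.req_leader.2 h1,
        (h.useful_iff _ _ _).2 h2, fun i hi => ?_⟩
      have h3 := testBit_parityCode (x, v) ⟨i, hi⟩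
      have h4 := testBit_parityCode (y, v + RvProtocol.toggle q q') ⟨i, hi⟩
      simp only at h3 h4
      rw [h3, h4]
      exact (toggle_iff _ _ ⟨i, hi⟩ _ _).1 rfl

/-- The dimension of `Fin m → ZMod 2` is `m`, which explains the length bound in `NumWalk`. -/
theorem numWalk_iff (h : Describes w P) (x y : Fin l × (Fin m → ZMod 2)) :
    NumWalk w (parityCode x) (parityCode y) ↔ ReflTransGen P.ParityStep x y := by
  unfold NumWalk
  rw [h.header0, h.header1]
  refine bddWalk_iff parityCode_lt (fun _ => exists_parityCode) parityCode_injective h.numStep_iff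
    (fun a b hab => ?_) x y
  simpa using exists_short_walk RvProtocol.ParityStep.translate hab

theorem accepts_iff (h : Describes w P) : Accepts w ↔ P.IsSymmetric ∧ P.HasCutoff := by
  have h0 := h.numWalk_iff (P.leaderInit, 0) (P.leaderFinal, 0)
  have h1 := h.numWalk_iff (P.leaderInit, Pi.single P.procInit 1)
    (P.leaderFinal, Pi.single P.procFinal 1)
  rw [parityCode_zero, parityCode_zero] at h0
  rw [parityCode_single, parityCode_single] at h1
  unfold Accepts
  rw [h.header0, h.header3, h.header4, h.header5, h.header6, h0, h1, ← h.isSymmetric_iff]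
  constructor
  · rintro ⟨-, hs, hw⟩
    exact ⟨hs, hs.hasCutoff_iff.2 hw⟩
  · rintro ⟨hs, hc⟩
    exact ⟨h.wellFormed, hs, hs.hasCutoff_iff.1 hc⟩

end Describes

theorem mem_symmetricCutoffProblem_iff (w : List Bool) :
    w ∈ symmetricCutoffProblem ↔ Accepts w := by
  constructor
  · rintro ⟨m, l, s, P, he, hs, hc⟩
    exact he.describes.accepts_iff.2 ⟨hs, hc⟩
  · intro h
    obtain ⟨P, hP⟩ := h.1.exists_isEncodedBy
    exact ⟨_, _, _, P, hP, hP.describes.accepts_iff.1 h⟩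

/-! ### The decision procedure needs polynomial space -/

namespace PSpace

variable {α : Type} [Coded α] {f : α → List Bool}

theorem wellFormed : PSpace WellFormed := by
  refine and (ball (const 7) ?_) (and (by fun_prop) ?_)
  · have := iterate (T := _root_.afterField) (by fun_prop) length_afterField_le
      (f := fun x : List Bool × ℕ => x.1) (n := fun x => x.2) (by fun_prop) (by fun_prop)
    fun_prop
  · refine bex (by fun_prop) (bex (by fun_prop) (and (by fun_prop) (ball (by fun_prop) ?_)))
    simp only [readEdge, decide_eq_true_iff]
    fun_prop

theorem listsEdge {q a q' : α → ℕ} (hf : PSpace f) (b c : Bool) (hq : PSpace q) (ha : PSpace a)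
    (hq' : PSpace q') : PSpace fun x => ListsEdge (f x) ⟨b, q x, c, a x, q' x⟩ := by
  refine bex (by fun_prop) (and (by fun_prop) ?_)
  refine congr_prop (p := fun x : α × ℕ =>
    (((_root_.edgesFrom (f x.1) x.2).head? = some true) ↔ b = true) ∧
    _root_.field (_root_.edgesFrom (f x.1) x.2).tail = q x.1 ∧
    ((_root_.afterField (_root_.edgesFrom (f x.1) x.2).tail).head? = some true ↔ c = true) ∧
    _root_.field (_root_.afterField (_root_.edgesFrom (f x.1) x.2).tail).tail = a x.1 ∧
    _root_.field (_root_.afterField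
      (_root_.afterField (_root_.edgesFrom (f x.1) x.2).tail).tail) = q' x.1) (by fun_prop) ?_
  rintro ⟨x, i⟩
  rw [RawEdge.ext_iff]
  simp only [readEdge]
  refine and_congr ?_ (and_congr_right fun _ => and_congr ?_ Iff.rfl)
  · cases b <;> simp
  · cases c <;> simp

theorem listsSymmetric : PSpace ListsSymmetric := by
  -- Edges are replaced by their positions in the list. `Bool` is not a coded type, so the two flags
  -- are constants and the four cases are treated separately.
  let Q : Bool → Bool → List Bool → ℕ → Prop := fun b c w i =>
    ((_root_.edgesFrom w i).head? = some true ↔ b = true) →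
    ((_root_.afterField (_root_.edgesFrom w i).tail).head? = some true ↔ c = true) →
    ListsEdge w ⟨b, _root_.field (_root_.edgesFrom w i).tail, !c,
      _root_.field (_root_.afterField (_root_.edgesFrom w i).tail).tail,
      _root_.field (_root_.afterField (_root_.afterField (_root_.edgesFrom w i).tail).tail)⟩
  have hQ : ∀ b c : Bool, PSpace fun x : List Bool × ℕ => Q b c x.1 x.2 := fun b c =>
    imp (by fun_prop) (imp (by fun_prop)
      (listsEdge (by fun_prop) _ _ (by fun_prop) (by fun_prop) (by fun_prop)))
  refine congr_prop (ball (b := fun w : List Bool => w.length + 1)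
    (p := fun w i => ¬ _root_.edgesFrom w i = [] →
      (Q true true w i ∧ Q true false w i) ∧ (Q false true w i ∧ Q false false w i)) (by fun_prop)
    (imp (by fun_prop) (and (and (hQ true true) (hQ true false))
      (and (hQ false true) (hQ false false)))))
    fun w => ?_
  constructor
  · intro h i hi hne
    have h1 := h _ ⟨i, hi, hne, rfl⟩
    have key : ∀ b c : Bool, ((_root_.edgesFrom w i).head? = some true ↔ b = true) →
        ((_root_.afterField (_root_.edgesFrom w i).tail).head? = some true ↔ c = true) →
        (readEdge (_root_.edgesFrom w i)).proc = b ∧ (readEdge (_root_.edgesFrom w i)).ans = c := by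
      intro b c hb hc
      simp only [readEdge, hb, hc]
      simp
    refine ⟨⟨?_, ?_⟩, ?_, ?_⟩ <;>
    · intro hb hc
      obtain ⟨e1, e2⟩ := key _ _ hb hc
      rw [e1, e2] at h1
      exact h1
  · rintro h e ⟨i, hi, hne, rfl⟩
    obtain ⟨⟨h1, h2⟩, h3, h4⟩ := h i hi hne
    by_cases hb : (_root_.edgesFrom w i).head? = some true <;>
      by_cases hc : (_root_.afterField (_root_.edgesFrom w i).tail).head? = some true
    · simpa [readEdge, hb, hc] using h1 (by simp [hb]) (by simp [hc])
    · simpa [readEdge, hb, hc] using h2 (by simp [hb]) (by simp [hc])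
    · simpa [readEdge, hb, hc] using h3 (by simp [hb]) (by simp [hc])
    · simpa [readEdge, hb, hc] using h4 (by simp [hb]) (by simp [hc])

theorem listsReach {q q' : α → ℕ} (hf : PSpace f) (hq : PSpace q) (hq' : PSpace q') :
    PSpace fun x => ListsReach (f x) (q x) (q' x) :=
  bddWalk (bex (by fun_prop) (listsEdge (by fun_prop) _ _ (by fun_prop) (by fun_prop)
    (by fun_prop))) (by fun_prop) (by fun_prop) (.header hf 0) hq hq'

theorem listsUseful {q a q' : α → ℕ} (hf : PSpace f) (hq : PSpace q) (ha : PSpace a)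
    (hq' : PSpace q') : PSpace fun x => ListsUseful (f x) (q x) (a x) (q' x) :=
  and (listsEdge hf _ _ hq ha hq') (and (listsReach hf (by fun_prop) hq)
    (listsReach hf hq' (by fun_prop)))

@[fun_prop]
theorem two_pow_header (hf : PSpace f) (j : ℕ) : PSpace fun x => 2 ^ _root_.header j (f x) :=
  pow (const 2) (by fun_prop) (.header hf j)

theorem numStep : PSpace fun x : List Bool × ℕ × ℕ => NumStep x.1 x.2.1 x.2.2 := by
  refine or (and (by fun_prop) (bex (by fun_prop) (bex (by fun_prop) (bex (by fun_prop)
    (bex (by fun_prop) (bex (by fun_prop) (and (listsUseful (by fun_prop) (by fun_prop)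
    (by fun_prop) (by fun_prop)) (and (listsUseful (by fun_prop) (by fun_prop)
    (by fun_prop) (by fun_prop)) (ball (by fun_prop) (by fun_prop)))))))))) ?_
  exact bex (by fun_prop) (bex (by fun_prop) (bex (by fun_prop) (and
    (listsEdge (by fun_prop) _ _ (by fun_prop) (by fun_prop) (by fun_prop))
    (and (listsUseful (by fun_prop) (by fun_prop) (by fun_prop) (by fun_prop))
      (ball (by fun_prop) (by fun_prop))))))

/-- The numbers of the header are in unary and hence at most the length of the word; so the walk has
polynomial length. -/
theorem numWalk {c c' : List Bool → ℕ} (hc : PSpace c) (hc' : PSpace c') :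
    PSpace fun w => NumWalk w (c w) (c' w) :=
  bddWalk numStep (by fun_prop) (by fun_prop)
    ((PolyBdd.header id 1).mul ((PolyBdd.header id 0).add (.const 1))) hc hc'

theorem accepts : PSpace Accepts :=
  and wellFormed (and listsSymmetric (and (numWalk (by fun_prop) (by fun_prop))
    (numWalk (by fun_prop) (by fun_prop))))

end PSpace

end

theorem mainTheorem4 : InPSPACE symmetricCutoffProblem := by
  have h : PSpace fun w : List Bool => w ∈ symmetricCutoffProblem :=
    PSpace.congr_prop PSpace.accepts mem_symmetricCutoffProblem_iff
  exact RegProg.IsComputable.inPSPACE (h (0 : Fin 1))
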